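/- **Model.** Let $d\ge 1$ and let $(X,Y)\in\mathbb R^d\times\{-1,1\}$ have the law $\rho$ of a two-class Gaussian mixture: $\{1,\dots,K\}=\mathcal T^+\sqcup\mathcal T^-$, $P(Y=1)=P^+$, $P(Y=-1)=P^-=1-P^+$, and given $Y=\pm1$ the point $X$ is drawn from component $j\in\mathcal T^\pm$ with probability $p_j$ (where $p_j\ge0$, $\sum_{j\in\mathcal T^+}p_j=\sum_{j\in\mathcal T^-}p_j=1$), component $j$ being Gaussian with mean $\mu_j\in\mathbb R^d$, nondegenerate covariance matrix $\Sigma_j$ and density $\mathcal N(x,\mu_j,\Sigma_j)$. No other restriction is made. Put $$D(x)=P^+\sum_{j\in\mathcal T^+}p_j\mathcal N(x,\mu_j,\Sigma_j)-P^-\sum_{j\in\mathcal T^-}p_j\mathcal N(x,\mu_j,\Sigma_j)=\sum_{j=1}^K\beta_j e^{-(x-\mu_j)^T\Sigma_j^{-1}(x-\mu_j)/2},$$ $\mu^*=\max_j\|\mu_j\|$, and let $\tilde\sigma$ and $\sigma^*$ be the smallest and the largest eigenvalue of all the $\Sigma_j$. Assume that for some $q>0$, $c_0>0$ we have $P(|D(X)|\le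 t)\le c_0t^q$ for all $t>0$. **Risks.** $\mathrm{sgn}(t)=1$ for $t\ge0$ and $-1$ otherwise; $R(f)=P(Y\,\mathrm{sgn}(f(X))=-1)$; $\phi(t)=\max\{0,1-t\}$, $\varepsilon(f)=\int\phi(yf(x))\,d\rho$, and $\varepsilon_z(f)=\frac1n\sum_{i=1}^n\phi(y_if(x_i))$ for a sample $z=\{(x_i,y_i)\}_{i=1}^n$. The Bayes classifier is $f_c(x)=1$ if $P(Y=1|X=x)\ge P(Y=-1|X=x)$ and $f_c(x)=-1$ otherwise. **Hypothesis space.** Let $\sigma(t)=\max\{t,0\}$. A squaring gate $\hat f_m$ is a univariate ReLU network $u\mapsto a\cdot\sigma(W^{(m)}\sigma(\cdots\sigma(W^{(1)}u+b^{(1)})\cdots)+b^{(m)})$ with $m$ hidden layers of width 5 and all parameters in $[-4,4]$. A product gate is $\hat\Phi(u,v)=\hat f_m(|\frac{u+v}2|)-\hat f_m(|\frac{u-v}2|)$, with the same $\hat f_m$ in both terms; different product gates have their own parameters. A binary tree network outputs $\hat h_1(u)=u$ and $\hat h_{2^s+i}(u)=\hat\Phi(\hat h_{2^s}(u),\hat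 h_i(u))$ for $0\le s<\ell$, $1\le i\le2^s$. Let $T_b(u)=\sigma(u+b+1)-\sigma(u+b)-\sigma(u-b)+\sigma(u-b-1)$, $\Psi_b(x)=\sigma(\sum_{i=1}^dT_b(x_i)-(d-1))$, and let $\sigma_\lambda(u)$ equal $1$ for $u\ge\lambda$, $u/\lambda$ for $-\lambda\le u<\lambda$, $-1$ for $u<-\lambda$. Then $\mathcal H$ consists of the functions $$\sigma_\lambda\Big(\sum_{j=1}^K\sum_{k=1}^{2^\ell}c_{k,j}\,\hat h_k^{(j)}\Big(\tfrac1d\sum_{i=1}^d\hat\Phi\big(w_{i,j}(x),w_{i,j}(x)\big)\Big)+c_{\mathrm{bias}}\Big),\qquad w_{i,j}(x)=\hat\Phi\big(\Psi_b(x),\mathring W_{i,j}\cdot x+\mathring b_{i,j}\big),$$ with one binary tree network $\hat h^{(j)}$ for every $j$, and $\|\mathring W_{i,j}\|\le C_K^0$, $|\mathring b_{i,j}|\le C_K^1$, $|c_{k,j}|,|c_{\mathrm{bias}}|\le C_K$. **Theorem.** Let $C_K^0\ge\sqrt d/\sqrt{\tilde\sigma}$, $C_K^1\ge\mu^*/\sqrt{\tilde\sigma}$,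 $c_2\ge\sum_j|\beta_j|$, $c_3\ge4d^2(C_K^0+C_K^1)^2$, and $c_q'=\dfrac{q\log2}{\frac1{16\sigma^*}+c_3q}$. There is a constant $C_{q,d}>0$, independent of $n$ and $\delta$, such that the following holds for all $n\ge3$ and $0<\delta<1$. Let $\ell$ be the smallest positive integer with $\ell2^{\ell-1}\ge\frac{16\sigma^*}{c_q'}\log n$, and take $m=\ell2^{\ell-1}$, $\lambda=n^{-1/q}$, $b=\sqrt{c_q'\ell2^{\ell-1}}$, $C_K=c_2\exp(c_3b^2)$. Let $z$ be an i.i.d. sample of size $n$ from $\rho$. With probability at least $1-\delta$, every minimizer $f_z$ of $\varepsilon_z$ over $\mathcal H$ satisfies $$R(\mathrm{sgn}f_z)-R(f_c)\le\varepsilon(f_z)-\varepsilon(f_c)\le C_{q,d}\log\Big(\frac2\delta\Big)(\log n)^4\Big(\frac1n\Big)^{\frac{q+1}{q+2}}.$$ -/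

import Mathlib

open MeasureTheory

noncomputable section

namespace GMMClassification

/-! ### Two-class Gaussian mixture models on `ℝ^d` -/

/-- The density at `x` of the Gaussian distribution on `ℝ^d` with mean `μ` and covariance `S`. -/
def gaussianDensity {d : ℕ} (μ : EuclideanSpace ℝ (Fin d)) (S : Matrix (Fin d) (Fin d) ℝ)
    (x : EuclideanSpace ℝ (Fin d)) : ℝ :=
  1 / Real.sqrt ((2 * Real.pi) ^ d * S.det) *
    Real.exp (-(1 / 2) * ((x - μ).ofLp ⬝ᵥ (S⁻¹).mulVec (x - μ).ofLp))

/-- A two-class Gaussian mixture model with `K` Gaussian components on `ℝ^d`. The components in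
`pos` belong to the class `1`, all the others belong to the class `-1`; `weight j` is the
conditional probability of the component `j` given its class, and `priorPos` is the probability of
the class `1`. The covariance matrices are nondegenerate and otherwise arbitrary. -/
structure GaussianMixture (d K : ℕ) where
  pos : Finset (Fin K)
  priorPos : ℝ
  priorPos_nonneg : 0 ≤ priorPos
  priorPos_le_one : priorPos ≤ 1
  weight : Fin K → ℝ
  weight_nonneg : ∀ j, 0 ≤ weight j
  sum_weight_pos : ∑ j ∈ pos, weight j = 1
  sum_weight_neg : ∑ j ∈ posᶜ, weight j = 1
  mean : Fin K → EuclideanSpace ℝ (Fin d)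
  cov : Fin K → Matrix (Fin d) (Fin d) ℝ
  cov_posDef : ∀ j, (cov j).PosDef

namespace GaussianMixture

variable {d K : ℕ} (G : GaussianMixture d K)

/-- The class label, `1` or `-1`, of the component `j`. -/
def label (j : Fin K) : ℝ := if j ∈ G.pos then 1 else -1

/-- The prior probability of the class of the component `j`. -/
def classPrior (j : Fin K) : ℝ := if j ∈ G.pos then G.priorPos else 1 - G.priorPos

/-- The joint law of `(X, Y)`: the component `j` is drawn with probability
`classPrior j * weight j`, then `X` is drawn from the Gaussian distribution `j`, and `Y` is the
label of the class of `j`. -/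
def law : Measure (EuclideanSpace ℝ (Fin d) × ℝ) :=
  ∑ j, ENNReal.ofReal (G.classPrior j * G.weight j) •
    (volume.withDensity fun x => ENNReal.ofReal (gaussianDensity (G.mean j) (G.cov j) x)).map
      (fun x => (x, G.label j))

/-- The discriminant function of the positive class. -/
def discrPos (x : EuclideanSpace ℝ (Fin d)) : ℝ :=
  G.priorPos * ∑ j ∈ G.pos, G.weight j * gaussianDensity (G.mean j) (G.cov j) x

/-- The discriminant function of the negative class. -/
def discrNeg (x : EuclideanSpace ℝ (Fin d)) : ℝ :=
  (1 - G.priorPos) * ∑ j ∈ G.posᶜ, G.weight j * gaussianDensity (G.mean j) (G.cov j) x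

/-- The discriminant function `D` of the model. -/
def discr (x : EuclideanSpace ℝ (Fin d)) : ℝ := G.discrPos x - G.discrNeg x

/-- The coefficient `β j` of `exp (-(x - μ j)ᵀ (Σ j)⁻¹ (x - μ j) / 2)` in `D`. -/
def coeff (j : Fin K) : ℝ :=
  G.label j * (G.classPrior j * G.weight j) / Real.sqrt ((2 * Real.pi) ^ d * (G.cov j).det)

/-- The largest norm of the means. -/
def meanBound : ℝ := ⨆ j, ‖G.mean j‖

/-- The smallest eigenvalue of all the covariance matrices. -/
def eigMin : ℝ := ⨅ p : Fin K × Fin d, (G.cov_posDef p.1).isHermitian.eigenvalues p.2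

/-- The largest eigenvalue of all the covariance matrices. -/
def eigMax : ℝ := ⨆ p : Fin K × Fin d, (G.cov_posDef p.1).isHermitian.eigenvalues p.2

/-- The noise condition `P(|D(X)| ≤ t) ≤ c₀ t^q` for all `t > 0`. -/
def NoiseCondition (c₀ q : ℝ) : Prop :=
  ∀ t : ℝ, 0 < t → G.law {z | |G.discr z.1| ≤ t} ≤ ENNReal.ofReal (c₀ * t ^ q)

end GaussianMixture

/-! ### Binary classification -/

section Classification

variable {X : Type*} [MeasurableSpace X]

/-- The sign, with values in `{-1, 1}`. -/
def sgn (t : ℝ) : ℝ := if 0 ≤ t then 1 else -1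

/-- The misclassification error `R(f) = P(Y sgn(f(X)) = -1)`. -/
def misclassError (ρ : Measure (X × ℝ)) (f : X → ℝ) : ℝ :=
  ρ.real {z | z.2 * sgn (f z.1) = -1}

/-- The hinge loss. -/
def hinge (t : ℝ) : ℝ := max 0 (1 - t)

/-- The generalization error `ε(f)` for the hinge loss. -/
def hingeRisk (ρ : Measure (X × ℝ)) (f : X → ℝ) : ℝ := ∫ z, hinge (z.2 * f z.1) ∂ρ

/-- The empirical risk `ε_z(f)` for the hinge loss over the sample `z`. -/
def empHingeRisk {n : ℕ} (z : Fin n → X × ℝ) (f : X → ℝ) : ℝ :=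
  1 / (n : ℝ) * ∑ i, hinge ((z i).2 * f (z i).1)

/-- `f` minimizes the empirical hinge risk over the sample `z` in the class `H`. -/
def IsERM {n : ℕ} (H : Set (X → ℝ)) (z : Fin n → X × ℝ) (f : X → ℝ) : Prop :=
  f ∈ H ∧ ∀ g ∈ H, empHingeRisk z f ≤ empHingeRisk z g

/-- The conditional probability `P(Y = y | X = x)`: the density of `A ↦ P(X ∈ A, Y = y)` with
respect to the law of `X`. -/
def posterior (ρ : Measure (X × ℝ)) (y : ℝ) : X → ENNReal :=
  ((ρ.restrict {z | z.2 = y}).map Prod.fst).rnDeriv (ρ.map Prod.fst)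

open Classical in
/-- The Bayes classifier `f_c`. -/
def bayes (ρ : Measure (X × ℝ)) (x : X) : ℝ :=
  if posterior ρ (-1) x ≤ posterior ρ 1 x then 1 else -1

end Classification

/-! ### ReLU gates -/

/-- The ReLU function. -/
def relu (t : ℝ) : ℝ := max t 0

/-- The weights of a univariate ReLU network all of whose hidden layers have width `5`: the
`5 × 1` weight matrix `W₁` of the first hidden layer, the weight matrix `W j` of the hidden layer
`j + 1` (only `j ≥ 1` is used), the bias vector `β j` of the hidden layer `j + 1`, and the outer
weight `a`. A network with `m` hidden layers uses only the layers up to `m`. -/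
structure GateParams where
  W₁ : Fin 5 → ℝ
  W : ℕ → Matrix (Fin 5) (Fin 5) ℝ
  β : ℕ → Fin 5 → ℝ
  a : Fin 5 → ℝ

namespace GateParams

/-- All the parameters lie in `[-4, 4]`. -/
def Bounded (θ : GateParams) : Prop :=
  (∀ i, |θ.W₁ i| ≤ 4) ∧ (∀ j i k, |θ.W j i k| ≤ 4) ∧ (∀ j i, |θ.β j i| ≤ 4) ∧ ∀ i, |θ.a i| ≤ 4

/-- The output of the hidden layer `j + 1` for the input `u`. -/
def hidden (θ : GateParams) (u : ℝ) : ℕ → Fin 5 → ℝ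
  | 0 => fun i => relu (θ.W₁ i * u + θ.β 0 i)
  | j + 1 => fun i => relu ((θ.W (j + 1)).mulVec (θ.hidden u j) i + θ.β (j + 1) i)

/-- The squaring gate: the ReLU network with `m ≥ 1` hidden layers of width `5`. -/
def squareGate (θ : GateParams) (m : ℕ) (u : ℝ) : ℝ := θ.a ⬝ᵥ θ.hidden u (m - 1)

/-- The product gate. -/
def productGate (θ : GateParams) (m : ℕ) (u v : ℝ) : ℝ :=
  θ.squareGate m |(u + v) / 2| - θ.squareGate m |(u - v) / 2|

end GateParams

/-- The output `ĥ k (u)`, `k ≥ 1`, of the expansive binary tree network: `ĥ 1 (u) = u`, and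
`ĥ (2 ^ j + i)` for `1 ≤ i ≤ 2 ^ j` is the output of a product gate for the inputs `ĥ (2 ^ j) (u)`
and `ĥ i (u)`. The product gate that outputs `ĥ k` has the parameters `θ k`. -/
def treeGate (θ : ℕ → GateParams) (m : ℕ) (u : ℝ) (k : ℕ) : ℝ :=
  if _h : k ≤ 1 then u
  else (θ k).productGate m (treeGate θ m u (2 ^ Nat.log 2 (k - 1)))
    (treeGate θ m u (k - 2 ^ Nat.log 2 (k - 1)))
termination_by k
decreasing_by
  · have := Nat.pow_log_le_self 2 (x := k - 1) (by omega)
    omega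
  · have := Nat.pow_pos (n := Nat.log 2 (k - 1)) (show 0 < 2 by norm_num)
    omega

theorem treeGate_one (θ : ℕ → GateParams) (m : ℕ) (u : ℝ) : treeGate θ m u 1 = u := by
  rw [treeGate]; simp

theorem treeGate_two_pow_add (θ : ℕ → GateParams) (m : ℕ) (u : ℝ) {j i : ℕ} (hi : 1 ≤ i)
    (hij : i ≤ 2 ^ j) :
    treeGate θ m u (2 ^ j + i) =
      (θ (2 ^ j + i)).productGate m (treeGate θ m u (2 ^ j)) (treeGate θ m u i) := by
  have hpos : 0 < 2 ^ j := Nat.pow_pos (by norm_num)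
  have hlog : Nat.log 2 (2 ^ j + i - 1) = j := by
    apply Nat.log_eq_of_pow_le_of_lt_pow
    · omega
    · rw [pow_succ]; omega
  rw [treeGate, dif_neg (by omega), hlog, Nat.add_sub_cancel_left]

/-! ### The hypothesis space -/

/-- The univariate trapezoid function `T_b`. -/
def trapezoid (b u : ℝ) : ℝ :=
  relu (u + b + 1) - relu (u + b) - relu (u - b) + relu (u - b - 1)

/-- The truncation function `Ψ_b` on `ℝ^d`. -/
def truncation {d : ℕ} (b : ℝ) (x : EuclideanSpace ℝ (Fin d)) : ℝ :=
  relu (∑ i, trapezoid b (x i) - ((d : ℝ) - 1))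

/-- The scaling unit `σ_l`, an approximation of the sign for small `l > 0`. -/
def scaling (l u : ℝ) : ℝ :=
  relu (u / l) - relu (u / l - 1) - relu (-u / l) + relu (-u / l - 1)

theorem scaling_eq {l : ℝ} (hl : 0 < l) (u : ℝ) :
    scaling l u = if l ≤ u then 1 else if -l ≤ u then u / l else -1 := by
  have h1 : l ≤ u ↔ 1 ≤ u / l := by rw [le_div_iff₀ hl, one_mul]
  have h2 : -l ≤ u ↔ -1 ≤ u / l := by rw [le_div_iff₀ hl, neg_one_mul]
  simp only [scaling, relu, h1, h2, neg_div]
  generalize u / l = v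
  split_ifs <;> rcases le_total v 0 with h | h <;>
    simp only [max_def] <;> split_ifs <;> linarith

/-- The free parameters of a network of the hypothesis space: for every component `j`, the affine
maps `x ↦ ⟪w i j, x⟫ + v i j`, the parameters of the `d` product gates that truncate them, of the
`d` product gates that square the results, and of the product gates of the binary tree network,
and finally the coefficients `c k j` and `c₀` of the output. -/
structure NetParams (d K : ℕ) where
  w : Fin d → Fin K → EuclideanSpace ℝ (Fin d)
  v : Fin d → Fin K → ℝ
  pre : Fin d → Fin K → GateParams
  sq : Fin d → Fin K → GateParams
  tree : Fin K → ℕ → GateParams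
  c : ℕ → Fin K → ℝ
  c₀ : ℝ

namespace NetParams

variable {d K : ℕ} (P : NetParams d K)

/-- The constraints on the parameters. -/
def Admissible (CK0 CK1 CK : ℝ) : Prop :=
  (∀ i j, ‖P.w i j‖ ≤ CK0) ∧ (∀ i j, |P.v i j| ≤ CK1) ∧
  (∀ i j, (P.pre i j).Bounded) ∧ (∀ i j, (P.sq i j).Bounded) ∧
  (∀ j k, (P.tree j k).Bounded) ∧ (∀ k j, |P.c k j| ≤ CK) ∧ |P.c₀| ≤ CK

/-- The affine map `r̂ i j`. -/
def affine (i : Fin d) (j : Fin K) (x : EuclideanSpace ℝ (Fin d)) : ℝ :=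
  inner ℝ (P.w i j) x + P.v i j

/-- The output of the truncating product gate for the inputs `Ψ_b(x)` and `r̂ i j (x)`. -/
def truncated (b : ℝ) (m : ℕ) (i : Fin d) (j : Fin K) (x : EuclideanSpace ℝ (Fin d)) : ℝ :=
  (P.pre i j).productGate m (truncation b x) (P.affine i j x)

/-- The function `h* k j`. -/
def hStar (b : ℝ) (m k : ℕ) (j : Fin K) (x : EuclideanSpace ℝ (Fin d)) : ℝ :=
  treeGate (P.tree j) m
    (1 / (d : ℝ) * ∑ i, (P.sq i j).productGate m (P.truncated b m i j x) (P.truncated b m i j x)) k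

/-- The function computed by the network. -/
def toFun (l b : ℝ) (m ℓ : ℕ) (x : EuclideanSpace ℝ (Fin d)) : ℝ :=
  scaling l (∑ j, ∑ k ∈ Finset.Icc 1 (2 ^ ℓ), P.c k j * P.hStar b m k j x + P.c₀)

end NetParams

/-- The hypothesis space. -/
def hypothesisSpace (d K : ℕ) (CK0 CK1 CK l b : ℝ) (m ℓ : ℕ) :
    Set (EuclideanSpace ℝ (Fin d) → ℝ) :=
  {f | ∃ P : NetParams d K, P.Admissible CK0 CK1 CK ∧ f = P.toFun l b m ℓ}

/-- The constant `c_q'` in the choice of the network parameters. -/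
def cPrime (q c₃ sMax : ℝ) : ℝ := q * Real.log 2 / (1 / (16 * sMax) + c₃ * q)

end GMMClassification

end

/-!
The excess risk of the empirical minimizer splits into an estimation part, which depends on the
hypothesis space only through its metric entropy, and an approximation part, for which one network
of the hypothesis space with a small excess risk has to be exhibited.

**Excess risk.** The law of the mixture has the two class densities `a = G.discrPos` and `c =
G.discrNeg` with respect to Lebesgue measure (`law_eq_twoDensityLaw`), the discriminant function
is `D = a - c`, and the Bayes classifier is almost everywhere the sign of `D`. For functions with
values in `[-1, 1]` the hinge loss is affine, so the excess hinge risk of `f` is `∫ |f - f_c| |D|`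
(`hingeRisk_sub_hingeRisk_bayes`). This gives the comparison with the misclassification error
(`misclassError_sub_le_hingeRisk_sub`) and, by a splitting at `|D| = t`, the variance bound of the
excess loss under the noise condition (`mul_integral_sq_excess_le`).

**Estimation.** A one-sided Bernstein inequality on a finite net, with the variance bound absorbed
into half of the excess risk, yields the oracle inequality `pi_isERM_le`: up to constants, the
excess risk of a minimizer is at most the best excess risk in the class, plus `r ^ (1 + q)`, plus
`(log N + log (1 / δ)) / (r * n)`, where `N` is the size of the net. With `r` of order `n ^ (-1 /
(q + 2))` both last terms have the order `n ^ (-(q + 1) / (q + 2))`, up to logarithms. The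
networks depend Lipschitz continuously on their parameters (`NetParams.abs_toFun_sub_le`), with a
constant whose logarithm is at most of order `m ^ 2 + log n`, and there are at most of the order
of `m ^ 2` parameters. Rounding the parameters to a grid gives nets with `log N` of order `m ^ 2 *
(m ^ 2 + log n)`, that is `(log n) ^ 4` (`hasNet_hypothesisSpace`, `exists_hasNet_log_le`).

**Approximation.** On the cube of radius `b` the truncation is inactive, and the mass outside of
it is of order `exp (-b ^ 2 / (8 * σ*))` (`exists_setIntegral_compl_cube_le`). With `Σ⁻¹ = Bᵀ *
B`, the exponent of a Gaussian component is a multiple, of order `m`, of a mean of squares of `d`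
affine maps that are bounded by `1` on the cube (`exists_affine_maps`). A gate with `m` hidden
layers computes squares up to an error `4 ^ (-m)`, by means of `y - y ^ 2 = ∑ 4⁻ˢ * tent^[s] y`.
What remains is the approximation of `exp (-(L * u))`, for `L` of order `m`, on the unit interval
by the outputs of one tree network, with an error of about `2 ^ (-m / 2)`; a polynomial in `u`
whose degree is the number `2 ^ ℓ` of outputs is not accurate enough, since for large `ℓ` this
number is smaller than `L`. A gate can however compute more than squares, because its weights are
free: it computes the iterate `tent^[ℓ]` and, suitably normalized, decreasing convex piecewise
linear functions with up to `m` knots (`isGate_sum_relu`). The interval is divided into the cells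
of the zigzag function `tent^[ℓ]`. In each cell, with the local coordinate `σ ∈ [-1, 1]`, the
exponential function is `v * exp (R * σ)` with `R` of order only `ℓ`, and `w = σ ^ 2 = (tent^[ℓ]
u) ^ 2` is available on all the cells at once. The values of `v` and of `v * σ` are contained in
the piecewise linear interpolations `V` and `W` of `exp (-(L * u))` and `exp (-(L * u / 2))` at
the end points of the cells, as `V = v * (cosh R + σ * sinh R)` and `V - W ^ 2 = v * sinh (R / 2)
^ 2 * (1 - σ ^ 2)` (`exists_expInterp_eq`). The Taylor polynomial of `exp (R * σ)`, multiplied by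
`v`, is a combination of `V * w ^ k` and `(V - W ^ 2) * w ^ k` up to the error of the Taylor
polynomial at the two end points (`exists_abs_exp_sub_le`). The gates `3`, `5` and `8` of the tree
provide `V`, `W ^ 2` and `w`, and the structure of the tree then provides the products with all
powers `w ^ k`, `8 * k < 2 ^ ℓ` (`abs_treeGate_sub_pow_mul_le`, `exists_treeGate_exp`). The Taylor
polynomial has degree below `J = 2 ^ (ℓ - 2)`, so that the error is of order `R ^ J / J!`, which
is about `2 ^ (-ℓ * 2 ^ (ℓ - 2)) = 2 ^ (-m / 2)` (`eventually_error_le`).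

**Choice of the parameters.** The hypotheses on the constants imply `m * log 2 ≥ (1 / q + 64) *
log n` and `b ^ 2 ≥ 16 * σ* * log n` (`depth_bounds`). Hence, for large depth, the approximation
error is below `n ^ (-1 / (2 * q) - 1)` and the tails are below `1 / n ^ 2`, and the scaling unit
of width `n ^ (-1 / q)` converts this into an excess risk of the order of the rate
(`exists_mem_hypothesisSpace_risk_le`, `exists_rate`). Small depth only occurs for bounded `n`,
where the trivial bound `2` of the excess risk suffices.
-/

noncomputable section

namespace GMMClassification

/-! ### Binary classification with two class densities -/

section TwoDensities

variable {X : Type*} [MeasurableSpace X]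

/-- The joint law of `(X, Y)` for which `P(X ∈ A, Y = 1)` has density `a` and `P(X ∈ A, Y = -1)` has
density `c` with respect to `ν`. -/
def twoDensityLaw (ν : Measure X) (a c : X → ℝ) : Measure (X × ℝ) :=
  (ν.withDensity fun x => ENNReal.ofReal (a x)).map (fun x => (x, (1 : ℝ))) +
    (ν.withDensity fun x => ENNReal.ofReal (c x)).map (fun x => (x, (-1 : ℝ)))

theorem integrable_map_withDensity {ν : Measure X} {a : X → ℝ} (ha : Measurable a)
    (ha0 : ∀ x, 0 ≤ a x) (hai : Integrable a ν) {φ : X × ℝ → ℝ} (hφ : Measurable φ) {y B : ℝ}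
    (hB : ∀ x, |φ (x, y)| ≤ B) :
    Integrable φ ((ν.withDensity fun x => ENNReal.ofReal (a x)).map (fun x => (x, y))) ∧
    Integrable (fun x => a x * φ (x, y)) ν ∧
    ∫ z, φ z ∂((ν.withDensity fun x => ENNReal.ofReal (a x)).map (fun x => (x, y))) =
      ∫ x, a x * φ (x, y) ∂ν := by
  have hm : Measurable fun x : X => (x, y) := by fun_prop
  have hm' : Measurable fun x => φ (x, y) := hφ.comp hm
  have hi : Integrable (fun x => a x * φ (x, y)) ν := by
    refine Integrable.mono' (hai.mul_const B) (ha.mul hm').aestronglyMeasurable ?_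
    filter_upwards with x
    rw [Real.norm_eq_abs, abs_mul, abs_of_nonneg (ha0 x)]
    exact mul_le_mul_of_nonneg_left (hB x) (ha0 x)
  refine ⟨?_, hi, ?_⟩
  · rw [integrable_map_measure hφ.aestronglyMeasurable hm.aemeasurable]
    rw [integrable_withDensity_iff_integrable_smul₀' (by fun_prop) (by simp)]
    simpa [ENNReal.toReal_ofReal (ha0 _), Function.comp_def] using hi
  · rw [integral_map hm.aemeasurable hφ.aestronglyMeasurable,
      integral_withDensity_eq_integral_toReal_smul (by fun_prop) (by simp)]
    simp [ENNReal.toReal_ofReal (ha0 _)]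

variable {ν : Measure X} {a c : X → ℝ}

/-- Integration of a bounded function against the law with class densities `a` and `c`. -/
theorem integrable_twoDensityLaw (ha : Measurable a) (hc : Measurable c) (ha0 : ∀ x, 0 ≤ a x)
    (hc0 : ∀ x, 0 ≤ c x) (hai : Integrable a ν) (hci : Integrable c ν) {φ : X × ℝ → ℝ}
    (hφ : Measurable φ) {B : ℝ} (hB : ∀ x, |φ (x, 1)| ≤ B) (hB' : ∀ x, |φ (x, -1)| ≤ B) :
    Integrable φ (twoDensityLaw ν a c) ∧
    Integrable (fun x => a x * φ (x, 1) + c x * φ (x, -1)) ν ∧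
    ∫ z, φ z ∂(twoDensityLaw ν a c) = ∫ x, a x * φ (x, 1) + c x * φ (x, -1) ∂ν := by
  obtain ⟨h1, h2, h3⟩ := integrable_map_withDensity ha ha0 hai hφ hB
  obtain ⟨k1, k2, k3⟩ := integrable_map_withDensity hc hc0 hci hφ hB'
  refine ⟨h1.add_measure k1, h2.add k2, ?_⟩
  rw [twoDensityLaw, integral_add_measure h1 k1, h3, k3, integral_add h2 k2]

theorem twoDensityLaw_ae (ν : Measure X) (a c : X → ℝ) :
    ∀ᵐ z ∂(twoDensityLaw ν a c), z.2 = 1 ∨ z.2 = -1 := by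
  have hms : MeasurableSet {z : X × ℝ | z.2 = 1 ∨ z.2 = -1} :=
    (measurableSet_eq_fun measurable_snd measurable_const).union
      (measurableSet_eq_fun measurable_snd measurable_const)
  rw [twoDensityLaw, ae_add_measure_iff]
  constructor
  · rw [ae_map_iff (by fun_prop) hms]; simp
  · rw [ae_map_iff (by fun_prop) hms]; simp

theorem measurable_bayes (ρ : Measure (X × ℝ)) : Measurable (bayes ρ) := by
  unfold bayes posterior
  exact Measurable.ite (measurableSet_le (Measure.measurable_rnDeriv _ _)
    (Measure.measurable_rnDeriv _ _)) measurable_const measurable_const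

theorem bayes_eq_or (ρ : Measure (X × ℝ)) (x : X) : bayes ρ x = 1 ∨ bayes ρ x = -1 := by
  unfold bayes; split_ifs <;> simp

theorem twoDensityLaw_map_fst (ν : Measure X) (ha : Measurable a)
    (ha0 : ∀ x, 0 ≤ a x) (hc0 : ∀ x, 0 ≤ c x) :
    (twoDensityLaw ν a c).map Prod.fst =
      ν.withDensity fun x => ENNReal.ofReal (a x + c x) := by
  rw [twoDensityLaw, Measure.map_add _ _ measurable_fst, Measure.map_map measurable_fst (by fun_prop),
    Measure.map_map measurable_fst (by fun_prop)]
  have : (fun x => ENNReal.ofReal (a x + c x)) =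
      (fun x => ENNReal.ofReal (a x)) + fun x => ENNReal.ofReal (c x) := by
    ext x; simp [ENNReal.ofReal_add (ha0 x) (hc0 x)]
  rw [this, withDensity_add_left (by fun_prop)]
  simp [Function.comp_def]

theorem twoDensityLaw_restrict_map_fst (ν : Measure X) (a c : X → ℝ) :
    ((twoDensityLaw ν a c).restrict {z | z.2 = 1}).map Prod.fst =
      (ν.withDensity fun x => ENNReal.ofReal (a x)) ∧
    ((twoDensityLaw ν a c).restrict {z | z.2 = -1}).map Prod.fst =
      (ν.withDensity fun x => ENNReal.ofReal (c x)) := by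
  have h1 : MeasurableSet {z : X × ℝ | z.2 = 1} :=
    measurableSet_eq_fun measurable_snd measurable_const
  have h2 : MeasurableSet {z : X × ℝ | z.2 = -1} :=
    measurableSet_eq_fun measurable_snd measurable_const
  have hne : ¬ ((-1 : ℝ) = 1) := by norm_num
  have hne' : ¬ ((1 : ℝ) = -1) := by norm_num
  constructor <;> ext s hs <;>
    rw [Measure.map_apply measurable_fst hs, Measure.restrict_apply (measurable_fst hs),
      twoDensityLaw, Measure.add_apply, Measure.map_apply (by fun_prop)
        ((measurable_fst hs).inter (by assumption)),
      Measure.map_apply (by fun_prop) ((measurable_fst hs).inter (by assumption))] <;>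
    simp [Set.preimage, hne, hne']

/-- Up to a null set, the Bayes classifier is the sign of `a - c`. -/
theorem bayes_mul_sub [SigmaFinite ν] (ha : Measurable a) (hc : Measurable c)
    (ha0 : ∀ x, 0 ≤ a x) (hc0 : ∀ x, 0 ≤ c x) (hpos : ∀ x, 0 < a x + c x) :
    ∀ᵐ x ∂ν, bayes (twoDensityLaw ν a c) x * (a x - c x) = |a x - c x| := by
  set p : X → ENNReal := fun x => ENNReal.ofReal (a x + c x) with hp
  have hpm : Measurable p := by fun_prop
  have hp0 : ∀ x, p x ≠ 0 := fun x => by simp [hp, hpos x]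
  have hpt : ∀ x, p x ≠ ⊤ := fun x => by simp [hp]
  have : SigmaFinite (ν.withDensity p) :=
    SigmaFinite.withDensity_of_ne_top (by simp [hpt])
  -- The posterior probabilities are Radon-Nikodym derivatives with respect to the law of `X`, which
  -- has the density `p`. As `p` is positive, they are the quotients of the densities.
  have key : ∀ u : X → ℝ, Measurable u →
      (ν.withDensity fun x => ENNReal.ofReal (u x)).rnDeriv (ν.withDensity p)
        =ᵐ[ν] fun x => ENNReal.ofReal (u x) / p x := by
    intro u hu
    have hq : Measurable fun x => ENNReal.ofReal (u x) / p x := by fun_prop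
    have e : (ν.withDensity fun x => ENNReal.ofReal (u x)) =
        (ν.withDensity p).withDensity fun x => ENNReal.ofReal (u x) / p x := by
      rw [← withDensity_mul _ hpm hq]
      congr 1; ext x
      simp only [Pi.mul_apply]
      rw [ENNReal.mul_div_cancel (hp0 x) (hpt x)]
    rw [e]
    have h := Measure.rnDeriv_withDensity (ν.withDensity p) hq
    exact (withDensity_absolutelyContinuous' hpm.aemeasurable
      (Filter.Eventually.of_forall hp0)).ae_eq h
  have hA := key a ha
  have hC := key c hc
  obtain ⟨r1, r2⟩ := twoDensityLaw_restrict_map_fst ν a c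
  filter_upwards [hA, hC] with x h1 h2
  unfold bayes posterior
  rw [r1, r2, twoDensityLaw_map_fst ν ha ha0 hc0, h1, h2]
  have hiff : ENNReal.ofReal (c x) / p x ≤ ENNReal.ofReal (a x) / p x ↔ c x ≤ a x := by
    rw [ENNReal.div_le_iff (hp0 x) (hpt x), ENNReal.div_mul_cancel (hp0 x) (hpt x),
      ENNReal.ofReal_le_ofReal_iff (ha0 x)]
  simp only [hiff]
  split_ifs with h
  · rw [one_mul, abs_of_nonneg (by linarith)]
  · rw [abs_of_nonpos (by linarith)]; ring

theorem hinge_le_two {t : ℝ} (h : |t| ≤ 1) : |hinge t| ≤ 2 := by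
  have := abs_le.mp h
  unfold hinge
  rw [abs_of_nonneg (le_max_left _ _)]
  exact max_le (by norm_num) (by linarith)

theorem hinge_eq {t : ℝ} (h : |t| ≤ 1) : hinge t = 1 - t := by
  have := abs_le.mp h
  exact max_eq_right (by linarith)

theorem abs_hinge_sub_hinge_le (s t : ℝ) : |hinge s - hinge t| ≤ |s - t| := by
  unfold hinge
  rw [max_comm 0, max_comm 0]
  refine (abs_max_sub_max_le_abs _ _ _).trans_eq ?_
  rw [show 1 - s - (1 - t) = -(s - t) by ring, abs_neg]

theorem measurable_hinge : Measurable hinge := by unfold hinge; fun_prop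

theorem hingeRisk_twoDensityLaw (ha : Measurable a) (hc : Measurable c) (ha0 : ∀ x, 0 ≤ a x)
    (hc0 : ∀ x, 0 ≤ c x) (hai : Integrable a ν) (hci : Integrable c ν) {f : X → ℝ}
    (hf : Measurable f) (hf1 : ∀ x, |f x| ≤ 1) :
    Integrable (fun x => a x * (1 - f x) + c x * (1 + f x)) ν ∧
    hingeRisk (twoDensityLaw ν a c) f = ∫ x, a x * (1 - f x) + c x * (1 + f x) ∂ν := by
  have hφ : Measurable fun z : X × ℝ => hinge (z.2 * f z.1) :=
    measurable_hinge.comp (measurable_snd.mul (hf.comp measurable_fst))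
  obtain ⟨-, h2, h3⟩ := integrable_twoDensityLaw ha hc ha0 hc0 hai hci hφ (B := 2)
    (fun x => hinge_le_two (by simpa using hf1 x)) (fun x => hinge_le_two (by simpa using hf1 x))
  have e : (fun x => a x * hinge (1 * f x) + c x * hinge (-1 * f x)) =
      fun x => a x * (1 - f x) + c x * (1 + f x) := by
    ext x
    rw [hinge_eq (by simpa using hf1 x), hinge_eq (by simpa using hf1 x)]; ring
  simp only [e] at h2 h3
  exact ⟨h2, h3⟩

/-- The excess hinge risk of a function with values in `[-1, 1]`. -/
theorem hingeRisk_sub_hingeRisk_bayes [SigmaFinite ν] (ha : Measurable a) (hc : Measurable c)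
    (ha0 : ∀ x, 0 ≤ a x) (hc0 : ∀ x, 0 ≤ c x) (hai : Integrable a ν) (hci : Integrable c ν)
    (hpos : ∀ x, 0 < a x + c x) {f : X → ℝ} (hf : Measurable f) (hf1 : ∀ x, |f x| ≤ 1) :
    Integrable (fun x => |f x - bayes (twoDensityLaw ν a c) x| * |a x - c x|) ν ∧
    hingeRisk (twoDensityLaw ν a c) f - hingeRisk (twoDensityLaw ν a c)
        (bayes (twoDensityLaw ν a c)) =
      ∫ x, |f x - bayes (twoDensityLaw ν a c) x| * |a x - c x| ∂ν := by
  set s := bayes (twoDensityLaw ν a c) with hs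
  have hs1 : ∀ x, |s x| ≤ 1 := fun x => by
    rcases bayes_eq_or (twoDensityLaw ν a c) x with h | h <;> simp [hs, h]
  obtain ⟨i1, e1⟩ := hingeRisk_twoDensityLaw ha hc ha0 hc0 hai hci hf hf1
  obtain ⟨i2, e2⟩ := hingeRisk_twoDensityLaw ha hc ha0 hc0 hai hci
    (measurable_bayes (twoDensityLaw ν a c)) hs1
  have hae : (fun x => (a x * (1 - f x) + c x * (1 + f x)) - (a x * (1 - s x) + c x * (1 + s x)))
      =ᵐ[ν] fun x => |f x - s x| * |a x - c x| := by
    filter_upwards [bayes_mul_sub (ν := ν) ha hc ha0 hc0 hpos] with x hx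
    rw [← hs] at hx
    have h1 := abs_le.mp (hf1 x)
    rw [← hx]
    rcases bayes_eq_or (twoDensityLaw ν a c) x with h | h <;> rw [← hs] at h <;> rw [h]
    · rw [abs_of_nonpos (by linarith)]; ring
    · rw [abs_of_nonneg (by linarith)]; ring
  exact ⟨(i1.sub i2).congr hae, by rw [e1, e2, ← integral_sub i1 i2]; exact integral_congr_ae hae⟩

theorem sgn_eq_or (t : ℝ) : sgn t = 1 ∨ sgn t = -1 := by
  unfold sgn; split_ifs <;> simp

theorem measurable_sgn : Measurable sgn :=
  Measurable.ite measurableSet_Ici measurable_const measurable_const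

theorem misclassError_twoDensityLaw (ha : Measurable a) (hc : Measurable c) (ha0 : ∀ x, 0 ≤ a x)
    (hc0 : ∀ x, 0 ≤ c x) (hai : Integrable a ν) (hci : Integrable c ν) {f : X → ℝ}
    (hf : Measurable f) :
    Integrable (fun x => a x * ((1 - sgn (f x)) / 2) + c x * ((1 + sgn (f x)) / 2)) ν ∧
    misclassError (twoDensityLaw ν a c) f =
      ∫ x, a x * ((1 - sgn (f x)) / 2) + c x * ((1 + sgn (f x)) / 2) ∂ν := by
  have hms : MeasurableSet {z : X × ℝ | z.2 * sgn (f z.1) = -1} :=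
    measurableSet_eq_fun (measurable_snd.mul (measurable_sgn.comp (hf.comp measurable_fst)))
      measurable_const
  have hφ : Measurable ({z : X × ℝ | z.2 * sgn (f z.1) = -1}.indicator (1 : X × ℝ → ℝ)) :=
    measurable_one.indicator hms
  have hb : ∀ z, |{z : X × ℝ | z.2 * sgn (f z.1) = -1}.indicator (1 : X × ℝ → ℝ) z| ≤ 1 := by
    intro z; by_cases h : z ∈ {z : X × ℝ | z.2 * sgn (f z.1) = -1} <;> simp [Set.indicator, h]
  obtain ⟨-, h2, h3⟩ := integrable_twoDensityLaw ha hc ha0 hc0 hai hci hφ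
    (fun x => hb _) (fun x => hb _)
  have e : (fun x => a x * {z : X × ℝ | z.2 * sgn (f z.1) = -1}.indicator (1 : X × ℝ → ℝ) (x, 1) +
      c x * {z : X × ℝ | z.2 * sgn (f z.1) = -1}.indicator (1 : X × ℝ → ℝ) (x, -1)) =
      fun x => a x * ((1 - sgn (f x)) / 2) + c x * ((1 + sgn (f x)) / 2) := by
    ext x
    rcases sgn_eq_or (f x) with h | h <;> norm_num [Set.indicator, h]
  rw [e] at h2
  simp only [e] at h3
  refine ⟨h2, ?_⟩
  rw [← h3, integral_indicator_one hms, misclassError]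

/-- Zhang's comparison inequality for functions with values in `[-1, 1]`. -/
theorem misclassError_sub_le_hingeRisk_sub [SigmaFinite ν] (ha : Measurable a) (hc : Measurable c)
    (ha0 : ∀ x, 0 ≤ a x) (hc0 : ∀ x, 0 ≤ c x) (hai : Integrable a ν) (hci : Integrable c ν)
    (hpos : ∀ x, 0 < a x + c x) {f : X → ℝ} (hf : Measurable f) (hf1 : ∀ x, |f x| ≤ 1) :
    misclassError (twoDensityLaw ν a c) (fun x => sgn (f x)) -
      misclassError (twoDensityLaw ν a c) (bayes (twoDensityLaw ν a c)) ≤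
    hingeRisk (twoDensityLaw ν a c) f - hingeRisk (twoDensityLaw ν a c)
        (bayes (twoDensityLaw ν a c)) := by
  obtain ⟨i0, e0⟩ := hingeRisk_sub_hingeRisk_bayes (ν := ν) ha hc ha0 hc0 hai hci hpos hf hf1
  obtain ⟨i1, e1⟩ := misclassError_twoDensityLaw (ν := ν) ha hc ha0 hc0 hai hci
    (measurable_sgn.comp hf)
  obtain ⟨i2, e2⟩ := misclassError_twoDensityLaw (ν := ν) ha hc ha0 hc0 hai hci
    (measurable_bayes (twoDensityLaw ν a c))
  simp only [Function.comp_def] at i1 e1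
  rw [e0, e1, e2, ← integral_sub i1 i2]
  refine integral_mono_ae (i1.sub i2) i0 ?_
  filter_upwards [bayes_mul_sub (ν := ν) ha hc ha0 hc0 hpos] with x hx
  set s := bayes (twoDensityLaw ν a c) with hs
  have h1 := abs_le.mp (hf1 x)
  have hsgn1 : sgn 1 = 1 := by simp [sgn]
  have hsgn2 : sgn (-1) = -1 := by norm_num [sgn]
  have h2 : |a x - c x| ≥ 0 := abs_nonneg _
  rcases bayes_eq_or (twoDensityLaw ν a c) x with h | h <;> rw [← hs] at h <;> rw [h] at hx ⊢ <;>
    by_cases h0 : 0 ≤ f x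
  · simp only [sgn, h0]; norm_num; positivity
  · have : sgn (f x) = -1 := by simp [sgn, h0]
    rw [this, hsgn1, hsgn2, abs_of_nonpos (by linarith : f x - 1 ≤ 0)]
    push Not at h0
    nlinarith
  · have : sgn (f x) = 1 := by simp [sgn, h0]
    rw [this, hsgn1, hsgn2, abs_of_nonneg (by linarith : 0 ≤ f x - -1)]
    nlinarith
  · have : sgn (f x) = -1 := by simp [sgn, h0]
    rw [this, hsgn2]; norm_num; positivity

/-- The excess hinge risk of a function that agrees with the sign of `a - c` on `S` wherever
`|a - c| > t`. -/
theorem hingeRisk_sub_le_of_eq_sign [SigmaFinite ν] (ha : Measurable a) (hc : Measurable c)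
    (ha0 : ∀ x, 0 ≤ a x) (hc0 : ∀ x, 0 ≤ c x) (hai : Integrable a ν) (hci : Integrable c ν)
    (hpos : ∀ x, 0 < a x + c x) {f : X → ℝ} (hf : Measurable f) (hf1 : ∀ x, |f x| ≤ 1)
    {S : Set X} (hS : MeasurableSet S) {t : ℝ}
    (h : ∀ x ∈ S, t < |a x - c x| → f x * (a x - c x) = |a x - c x|) :
    hingeRisk (twoDensityLaw ν a c) f - hingeRisk (twoDensityLaw ν a c)
        (bayes (twoDensityLaw ν a c)) ≤
      2 * ∫ x in {x | |a x - c x| ≤ t}, (a x + c x) ∂ν + 2 * ∫ x in Sᶜ, (a x + c x) ∂ν := by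
  obtain ⟨i0, e0⟩ := hingeRisk_sub_hingeRisk_bayes (ν := ν) ha hc ha0 hc0 hai hci hpos hf hf1
  have hT : MeasurableSet {x | |a x - c x| ≤ t} :=
    measurableSet_le (by fun_prop) measurable_const
  have hi : Integrable (fun x => a x + c x) ν := hai.add hci
  rw [e0, ← integral_indicator hT, ← integral_indicator hS.compl, ← integral_const_mul,
    ← integral_const_mul, ← integral_add ((hi.indicator hT).const_mul 2)
      ((hi.indicator hS.compl).const_mul 2)]
  refine integral_mono_ae i0 (((hi.indicator hT).const_mul 2).add
    ((hi.indicator hS.compl).const_mul 2)) ?_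
  filter_upwards [bayes_mul_sub (ν := ν) ha hc ha0 hc0 hpos] with x hx
  set s := bayes (twoDensityLaw ν a c) with hs
  have hq : |a x - c x| ≤ a x + c x := by
    rw [abs_le]; constructor <;> linarith [ha0 x, hc0 x]
  have hfs : |f x - s x| ≤ 2 := by
    have hs1 : |s x| ≤ 1 := by
      rcases bayes_eq_or (twoDensityLaw ν a c) x with h | h <;> simp [hs, h]
    linarith [abs_sub (f x) (s x), hf1 x]
  have hle : |f x - s x| * |a x - c x| ≤ 2 * (a x + c x) :=
    mul_le_mul hfs hq (abs_nonneg _) (by norm_num)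
  have hp := (hpos x).le
  by_cases h1 : x ∈ S
  · by_cases h2 : |a x - c x| ≤ t
    · have : x ∈ {x | |a x - c x| ≤ t} := h2
      simp only [Set.indicator_of_mem this]
      have : 0 ≤ (Sᶜ).indicator (fun x => a x + c x) x := Set.indicator_nonneg (fun y _ => (hpos y).le) x
      linarith
    · have e := h x h1 (not_le.mp h2)
      have : (f x - s x) * (a x - c x) = 0 := by rw [sub_mul, e, hx, sub_self]
      rw [← abs_mul, this, abs_zero]
      have k1 : 0 ≤ (Sᶜ).indicator (fun x => a x + c x) x := Set.indicator_nonneg (fun y _ => (hpos y).le) x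
      have k2 : 0 ≤ ({x | |a x - c x| ≤ t}).indicator (fun x => a x + c x) x :=
        Set.indicator_nonneg (fun y _ => (hpos y).le) x
      linarith
  · have : x ∈ Sᶜ := h1
    simp only [Set.indicator_of_mem this]
    have k2 : 0 ≤ ({x | |a x - c x| ≤ t}).indicator (fun x => a x + c x) x :=
        Set.indicator_nonneg (fun y _ => (hpos y).le) x
    linarith

/-- The variance bound of the hinge loss under a margin condition: the second moment of the excess
loss is controlled by the mass of `{|a - c| ≤ t}` and by the excess risk. -/
theorem integral_sq_excess_le [SigmaFinite ν] (ha : Measurable a) (hc : Measurable c)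
    (ha0 : ∀ x, 0 ≤ a x) (hc0 : ∀ x, 0 ≤ c x) (hai : Integrable a ν) (hci : Integrable c ν)
    (hpos : ∀ x, 0 < a x + c x) {f : X → ℝ} (hf : Measurable f) (hf1 : ∀ x, |f x| ≤ 1)
    {t M : ℝ} (ht : 0 < t) (hM : ∀ x, a x + c x ≤ M) :
    ∫ z, (hinge (z.2 * f z.1) - hinge (z.2 * bayes (twoDensityLaw ν a c) z.1)) ^ 2
        ∂(twoDensityLaw ν a c) ≤
      4 * ∫ x in {x | |a x - c x| ≤ t}, (a x + c x) ∂ν +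
        2 * (M / t) * (hingeRisk (twoDensityLaw ν a c) f - hingeRisk (twoDensityLaw ν a c)
        (bayes (twoDensityLaw ν a c))) := by
  obtain ⟨i0, e0⟩ := hingeRisk_sub_hingeRisk_bayes (ν := ν) ha hc ha0 hc0 hai hci hpos hf hf1
  set s := bayes (twoDensityLaw ν a c) with hs
  have hsm : Measurable s := measurable_bayes _
  have hs1 : ∀ x, |s x| ≤ 1 := fun x => by
    rcases bayes_eq_or (twoDensityLaw ν a c) x with h | h <;> simp [hs, h]
  have hT : MeasurableSet {x | |a x - c x| ≤ t} :=
    measurableSet_le (by fun_prop) measurable_const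
  have hi : Integrable (fun x => a x + c x) ν := hai.add hci
  have hφ : Measurable fun z : X × ℝ => (hinge (z.2 * f z.1) - hinge (z.2 * s z.1)) ^ 2 :=
    ((measurable_hinge.comp (measurable_snd.mul (hf.comp measurable_fst))).sub
      (measurable_hinge.comp (measurable_snd.mul (hsm.comp measurable_fst)))).pow_const 2
  have hfs : ∀ x, |f x - s x| ≤ 2 := fun x => by linarith [abs_sub (f x) (s x), hf1 x, hs1 x]
  have v1 : ∀ x, (hinge (1 * f x) - hinge (1 * s x)) ^ 2 = |f x - s x| ^ 2 := fun x => by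
    rw [hinge_eq (by simpa using hf1 x), hinge_eq (by simpa using hs1 x), sq_abs]; ring
  have v2 : ∀ x, (hinge (-1 * f x) - hinge (-1 * s x)) ^ 2 = |f x - s x| ^ 2 := fun x => by
    rw [hinge_eq (by simpa using hf1 x), hinge_eq (by simpa using hs1 x), sq_abs]; ring
  have hsq : ∀ x, |f x - s x| ^ 2 ≤ 4 := fun x => by
    nlinarith [hfs x, abs_nonneg (f x - s x)]
  obtain ⟨-, h2, h3⟩ := integrable_twoDensityLaw ha hc ha0 hc0 hai hci hφ (B := 4)
    (fun x => by rw [v1, abs_of_nonneg (by positivity)]; exact hsq x)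
    (fun x => by rw [v2, abs_of_nonneg (by positivity)]; exact hsq x)
  simp only [v1, v2] at h2 h3
  rw [h3, e0, ← integral_indicator hT, ← integral_const_mul,
    ← integral_const_mul, ← integral_add ((hi.indicator hT).const_mul 4) (i0.const_mul _)]
  refine integral_mono h2 (((hi.indicator hT).const_mul 4).add (i0.const_mul _)) fun x => ?_
  have hp := (hpos x).le
  have hM0 : 0 ≤ M := hp.trans (hM x)
  have hn := abs_nonneg (f x - s x)
  show a x * |f x - s x| ^ 2 + c x * |f x - s x| ^ 2 ≤ _
  rw [← add_mul]
  by_cases h2 : |a x - c x| ≤ t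
  · have hmem : x ∈ {x | |a x - c x| ≤ t} := h2
    simp only [Set.indicator_of_mem hmem]
    have : 0 ≤ 2 * (M / t) * (|f x - s x| * |a x - c x|) := by positivity
    nlinarith [hsq x]
  · have hmem : x ∉ {x | |a x - c x| ≤ t} := h2
    simp only [Set.indicator_of_notMem hmem, mul_zero, zero_add]
    push Not at h2
    have h4 : a x + c x ≤ M / t * |a x - c x| := by
      have : M ≤ M / t * |a x - c x| := by
        rw [div_mul_eq_mul_div, le_div_iff₀ ht]
        exact mul_le_mul_of_nonneg_left h2.le hM0
      exact (hM x).trans this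
    have h5 : |f x - s x| ^ 2 ≤ 2 * |f x - s x| := by nlinarith [hfs x]
    calc (a x + c x) * |f x - s x| ^ 2 ≤ (M / t * |a x - c x|) * (2 * |f x - s x|) :=
          mul_le_mul h4 h5 (by positivity) (by positivity)
      _ = _ := by ring

end TwoDensities

/-! ### One-sided Bernstein inequalities and empirical risk minimization -/

section Concentration

variable {Ω : Type*} [MeasurableSpace Ω] {ρ : Measure Ω} [IsProbabilityMeasure ρ]

/-- The bound of the Laplace transform behind Bernstein's inequality, from `exp x ≤ 1 + x + x ^ 2` for
`|x| ≤ 1`. -/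
theorem integral_exp_neg_mul_le {g : Ω → ℝ} (hg : Measurable g) (hb : ∀ᵐ z ∂ρ, |g z| ≤ 2)
    {r : ℝ} (hr0 : 0 ≤ r) (hr : r ≤ 1 / 2) :
    Integrable (fun z => Real.exp (-r * g z)) ρ ∧
    ∫ z, Real.exp (-r * g z) ∂ρ ≤ Real.exp (-r * ∫ z, g z ∂ρ + r ^ 2 * ∫ z, g z ^ 2 ∂ρ) := by
  have hx : ∀ᵐ z ∂ρ, |-r * g z| ≤ 1 := by
    filter_upwards [hb] with z hz
    rw [abs_mul, abs_neg, abs_of_nonneg hr0]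
    nlinarith [abs_nonneg (g z)]
  have i1 : Integrable g ρ :=
    Integrable.mono' (integrable_const 2) hg.aestronglyMeasurable (by simpa using hb)
  have i2 : Integrable (fun z => g z ^ 2) ρ := by
    refine Integrable.mono' (integrable_const 4) (hg.pow_const 2).aestronglyMeasurable ?_
    filter_upwards [hb] with z hz
    rw [Real.norm_eq_abs, abs_pow]
    nlinarith [abs_nonneg (g z)]
  have i3 : Integrable (fun z => Real.exp (-r * g z)) ρ := by
    refine Integrable.mono' (integrable_const (Real.exp 1))
      (Real.measurable_exp.comp (hg.const_mul _)).aestronglyMeasurable ?_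
    filter_upwards [hx] with z hz
    rw [Real.norm_eq_abs, abs_of_pos (Real.exp_pos _)]
    exact Real.exp_le_exp.mpr (abs_le.mp hz).2
  refine ⟨i3, ?_⟩
  calc ∫ z, Real.exp (-r * g z) ∂ρ ≤ ∫ z, (1 + -r * g z + r ^ 2 * g z ^ 2) ∂ρ := by
        refine integral_mono_ae i3 (((integrable_const 1).add (i1.const_mul _)).add
          (i2.const_mul _)) ?_
        filter_upwards [hx] with z hz
        have := (abs_le.mp (Real.abs_exp_sub_one_sub_id_le hz)).2
        change _ ≤ 1 + -r * g z + r ^ 2 * g z ^ 2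
        nlinarith
    _ = 1 + (-r * ∫ z, g z ∂ρ + r ^ 2 * ∫ z, g z ^ 2 ∂ρ) := by
        have j1 : Integrable (fun z => -r * g z) ρ := i1.const_mul _
        have j2 : Integrable (fun z => r ^ 2 * g z ^ 2) ρ := i2.const_mul _
        have j3 : Integrable (fun z => 1 + -r * g z) ρ := (integrable_const 1).add j1
        rw [integral_add j3 j2, integral_add (integrable_const 1) j1, integral_const_mul,
          integral_const_mul]
        simp [add_assoc]
    _ ≤ _ := by
        have := Real.add_one_le_exp (-r * ∫ z, g z ∂ρ + r ^ 2 * ∫ z, g z ^ 2 ∂ρ)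
        linarith

/-- A one-sided Bernstein inequality for an i.i.d. sample, with a free parameter `r`. -/
theorem pi_empirical_mean_lt_le {n : ℕ} (hn : 0 < n) {g : Ω → ℝ} (hg : Measurable g)
    (hb : ∀ᵐ z ∂ρ, |g z| ≤ 2) {r : ℝ} (hr0 : 0 < r) (hr : r ≤ 1 / 2) (s : ℝ) :
    Measure.pi (fun _ : Fin n => ρ) {z | 1 / (n : ℝ) * ∑ i, g (z i) <
        ∫ z, g z ∂ρ - r * ∫ z, g z ^ 2 ∂ρ - s / (r * n)} ≤ ENNReal.ofReal (Real.exp (-s)) := by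
  obtain ⟨hi, hle⟩ := integral_exp_neg_mul_le hg hb hr0.le hr
  set A := ∫ z, g z ∂ρ
  set V := ∫ z, g z ^ 2 ∂ρ
  have hn' : (0 : ℝ) < n := by exact_mod_cast hn
  set θ := Real.exp (n * (-r * A + r ^ 2 * V) + s) with hθ
  have hprod : ∀ z : Fin n → Ω, ∏ i, Real.exp (-r * g (z i)) = Real.exp (-r * ∑ i, g (z i)) := by
    intro z; rw [← Real.exp_sum, Finset.mul_sum]
  have hsub : {z : Fin n → Ω | 1 / (n : ℝ) * ∑ i, g (z i) < A - r * V - s / (r * n)} ⊆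
      {z | θ ≤ ∏ i, Real.exp (-r * g (z i))} := by
    intro z hz
    simp only [Set.mem_ofPred_eq] at hz ⊢
    rw [hprod, hθ]
    refine Real.exp_le_exp.mpr ?_
    have h1 : ∑ i, g (z i) ≤ n * (A - r * V - s / (r * n)) := by
      rw [one_div, inv_mul_eq_div, div_lt_iff₀ hn'] at hz; linarith
    have h2 : r * (n * (A - r * V - s / (r * n))) = r * n * A - r ^ 2 * n * V - s := by
      field_simp
    nlinarith
  have hint : Integrable (fun z : Fin n → Ω => ∏ i, Real.exp (-r * g (z i)))
      (Measure.pi fun _ : Fin n => ρ) := Integrable.fintype_prod (fun _ => hi)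
  have hval : ∫ z, ∏ i, Real.exp (-r * g (z i)) ∂(Measure.pi fun _ : Fin n => ρ) ≤
      Real.exp (n * (-r * A + r ^ 2 * V)) := by
    have e := integral_fintype_prod_eq_pow (μ := ρ) (ι := Fin n)
      (fun z => Real.exp (-r * g z))
    rw [e, Fintype.card_fin, Real.exp_nat_mul]
    exact pow_le_pow_left₀ (integral_nonneg fun _ => (Real.exp_pos _).le) hle n
  have hmk := mul_meas_ge_le_integral_of_nonneg (μ := Measure.pi fun _ : Fin n => ρ)
    (Filter.Eventually.of_forall fun z => Finset.prod_nonneg fun i _ =>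
      (Real.exp_pos (-r * g (z i))).le) hint θ
  have hθ0 : 0 < θ := Real.exp_pos _
  have hreal : (Measure.pi fun _ : Fin n => ρ).real {z | θ ≤ ∏ i, Real.exp (-r * g (z i))} ≤
      Real.exp (-s) := by
    have : θ * (Measure.pi fun _ : Fin n => ρ).real {z | θ ≤ ∏ i, Real.exp (-r * g (z i))} ≤
        θ * Real.exp (-s) := by
      refine (hmk.trans hval).trans_eq ?_
      rw [hθ, ← Real.exp_add]; congr 1; ring
    exact le_of_mul_le_mul_left this hθ0
  refine (measure_mono hsub).trans ?_
  rw [← ENNReal.ofReal_toReal (measure_ne_top (Measure.pi fun _ : Fin n => ρ) _)]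
  exact ENNReal.ofReal_le_ofReal hreal

end Concentration

theorem abs_hinge_mul_sub_le {y : ℝ} (hy : y = 1 ∨ y = -1) (u v : ℝ) :
    |hinge (y * u) - hinge (y * v)| ≤ |u - v| := by
  refine (abs_hinge_sub_hinge_le _ _).trans_eq ?_
  rw [← mul_sub, abs_mul]
  rcases hy with h | h <;> simp [h]

theorem empHingeRisk_le_add {X : Type*} {n : ℕ} (hn : 0 < n) {z : Fin n → X × ℝ}
    (hz : ∀ i, (z i).2 = 1 ∨ (z i).2 = -1) {f g : X → ℝ} {τ : ℝ} (h : ∀ x, |f x - g x| ≤ τ) :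
    empHingeRisk z f ≤ empHingeRisk z g + τ := by
  have hn' : (0 : ℝ) < n := by exact_mod_cast hn
  have : ∑ i, hinge ((z i).2 * f (z i).1) ≤ ∑ i, (hinge ((z i).2 * g (z i).1) + τ) :=
    Finset.sum_le_sum fun i _ => by
      have := (abs_le.mp ((abs_hinge_mul_sub_le (hz i) _ _).trans (h (z i).1))).2
      linarith
  rw [Finset.sum_add_distrib] at this
  simp only [Finset.sum_const, Finset.card_univ, Fintype.card_fin, nsmul_eq_mul] at this
  unfold empHingeRisk
  calc _ ≤ 1 / (n : ℝ) * (∑ i, hinge ((z i).2 * g (z i).1) + n * τ) := by gcongr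
    _ = _ := by field_simp

section ERM

variable {X : Type*} [MeasurableSpace X] {ρ : Measure (X × ℝ)} [IsProbabilityMeasure ρ]

theorem integrable_hinge (hy : ∀ᵐ z ∂ρ, z.2 = 1 ∨ z.2 = -1) {f : X → ℝ} (hf : Measurable f)
    (hf1 : ∀ x, |f x| ≤ 1) : Integrable (fun z => hinge (z.2 * f z.1)) ρ := by
  refine Integrable.mono' (integrable_const 2)
    (measurable_hinge.comp (measurable_snd.mul (hf.comp measurable_fst))).aestronglyMeasurable ?_
  filter_upwards [hy] with z hz
  refine hinge_le_two ?_
  rcases hz with h | h <;> simpa [h] using hf1 z.1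

theorem hingeRisk_le_add (hy : ∀ᵐ z ∂ρ, z.2 = 1 ∨ z.2 = -1) {f g : X → ℝ} (hf : Measurable f)
    (hf1 : ∀ x, |f x| ≤ 1) (hg : Measurable g) (hg1 : ∀ x, |g x| ≤ 1) {τ : ℝ}
    (h : ∀ x, |f x - g x| ≤ τ) : hingeRisk ρ f ≤ hingeRisk ρ g + τ := by
  have i1 := integrable_hinge hy hf hf1
  have i2 := integrable_hinge hy hg hg1
  have : hingeRisk ρ f ≤ ∫ z, (hinge (z.2 * g z.1) + τ) ∂ρ := by
    refine integral_mono_ae i1 (i2.add (integrable_const τ)) ?_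
    filter_upwards [hy] with z hz
    have := (abs_le.mp ((abs_hinge_mul_sub_le hz _ _).trans (h z.1))).2
    linarith
  rw [integral_add i2 (integrable_const τ)] at this
  simpa [hingeRisk] using this

/-- An oracle inequality for empirical risk minimizers over a class with a finite uniform net `T`,
under the variance condition `hvar`. Outside of an event of small probability, the Bernstein
inequality holds for the excess losses of all members of the net, from below, and of the competitor
`f₀`, from above. The variance condition turns both into bounds by half of the excess risk. -/
theorem pi_isERM_le (hy : ∀ᵐ z ∂ρ, z.2 = 1 ∨ z.2 = -1) {n : ℕ} (hn : 0 < n)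
    {H : Set (X → ℝ)} {T : Finset (X → ℝ)} {τ : ℝ}
    (hH : ∀ f ∈ H, Measurable f ∧ ∀ x, |f x| ≤ 1) (hTH : ∀ f ∈ T, f ∈ H)
    (hT : ∀ f ∈ H, ∃ g ∈ T, ∀ x, |f x - g x| ≤ τ)
    {b : X → ℝ} (hb : Measurable b) (hb1 : ∀ x, |b x| ≤ 1) {f₀ : X → ℝ} (hf₀ : f₀ ∈ H)
    {r v : ℝ} (hr0 : 0 < r) (hr : r ≤ 1 / 2)
    (hvar : ∀ f ∈ H, r * ∫ z, (hinge (z.2 * f z.1) - hinge (z.2 * b z.1)) ^ 2 ∂ρ ≤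
      (hingeRisk ρ f - hingeRisk ρ b) / 2 + v) (s : ℝ) :
    Measure.pi (fun _ : Fin n => ρ) {z | ¬ ∀ f, IsERM H z f → hingeRisk ρ f - hingeRisk ρ b ≤
        3 * (hingeRisk ρ f₀ - hingeRisk ρ b) + 4 * v + 4 * (s / (r * n)) + 3 * τ} ≤
      ENNReal.ofReal ((T.card + 1) * Real.exp (-s)) := by
  classical
  set μ := Measure.pi (fun _ : Fin n => ρ)
  set g : (X → ℝ) → X × ℝ → ℝ := fun f z => hinge (z.2 * f z.1) - hinge (z.2 * b z.1) with hg
  have hgm : ∀ f, Measurable f → Measurable (g f) := fun f hf =>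
    (measurable_hinge.comp (measurable_snd.mul (hf.comp measurable_fst))).sub
      (measurable_hinge.comp (measurable_snd.mul (hb.comp measurable_fst)))
  have hg2 : ∀ f, (∀ x, |f x| ≤ 1) → ∀ᵐ z ∂ρ, |g f z| ≤ 2 := fun f hf => by
    filter_upwards [hy] with z hz
    refine (abs_hinge_mul_sub_le hz _ _).trans ?_
    linarith [abs_sub (f z.1) (b z.1), hf z.1, hb1 z.1]
  have hgi : ∀ f, Measurable f → (∀ x, |f x| ≤ 1) →
      ∫ z, g f z ∂ρ = hingeRisk ρ f - hingeRisk ρ b := fun f hf hf1 =>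
    integral_sub (integrable_hinge hy hf hf1) (integrable_hinge hy hb hb1)
  have hge : ∀ (z : Fin n → X × ℝ) f, 1 / (n : ℝ) * ∑ i, g f (z i) =
      empHingeRisk z f - empHingeRisk z b := fun z f => by
    simp only [hg, empHingeRisk, Finset.sum_sub_distrib, mul_sub]
  set bad : (X → ℝ) → Set (Fin n → X × ℝ) := fun f => {z | 1 / (n : ℝ) * ∑ i, g f (z i) <
        ∫ z, g f z ∂ρ - r * ∫ z, g f z ^ 2 ∂ρ - s / (r * n)} with hbad
  set bad₀ : Set (Fin n → X × ℝ) := {z | 1 / (n : ℝ) * ∑ i, (fun z => -g f₀ z) (z i) <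
        ∫ z, (fun z => -g f₀ z) z ∂ρ - r * ∫ z, (fun z => -g f₀ z) z ^ 2 ∂ρ - s / (r * n)}
    with hbad₀
  set Y : Set (Fin n → X × ℝ) := {z | ¬ ∀ i, (z i).2 = 1 ∨ (z i).2 = -1} with hY
  have hY0 : μ Y = 0 := by
    have : ∀ᵐ z ∂μ, ∀ i, (z i).2 = 1 ∨ (z i).2 = -1 := by
      rw [ae_all_iff]
      exact fun i => (Measure.quasiMeasurePreserving_eval (fun _ : Fin n => ρ) i).ae hy
    exact this
  have h0 := hH f₀ hf₀
  -- The labels are `1` or `-1` outside of the null set `Y`.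
  have hsub : {z | ¬ ∀ f, IsERM H z f → hingeRisk ρ f - hingeRisk ρ b ≤
        3 * (hingeRisk ρ f₀ - hingeRisk ρ b) + 4 * v + 4 * (s / (r * n)) + 3 * τ} ⊆
      (⋃ f ∈ T, bad f) ∪ bad₀ ∪ Y := by
    intro z hz
    by_contra hcon
    simp only [Set.mem_union, Set.mem_iUnion, not_or, not_exists] at hcon
    obtain ⟨⟨hc1, hc2⟩, hc3⟩ := hcon
    simp only [hY, Set.mem_ofPred_eq, not_not] at hc3
    apply hz
    intro f hf
    have hfH := hH f hf.1
    obtain ⟨f', hf'T, hff'⟩ := hT f hf.1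
    have hf'H := hH f' (hTH f' hf'T)
    have a1 := hc1 f' hf'T
    simp only [hbad, Set.mem_ofPred_eq, not_lt] at a1
    rw [hge, hgi f' hf'H.1 hf'H.2] at a1
    have a2 : ∫ z, g f₀ z ∂ρ + r * ∫ z, g f₀ z ^ 2 ∂ρ + s / (r * n) ≥
        1 / (n : ℝ) * ∑ i, g f₀ (z i) := by
      simp only [hbad₀, Set.mem_ofPred_eq, not_lt, integral_neg, Finset.sum_neg_distrib,
        mul_neg, neg_sq] at hc2
      linarith
    rw [hge, hgi f₀ h0.1 h0.2] at a2
    have v1 := hvar f' (hTH f' hf'T)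
    have v2 := hvar f₀ hf₀
    have e1 := empHingeRisk_le_add hn hc3 (f := f') (g := f) (τ := τ)
      (fun x => by rw [abs_sub_comm]; exact hff' x)
    have e2 := hf.2 f₀ hf₀
    have e3 := hingeRisk_le_add hy hfH.1 hfH.2 hf'H.1 hf'H.2 hff'
    simp only [hg] at a1 a2
    linarith
  refine (measure_mono hsub).trans ?_
  refine (measure_union_le _ _).trans ?_
  rw [hY0, add_zero]
  refine (measure_union_le _ _).trans ?_
  have b1 : μ (⋃ f ∈ T, bad f) ≤ T.card * ENNReal.ofReal (Real.exp (-s)) := by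
    refine (measure_biUnion_finset_le _ _).trans ?_
    refine (Finset.sum_le_sum (g := fun _ => ENNReal.ofReal (Real.exp (-s))) fun f hf => ?_).trans
      (by simp)
    have := hH f (hTH f hf)
    exact pi_empirical_mean_lt_le hn (hgm f this.1) (hg2 f this.2) hr0 hr s
  have b2 : μ bad₀ ≤ ENNReal.ofReal (Real.exp (-s)) :=
    pi_empirical_mean_lt_le hn (hgm f₀ h0.1).neg (by simpa using hg2 f₀ h0.2) hr0 hr s
  refine (add_le_add b1 b2).trans_eq ?_
  rw [ENNReal.ofReal_mul (by positivity), ENNReal.ofReal_add (by positivity) zero_le_one,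
    ENNReal.ofReal_natCast, ENNReal.ofReal_one, add_mul, one_mul]

end ERM

/-! ### Gaussian densities -/

section Gaussian

open scoped MatrixOrder in
/-- A square root of the precision matrix. It turns the quadratic form of a Gaussian density into the
squared norm of the image under a linear map. -/
theorem exists_inv_eq_transpose_mul_self {d : ℕ} {S : Matrix (Fin d) (Fin d) ℝ} (hS : S.PosDef) :
    ∃ B : Matrix (Fin d) (Fin d) ℝ, S⁻¹ = B.transpose * B ∧ |B.det| * Real.sqrt S.det = 1 := by
  obtain ⟨B, hB⟩ := CStarAlgebra.nonneg_iff_eq_star_mul_self.mp hS.inv.posSemidef.nonneg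
  rw [Matrix.star_eq_conjTranspose, Matrix.conjTranspose_eq_transpose_of_trivial] at hB
  refine ⟨B, hB, ?_⟩
  have h1 := congrArg Matrix.det hB
  rw [Matrix.det_mul, Matrix.det_transpose, Matrix.det_nonsing_inv, Ring.inverse_eq_inv'] at h1
  have hp := hS.det_pos
  rw [← Real.sqrt_sq_eq_abs, ← Real.sqrt_mul (sq_nonneg _), sq, ← h1, inv_mul_cancel₀ hp.ne',
    Real.sqrt_one]

theorem dotProduct_transpose_mul_self {d : ℕ} (B : Matrix (Fin d) (Fin d) ℝ)
    (x : EuclideanSpace ℝ (Fin d)) :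
    x.ofLp ⬝ᵥ (B.transpose * B).mulVec x.ofLp = ‖B.toEuclideanLin x‖ ^ 2 := by
  rw [← Matrix.mulVec_mulVec, Matrix.dotProduct_mulVec, Matrix.vecMul_transpose,
    EuclideanSpace.real_norm_sq_eq]
  simp [dotProduct, sq]

theorem integral_comp_toEuclideanLin {d : ℕ} {B : Matrix (Fin d) (Fin d) ℝ} (hB : B.det ≠ 0)
    (g : EuclideanSpace ℝ (Fin d) → ℝ) :
    ∫ x, g (B.toEuclideanLin x) = |B.det|⁻¹ * ∫ x, g x := by
  have hdet : LinearMap.det B.toEuclideanLin = B.det := by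
    rw [Matrix.toEuclideanLin_eq_toLin_orthonormal, LinearMap.det_toLin]
  have hd : LinearMap.det B.toEuclideanLin ≠ 0 := by rwa [hdet]
  have hemb : MeasurableEmbedding (B.toEuclideanLin) := by
    have := (LinearEquiv.ofIsUnitDet (f := B.toEuclideanLin)
      (v := (EuclideanSpace.basisFun (Fin d) ℝ).toBasis) (v' := (EuclideanSpace.basisFun (Fin d) ℝ).toBasis)
      (by rw [LinearMap.det_toMatrix]; exact hd.isUnit)).toContinuousLinearEquiv.toHomeomorph.measurableEmbedding
    exact this
  rw [← hemb.integral_map, Measure.map_linearMap_addHaar_eq_smul_addHaar volume hd,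
    integral_smul_measure, hdet, abs_inv, ENNReal.toReal_ofReal (by positivity), smul_eq_mul]

theorem integral_exp_neg_quadForm {d : ℕ} (μ : EuclideanSpace ℝ (Fin d))
    {S : Matrix (Fin d) (Fin d) ℝ} (hS : S.PosDef) {t : ℝ} (ht : 0 < t) :
    ∫ x : EuclideanSpace ℝ (Fin d),
      Real.exp (-t * ((x - μ).ofLp ⬝ᵥ (S⁻¹).mulVec (x - μ).ofLp)) =
      Real.sqrt ((Real.pi / t) ^ d * S.det) := by
  obtain ⟨B, hB, hdet⟩ := exists_inv_eq_transpose_mul_self hS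
  have hB0 : B.det ≠ 0 := by rintro h; simp [h] at hdet
  simp only [hB, dotProduct_transpose_mul_self]
  rw [integral_sub_right_eq_self (fun x => Real.exp (-t * ‖B.toEuclideanLin x‖ ^ 2)) μ,
    integral_comp_toEuclideanLin hB0 (fun x => Real.exp (-t * ‖x‖ ^ 2)),
    GaussianFourier.integral_rexp_neg_mul_sq_norm ht, Real.sqrt_mul (by positivity)]
  have h1 : |B.det|⁻¹ = Real.sqrt S.det := inv_eq_of_mul_eq_one_right hdet
  rw [h1, finrank_euclideanSpace_fin, mul_comm, Real.sqrt_eq_rpow ((Real.pi / t) ^ d),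
    ← Real.rpow_natCast, ← Real.rpow_mul (by positivity)]
  congr 2; ring

theorem integrable_exp_neg_quadForm {d : ℕ} (μ : EuclideanSpace ℝ (Fin d))
    {S : Matrix (Fin d) (Fin d) ℝ} (hS : S.PosDef) {t : ℝ} (ht : 0 < t) :
    Integrable fun x : EuclideanSpace ℝ (Fin d) =>
      Real.exp (-t * ((x - μ).ofLp ⬝ᵥ (S⁻¹).mulVec (x - μ).ofLp)) := by
  apply Integrable.of_integral_ne_zero
  rw [integral_exp_neg_quadForm μ hS ht]
  have := hS.det_pos
  positivity

variable {d : ℕ} (μ : EuclideanSpace ℝ (Fin d)) {S : Matrix (Fin d) (Fin d) ℝ}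

theorem continuous_gaussianDensity (S : Matrix (Fin d) (Fin d) ℝ) :
    Continuous (gaussianDensity μ S) := by
  unfold gaussianDensity
  have : Continuous fun x : EuclideanSpace ℝ (Fin d) =>
      (x - μ).ofLp ⬝ᵥ (S⁻¹).mulVec (x - μ).ofLp := by
    have h : Continuous fun x : EuclideanSpace ℝ (Fin d) => (x - μ).ofLp := by fun_prop
    exact h.dotProduct (continuous_const.matrix_mulVec h)
  fun_prop

theorem gaussianDensity_pos (hS : S.PosDef) (x : EuclideanSpace ℝ (Fin d)) :
    0 < gaussianDensity μ S x := by
  have := hS.det_pos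
  unfold gaussianDensity; positivity

theorem integrable_gaussianDensity (hS : S.PosDef) : Integrable (gaussianDensity μ S) :=
  (integrable_exp_neg_quadForm μ hS (by norm_num : (0 : ℝ) < 1 / 2)).const_mul _

theorem integral_gaussianDensity (hS : S.PosDef) : ∫ x, gaussianDensity μ S x = 1 := by
  unfold gaussianDensity
  rw [integral_const_mul, integral_exp_neg_quadForm μ hS (by norm_num : (0 : ℝ) < 1 / 2)]
  have := hS.det_pos
  rw [show Real.pi / (1 / 2) = 2 * Real.pi by ring, one_div, inv_mul_cancel₀ (by positivity)]

/-- The quadratic form of a symmetric matrix in the coordinates of an eigenbasis. -/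
theorem exists_quadForm_eq_sum (hS : S.IsHermitian) (y : Fin d → ℝ) : ∃ z : Fin d → ℝ,
    y ⬝ᵥ S.mulVec y = ∑ i, hS.eigenvalues i * z i ^ 2 ∧ y ⬝ᵥ y = ∑ i, z i ^ 2 := by
  have h1 := hS.spectral_theorem
  rw [Unitary.conjStarAlgAut_apply] at h1
  set U : Matrix (Fin d) (Fin d) ℝ := ↑(hS.eigenvectorUnitary)
  have hU : U * star U = 1 := (Matrix.mem_unitaryGroup_iff).mp (hS.eigenvectorUnitary).2
  have hz : Matrix.vecMul y U = (star U).mulVec y := by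
    rw [Matrix.star_eq_conjTranspose, Matrix.conjTranspose_eq_transpose_of_trivial,
      Matrix.mulVec_transpose]
  refine ⟨(star U).mulVec y, ?_, ?_⟩
  · rw [congrArg (fun T => y ⬝ᵥ T.mulVec y) h1]
    rw [← Matrix.mulVec_mulVec, ← Matrix.mulVec_mulVec, Matrix.dotProduct_mulVec, hz]
    simp only [dotProduct, Matrix.mulVec_diagonal, Function.comp_apply, RCLike.ofReal_real_eq_id,
      id_eq]
    exact Finset.sum_congr rfl fun i _ => by ring
  · calc y ⬝ᵥ y = y ⬝ᵥ (U * star U).mulVec y := by rw [hU, Matrix.one_mulVec]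
      _ = _ := by
        rw [← Matrix.mulVec_mulVec, Matrix.dotProduct_mulVec, hz]
        simp [dotProduct, sq]

/-- The quadratic form of the inverse covariance is bounded above through the smallest
eigenvalue. -/
theorem mul_quadForm_inv_le_norm_sq (hS : S.PosDef) {σ : ℝ}
    (hσ : ∀ i, σ ≤ hS.isHermitian.eigenvalues i) (hσ0 : 0 < σ) (x : EuclideanSpace ℝ (Fin d)) :
    σ * (x.ofLp ⬝ᵥ (S⁻¹).mulVec x.ofLp) ≤ ‖x‖ ^ 2 := by
  set v := x.ofLp
  set y := (S⁻¹).mulVec v with hy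
  have hSy : S.mulVec y = v := by
    rw [hy, Matrix.mulVec_mulVec, Matrix.mul_nonsing_inv _ hS.det_pos.ne'.isUnit,
      Matrix.one_mulVec]
  obtain ⟨z, h1, h2⟩ := exists_quadForm_eq_sum hS.isHermitian y
  rw [hSy, dotProduct_comm] at h1
  have h3 : σ * (y ⬝ᵥ y) ≤ v ⬝ᵥ y := by
    rw [h1, h2, Finset.mul_sum]
    exact Finset.sum_le_sum fun i _ => mul_le_mul_of_nonneg_right (hσ i) (sq_nonneg _)
  have h4 : ‖x‖ ^ 2 = v ⬝ᵥ v := by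
    rw [EuclideanSpace.real_norm_sq_eq]; simp [dotProduct, sq, v]
  have h5 : 0 ≤ (v - σ • y) ⬝ᵥ (v - σ • y) := by
    simp only [dotProduct, ← sq]; positivity
  simp only [sub_dotProduct, dotProduct_sub, smul_dotProduct, dotProduct_smul, smul_eq_mul] at h5
  rw [dotProduct_comm y v] at h5
  rw [h4]
  nlinarith

/-- The quadratic form of the inverse covariance is bounded below through the largest
eigenvalue. -/
theorem norm_sq_le_mul_quadForm_inv (hS : S.PosDef) {σ : ℝ}
    (hσ : ∀ i, hS.isHermitian.eigenvalues i ≤ σ) (hσ0 : 0 < σ) (x : EuclideanSpace ℝ (Fin d)) :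
    ‖x‖ ^ 2 ≤ σ * (x.ofLp ⬝ᵥ (S⁻¹).mulVec x.ofLp) := by
  have q1 : ∀ y : Fin d → ℝ, y ⬝ᵥ S.mulVec y ≤ σ * (y ⬝ᵥ y) := by
    intro y
    obtain ⟨z, h1, h2⟩ := exists_quadForm_eq_sum hS.isHermitian y
    rw [h1, h2, Finset.mul_sum]
    exact Finset.sum_le_sum fun i _ => mul_le_mul_of_nonneg_right (hσ i) (sq_nonneg _)
  have q2 := fun y => hS.posSemidef.dotProduct_mulVec_nonneg (x := y)
  set v := x.ofLp
  set y := (S⁻¹).mulVec v with hy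
  have hSy : S.mulVec y = v := by
    rw [hy, Matrix.mulVec_mulVec, Matrix.mul_nonsing_inv _ hS.det_pos.ne'.isUnit,
      Matrix.one_mulVec]
  have hSt : S.transpose = S := by
    have := hS.isHermitian.eq
    rwa [Matrix.conjTranspose_eq_transpose_of_trivial] at this
  have hyv : y ⬝ᵥ S.mulVec v = v ⬝ᵥ v := by
    rw [Matrix.dotProduct_mulVec, ← Matrix.mulVec_transpose, hSt, hSy]
  have h3 := q2 (v - σ • y)
  rw [star_trivial, Matrix.mulVec_sub, Matrix.mulVec_smul, hSy] at h3
  simp only [sub_dotProduct, dotProduct_sub, smul_dotProduct, dotProduct_smul, smul_eq_mul, hyv] at h3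
  have h4 := q1 v
  have h5 : ‖x‖ ^ 2 = v ⬝ᵥ v := by
    rw [EuclideanSpace.real_norm_sq_eq]; simp [dotProduct, sq, v]
  have h6 : y ⬝ᵥ v = v ⬝ᵥ y := dotProduct_comm _ _
  rw [h6] at h3
  rw [h5]
  have h7 : σ * (v ⬝ᵥ v) ≤ σ * (σ * (v ⬝ᵥ y)) := by nlinarith
  exact le_of_mul_le_mul_left h7 hσ0

/-- A Gaussian tail bound outside of a ball that is large in comparison with the mean. Half of the
exponent is kept, so that the bound remains integrable. -/
theorem gaussianDensity_le_of_le_norm (hS : S.PosDef) {σ : ℝ}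
    (hσ : ∀ i, hS.isHermitian.eigenvalues i ≤ σ) (hσ0 : 0 < σ) {b : ℝ} (hb : 4 * ‖μ‖ ≤ b)
    {x : EuclideanSpace ℝ (Fin d)} (hx : b ≤ ‖x‖) :
    gaussianDensity μ S x ≤ Real.exp (-(b ^ 2 / (8 * σ))) *
      (1 / Real.sqrt ((2 * Real.pi) ^ d * S.det) *
        Real.exp (-(1 / 4) * ((x - μ).ofLp ⬝ᵥ (S⁻¹).mulVec (x - μ).ofLp))) := by
  have h1 := norm_sq_le_mul_quadForm_inv hS hσ hσ0 (x - μ)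
  set Q := (x - μ).ofLp ⬝ᵥ (S⁻¹).mulVec (x - μ).ofLp
  have h2 : ‖x‖ - ‖μ‖ ≤ ‖x - μ‖ := norm_sub_norm_le x μ
  have h0 := norm_nonneg μ
  have h3 : b ^ 2 / 2 ≤ ‖x - μ‖ ^ 2 := by
    have : 3 / 4 * b ≤ ‖x - μ‖ := by linarith
    nlinarith
  have h4 : b ^ 2 / (8 * σ) ≤ Q / 4 := by
    rw [div_le_iff₀ (by positivity)]; nlinarith
  unfold gaussianDensity
  rw [← mul_assoc, mul_comm (Real.exp _) (1 / _), mul_assoc, ← Real.exp_add]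
  refine mul_le_mul_of_nonneg_left (Real.exp_le_exp.mpr ?_) (by positivity)
  linarith

end Gaussian

/-! ### The law of a Gaussian mixture -/

namespace GaussianMixture

variable {d K : ℕ} (G : GaussianMixture d K)

theorem classPrior_nonneg (j : Fin K) : 0 ≤ G.classPrior j := by
  unfold classPrior
  split_ifs
  · exact G.priorPos_nonneg
  · linarith [G.priorPos_le_one]

theorem discrPos_eq_sum (x : EuclideanSpace ℝ (Fin d)) : G.discrPos x =
    ∑ j ∈ G.pos, G.classPrior j * G.weight j * gaussianDensity (G.mean j) (G.cov j) x := by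
  rw [discrPos, Finset.mul_sum]
  refine Finset.sum_congr rfl fun j hj => ?_
  rw [classPrior, if_pos hj, mul_assoc]

theorem discrNeg_eq_sum (x : EuclideanSpace ℝ (Fin d)) : G.discrNeg x =
    ∑ j ∈ G.posᶜ, G.classPrior j * G.weight j * gaussianDensity (G.mean j) (G.cov j) x := by
  rw [discrNeg, Finset.mul_sum]
  refine Finset.sum_congr rfl fun j hj => ?_
  rw [classPrior, if_neg (Finset.mem_compl.mp hj), mul_assoc]

theorem discrPos_add_discrNeg (x : EuclideanSpace ℝ (Fin d)) : G.discrPos x + G.discrNeg x =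
    ∑ j, G.classPrior j * G.weight j * gaussianDensity (G.mean j) (G.cov j) x := by
  rw [discrPos_eq_sum, discrNeg_eq_sum, Finset.sum_add_sum_compl]

theorem discr_eq_sum_coeff (x : EuclideanSpace ℝ (Fin d)) : G.discr x =
    ∑ j, G.coeff j * Real.exp (-(1 / 2) *
      ((x - G.mean j).ofLp ⬝ᵥ ((G.cov j)⁻¹).mulVec (x - G.mean j).ofLp)) := by
  rw [discr, discrPos_eq_sum, discrNeg_eq_sum, ← Finset.sum_add_sum_compl G.pos, sub_eq_add_neg,
    ← Finset.sum_neg_distrib]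
  congr 1 <;> refine Finset.sum_congr rfl fun j hj => ?_
  · rw [coeff, label, if_pos hj, gaussianDensity]; ring
  · rw [coeff, label, if_neg (Finset.mem_compl.mp hj), gaussianDensity]; ring

theorem abs_coeff (j : Fin K) : |G.coeff j| =
    G.classPrior j * G.weight j * (1 / Real.sqrt ((2 * Real.pi) ^ d * (G.cov j).det)) := by
  have h1 := G.classPrior_nonneg j
  have h2 := G.weight_nonneg j
  rw [coeff, abs_div, abs_mul, abs_of_nonneg (Real.sqrt_nonneg _), abs_of_nonneg (mul_nonneg h1 h2)]
  have : |G.label j| = 1 := by unfold label; split_ifs <;> simp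
  rw [this]; ring

theorem discrPos_nonneg (x : EuclideanSpace ℝ (Fin d)) : 0 ≤ G.discrPos x :=
  mul_nonneg G.priorPos_nonneg (Finset.sum_nonneg fun j _ =>
    mul_nonneg (G.weight_nonneg j) (gaussianDensity_pos _ (G.cov_posDef j) x).le)

theorem discrNeg_nonneg (x : EuclideanSpace ℝ (Fin d)) : 0 ≤ G.discrNeg x :=
  mul_nonneg (by linarith [G.priorPos_le_one]) (Finset.sum_nonneg fun j _ =>
    mul_nonneg (G.weight_nonneg j) (gaussianDensity_pos _ (G.cov_posDef j) x).le)

theorem sum_classPrior_mul_weight : ∑ j, G.classPrior j * G.weight j = 1 := by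
  rw [← Finset.sum_add_sum_compl G.pos]
  have h1 : ∑ j ∈ G.pos, G.classPrior j * G.weight j = G.priorPos := by
    rw [← mul_one G.priorPos, ← G.sum_weight_pos, Finset.mul_sum]
    exact Finset.sum_congr rfl fun j hj => by rw [classPrior, if_pos hj]
  have h2 : ∑ j ∈ G.posᶜ, G.classPrior j * G.weight j =
      (1 - G.priorPos) * ∑ j ∈ G.posᶜ, G.weight j := by
    rw [Finset.mul_sum]
    exact Finset.sum_congr rfl fun j hj => by
      rw [classPrior, if_neg (Finset.mem_compl.mp hj)]
  rw [h1, h2, G.sum_weight_neg]; ring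

theorem exists_classPrior_mul_weight_pos : ∃ j, 0 < G.classPrior j * G.weight j := by
  by_contra! h
  have := Finset.sum_nonpos fun j (_ : j ∈ Finset.univ) => h j
  rw [G.sum_classPrior_mul_weight] at this
  linarith

theorem discrPos_add_discrNeg_pos (x : EuclideanSpace ℝ (Fin d)) :
    0 < G.discrPos x + G.discrNeg x := by
  rw [discrPos_add_discrNeg]
  obtain ⟨j, hj⟩ := G.exists_classPrior_mul_weight_pos
  exact Finset.sum_pos' (fun i _ => mul_nonneg (mul_nonneg (G.classPrior_nonneg i)
    (G.weight_nonneg i)) (gaussianDensity_pos _ (G.cov_posDef i) x).le)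
    ⟨j, Finset.mem_univ j, mul_pos hj (gaussianDensity_pos _ (G.cov_posDef j) x)⟩

theorem sum_abs_coeff_pos : 0 < ∑ j, |G.coeff j| := by
  obtain ⟨j, hj⟩ := G.exists_classPrior_mul_weight_pos
  refine Finset.sum_pos' (fun i _ => abs_nonneg _) ⟨j, Finset.mem_univ j, ?_⟩
  rw [abs_coeff]
  have := (G.cov_posDef j).det_pos
  positivity

theorem discrPos_add_discrNeg_le (x : EuclideanSpace ℝ (Fin d)) :
    G.discrPos x + G.discrNeg x ≤ ∑ j, |G.coeff j| := by
  rw [discrPos_add_discrNeg]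
  refine Finset.sum_le_sum fun j _ => ?_
  rw [abs_coeff]
  refine mul_le_mul_of_nonneg_left ?_ (mul_nonneg (G.classPrior_nonneg j) (G.weight_nonneg j))
  unfold gaussianDensity
  refine mul_le_of_le_one_right (by positivity) (Real.exp_le_one_iff.mpr ?_)
  have := (G.cov_posDef j).inv.posSemidef.dotProduct_mulVec_nonneg (x - G.mean j).ofLp
  rw [star_trivial] at this
  linarith

theorem continuous_discrPos : Continuous G.discrPos := by
  unfold discrPos
  exact continuous_const.mul (continuous_finsetSum _ fun j _ =>
    continuous_const.mul (continuous_gaussianDensity _ _))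

theorem continuous_discrNeg : Continuous G.discrNeg := by
  unfold discrNeg
  exact continuous_const.mul (continuous_finsetSum _ fun j _ =>
    continuous_const.mul (continuous_gaussianDensity _ _))

theorem integrable_discrPos : Integrable G.discrPos :=
  (integrable_finsetSum _ fun j _ =>
    (integrable_gaussianDensity _ (G.cov_posDef j)).const_mul (G.weight j)).const_mul _

theorem integrable_discrNeg : Integrable G.discrNeg :=
  (integrable_finsetSum _ fun j _ =>
    (integrable_gaussianDensity _ (G.cov_posDef j)).const_mul (G.weight j)).const_mul _

theorem integral_discrPos_add_discrNeg : ∫ x, (G.discrPos x + G.discrNeg x) = 1 := by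
  simp only [discrPos_add_discrNeg]
  rw [integral_finsetSum _ fun j _ =>
    (integrable_gaussianDensity _ (G.cov_posDef j)).const_mul _]
  simp only [integral_const_mul, integral_gaussianDensity _ (G.cov_posDef _), mul_one]
  exact G.sum_classPrior_mul_weight

theorem withDensity_ofReal_sum {s : Finset (Fin K)} :
    (volume.withDensity fun x => ENNReal.ofReal
      (∑ j ∈ s, G.classPrior j * G.weight j * gaussianDensity (G.mean j) (G.cov j) x)) =
    ∑ j ∈ s, ENNReal.ofReal (G.classPrior j * G.weight j) •
      volume.withDensity fun x => ENNReal.ofReal (gaussianDensity (G.mean j) (G.cov j) x) := by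
  have hm : ∀ j, Measurable fun x => ENNReal.ofReal (gaussianDensity (G.mean j) (G.cov j) x) :=
    fun j => (continuous_gaussianDensity _ _).measurable.ennreal_ofReal
  ext t ht
  rw [withDensity_apply _ ht, Measure.finsetSum_apply]
  simp only [Measure.smul_apply, withDensity_apply _ ht, smul_eq_mul]
  have : ∀ x, ENNReal.ofReal (∑ j ∈ s, G.classPrior j * G.weight j *
      gaussianDensity (G.mean j) (G.cov j) x) = ∑ j ∈ s, ENNReal.ofReal (G.classPrior j * G.weight j)
        * ENNReal.ofReal (gaussianDensity (G.mean j) (G.cov j) x) := fun x => by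
    rw [ENNReal.ofReal_sum_of_nonneg fun j _ => mul_nonneg (mul_nonneg (G.classPrior_nonneg j)
      (G.weight_nonneg j)) (gaussianDensity_pos _ (G.cov_posDef j) x).le]
    exact Finset.sum_congr rfl fun j _ => ENNReal.ofReal_mul (mul_nonneg (G.classPrior_nonneg j)
      (G.weight_nonneg j))
  simp only [this]
  rw [lintegral_finsetSum _ fun j _ => (hm j).const_mul _]
  exact Finset.sum_congr rfl fun j _ => lintegral_const_mul _ (hm j)

/-- The conditional distribution of the points with label `±1`, weighted by the class prior, has the
density `discrPos` or `discrNeg`. -/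
theorem law_eq_twoDensityLaw : G.law = twoDensityLaw volume G.discrPos G.discrNeg := by
  unfold law twoDensityLaw
  simp only [discrPos_eq_sum, discrNeg_eq_sum, withDensity_ofReal_sum]
  rw [← Finset.sum_add_sum_compl G.pos]
  congr 1
  · rw [← Measure.mapₗ_apply_of_measurable (by fun_prop), map_sum]
    refine Finset.sum_congr rfl fun j hj => ?_
    rw [Measure.mapₗ_apply_of_measurable (by fun_prop), Measure.map_smul]
    simp [label, hj]
  · rw [← Measure.mapₗ_apply_of_measurable (by fun_prop), map_sum]
    refine Finset.sum_congr rfl fun j hj => ?_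
    rw [Measure.mapₗ_apply_of_measurable (by fun_prop), Measure.map_smul]
    simp [label, Finset.mem_compl.mp hj]

theorem law_fst_preimage {A : Set (EuclideanSpace ℝ (Fin d))} (hA : MeasurableSet A) :
    G.law {z | z.1 ∈ A} = ENNReal.ofReal (∫ x in A, (G.discrPos x + G.discrNeg x)) := by
  have h : G.law {z | z.1 ∈ A} = G.law.map Prod.fst A := by
    rw [Measure.map_apply measurable_fst hA]; rfl
  rw [h, law_eq_twoDensityLaw, twoDensityLaw_map_fst volume G.continuous_discrPos.measurable
    G.discrPos_nonneg G.discrNeg_nonneg, withDensity_apply _ hA,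
    ofReal_integral_eq_lintegral_ofReal]
  · exact (G.integrable_discrPos.add G.integrable_discrNeg).integrableOn
  · exact Filter.Eventually.of_forall fun x => (G.discrPos_add_discrNeg_pos x).le

instance isProbabilityMeasure_law : IsProbabilityMeasure G.law := by
  constructor
  have := G.law_fst_preimage MeasurableSet.univ
  simpa [G.integral_discrPos_add_discrNeg] using this

/-- The noise condition in terms of the class densities. -/
theorem NoiseCondition.setIntegral_le {G : GaussianMixture d K} {c₀ q : ℝ} (hc₀ : 0 < c₀)
    (h : G.NoiseCondition c₀ q) {t : ℝ} (ht : 0 < t) :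
    ∫ x in {x | |G.discrPos x - G.discrNeg x| ≤ t}, (G.discrPos x + G.discrNeg x) ≤
      c₀ * t ^ q := by
  have h1 := h t ht
  have hm : MeasurableSet {x | |G.discrPos x - G.discrNeg x| ≤ t} :=
    (isClosed_le ((G.continuous_discrPos.sub G.continuous_discrNeg).abs)
      continuous_const).measurableSet
  have h2 := G.law_fst_preimage hm
  have h3 : {z : EuclideanSpace ℝ (Fin d) × ℝ | |G.discr z.1| ≤ t} =
      {z | z.1 ∈ {x | |G.discrPos x - G.discrNeg x| ≤ t}} := rfl
  rw [h3, h2] at h1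
  exact (ENNReal.ofReal_le_ofReal_iff (by positivity)).mp h1

theorem nonempty_index {d K : ℕ} (G : GaussianMixture d K) (hd : 1 ≤ d) : Nonempty (Fin K × Fin d) := by
  obtain ⟨j, -⟩ := G.exists_classPrior_mul_weight_pos
  exact ⟨j, ⟨0, hd⟩⟩

theorem eigenvalues_le_eigMax (j : Fin K) (i : Fin d) :
    (G.cov_posDef j).isHermitian.eigenvalues i ≤ G.eigMax :=
  le_ciSup (f := fun p : Fin K × Fin d => (G.cov_posDef p.1).isHermitian.eigenvalues p.2)
    (Set.finite_range _).bddAbove (j, i)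

theorem eigMin_pos (hd : 1 ≤ d) : 0 < G.eigMin := by
  have := G.nonempty_index hd
  obtain ⟨p, hp⟩ := exists_eq_ciInf_of_finite
    (f := fun p : Fin K × Fin d => (G.cov_posDef p.1).isHermitian.eigenvalues p.2)
  rw [eigMin, ← hp]
  exact (G.cov_posDef p.1).eigenvalues_pos p.2

theorem eigMin_le_eigMax (hd : 1 ≤ d) : G.eigMin ≤ G.eigMax := by
  obtain ⟨p⟩ := G.nonempty_index hd
  exact (ciInf_le (Set.finite_range _).bddBelow p).trans (G.eigenvalues_le_eigMax p.1 p.2)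

theorem eigMax_pos (hd : 1 ≤ d) : 0 < G.eigMax := (G.eigMin_pos hd).trans_le (G.eigMin_le_eigMax hd)

theorem norm_mean_le (j : Fin K) : ‖G.mean j‖ ≤ G.meanBound :=
  le_ciSup (f := fun j => ‖G.mean j‖) (Set.finite_range _).bddAbove j

theorem meanBound_nonneg : 0 ≤ G.meanBound := Real.iSup_nonneg fun j => norm_nonneg (G.mean j)

/-- The mass of the mixture outside of a large cube. -/
theorem exists_setIntegral_compl_cube_le (hd : 1 ≤ d) : ∃ C : ℝ, 0 ≤ C ∧
    ∀ b : ℝ, 4 * G.meanBound ≤ b →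
      ∫ x in {x : EuclideanSpace ℝ (Fin d) | ∀ i, |x i| ≤ b}ᶜ, (G.discrPos x + G.discrNeg x) ≤
        C * Real.exp (-(b ^ 2 / (8 * G.eigMax))) := by
  set g : Fin K → EuclideanSpace ℝ (Fin d) → ℝ := fun j x =>
    1 / Real.sqrt ((2 * Real.pi) ^ d * (G.cov j).det) * Real.exp (-(1 / 4) *
      ((x - G.mean j).ofLp ⬝ᵥ ((G.cov j)⁻¹).mulVec (x - G.mean j).ofLp)) with hg
  have hg0 : ∀ j x, 0 ≤ g j x := fun j x => by positivity
  have hgi : ∀ j, Integrable (g j) := fun j =>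
    (integrable_exp_neg_quadForm (G.mean j) (G.cov_posDef j) (by norm_num)).const_mul _
  set F : EuclideanSpace ℝ (Fin d) → ℝ := fun x => ∑ j, G.classPrior j * G.weight j * g j x
    with hF
  have hp : ∀ j, 0 ≤ G.classPrior j * G.weight j := fun j =>
    mul_nonneg (G.classPrior_nonneg j) (G.weight_nonneg j)
  have hF0 : ∀ x, 0 ≤ F x := fun x => Finset.sum_nonneg fun j _ => mul_nonneg (hp j) (hg0 j x)
  have hFi : Integrable F := integrable_finsetSum _ fun j _ => (hgi j).const_mul _
  refine ⟨∫ x, F x, integral_nonneg hF0, fun b hb => ?_⟩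
  have hm : MeasurableSet {x : EuclideanSpace ℝ (Fin d) | ∀ i, |x i| ≤ b} := by
    rw [Set.ofPred_forall]
    exact MeasurableSet.iInter fun i =>
      (isClosed_le (by fun_prop) continuous_const).measurableSet
  calc _ ≤ ∫ x in {x : EuclideanSpace ℝ (Fin d) | ∀ i, |x i| ≤ b}ᶜ,
        F x * Real.exp (-(b ^ 2 / (8 * G.eigMax))) := by
        refine setIntegral_mono_on (G.integrable_discrPos.add G.integrable_discrNeg).integrableOn
          (hFi.mul_const _).integrableOn hm.compl fun x hx => ?_
        simp only [Set.mem_compl_iff, Set.mem_ofPred_eq, not_forall, not_le] at hx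
        obtain ⟨i, hi⟩ := hx
        have hx : b ≤ ‖x‖ := hi.le.trans (PiLp.norm_apply_le x i)
        rw [discrPos_add_discrNeg, hF, Finset.sum_mul]
        refine Finset.sum_le_sum fun j _ => ?_
        rw [mul_assoc (_ * _) (g j x)]
        refine mul_le_mul_of_nonneg_left ?_ (hp j)
        rw [mul_comm (g j x)]
        exact gaussianDensity_le_of_le_norm _ (G.cov_posDef j) (G.eigenvalues_le_eigMax j)
          (G.eigMax_pos hd) (by linarith [G.norm_mean_le j]) hx
    _ ≤ ∫ x, F x * Real.exp (-(b ^ 2 / (8 * G.eigMax))) :=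
        setIntegral_le_integral (hFi.mul_const _)
          (Filter.Eventually.of_forall fun x => mul_nonneg (hF0 x) (Real.exp_pos _).le)
    _ = _ := integral_mul_const _ _

end GaussianMixture

/-! ### Continuity and parameter dependence of the networks -/

theorem continuous_relu : Continuous relu := by unfold relu; fun_prop

theorem abs_relu_sub_relu_le (s t : ℝ) : |relu s - relu t| ≤ |s - t| :=
  abs_max_sub_max_le_abs _ _ _

theorem abs_relu_le (t : ℝ) : |relu t| ≤ |t| := by
  simpa [relu] using abs_relu_sub_relu_le t 0

theorem relu_nonneg (t : ℝ) : 0 ≤ relu t := le_max_right _ _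

theorem relu_of_nonneg {t : ℝ} (h : 0 ≤ t) : relu t = t := max_eq_left h

theorem relu_of_nonpos {t : ℝ} (h : t ≤ 0) : relu t = 0 := max_eq_right h

theorem abs_scaling_le_one {l : ℝ} (hl : 0 < l) (u : ℝ) : |scaling l u| ≤ 1 := by
  rw [scaling_eq hl]
  split_ifs with h1 h2
  · simp
  · push Not at h1
    rw [abs_le, le_div_iff₀ hl, div_le_iff₀ hl]; constructor <;> linarith
  · simp

theorem abs_scaling_sub_scaling_le {l : ℝ} (hl : 0 < l) (u v : ℝ) :
    |scaling l u - scaling l v| ≤ 4 / l * |u - v| := by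
  have e : |u / l - v / l| = 1 / l * |u - v| := by
    rw [← sub_div, abs_div, abs_of_pos hl]; ring
  have h1 := abs_le.mp (abs_relu_sub_relu_le (u / l) (v / l))
  have h2 := abs_le.mp (abs_relu_sub_relu_le (u / l - 1) (v / l - 1))
  have h3 := abs_le.mp (abs_relu_sub_relu_le (-u / l) (-v / l))
  have h4 := abs_le.mp (abs_relu_sub_relu_le (-u / l - 1) (-v / l - 1))
  rw [show u / l - 1 - (v / l - 1) = u / l - v / l by ring] at h2
  rw [show -u / l - -v / l = -(u / l - v / l) by ring, abs_neg] at h3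
  rw [show -u / l - 1 - (-v / l - 1) = -(u / l - v / l) by ring, abs_neg] at h4
  rw [e] at h1 h2 h3 h4
  have e' : 4 / l * |u - v| = 4 * (1 / l * |u - v|) := by ring
  rw [e']
  unfold scaling
  rw [abs_le]
  constructor <;> linarith [h1.1, h1.2, h2.1, h2.2, h3.1, h3.2, h4.1, h4.2]

theorem continuous_scaling (l : ℝ) : Continuous (scaling l) := by
  unfold scaling relu; fun_prop

namespace GateParams

theorem continuous_hidden (θ : GateParams) (j : ℕ) (i : Fin 5) :
    Continuous fun u => θ.hidden u j i := by
  induction j generalizing i with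
  | zero => exact continuous_relu.comp (by fun_prop)
  | succ j ih =>
    simp only [hidden, Matrix.mulVec, dotProduct]
    exact continuous_relu.comp ((continuous_finsetSum _ fun k _ =>
      continuous_const.mul (ih k)).add continuous_const)

theorem continuous_squareGate (θ : GateParams) (m : ℕ) : Continuous (θ.squareGate m) := by
  unfold squareGate dotProduct
  exact continuous_finsetSum _ fun k _ => continuous_const.mul (θ.continuous_hidden _ k)

theorem continuous_productGate (θ : GateParams) (m : ℕ) {X : Type*} [TopologicalSpace X]
    {f g : X → ℝ} (hf : Continuous f) (hg : Continuous g) :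
    Continuous fun x => θ.productGate m (f x) (g x) := by
  unfold productGate
  exact ((θ.continuous_squareGate m).comp (by fun_prop)).sub
    ((θ.continuous_squareGate m).comp (by fun_prop))

end GateParams

theorem treeGate_of_le_one (θ : ℕ → GateParams) (m : ℕ) (u : ℝ) {k : ℕ} (h : k ≤ 1) :
    treeGate θ m u k = u := by
  rw [treeGate, dif_pos h]

theorem treeGate_of_not_le_one (θ : ℕ → GateParams) (m : ℕ) (u : ℝ) {k : ℕ} (h : ¬ k ≤ 1) :
    treeGate θ m u k = (θ k).productGate m (treeGate θ m u (2 ^ Nat.log 2 (k - 1)))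
      (treeGate θ m u (k - 2 ^ Nat.log 2 (k - 1))) := by
  conv_lhs => rw [treeGate, dif_neg h]

theorem continuous_treeGate (θ : ℕ → GateParams) (m k : ℕ) :
    Continuous fun u => treeGate θ m u k := by
  induction k using Nat.strong_induction_on with
  | _ k ih =>
    by_cases h : k ≤ 1
    · have : (fun u => treeGate θ m u k) = id := by
        ext u; exact treeGate_of_le_one θ m u h
      rw [this]; exact continuous_id
    · have : (fun u => treeGate θ m u k) = fun u => (θ k).productGate m
          (treeGate θ m u (2 ^ Nat.log 2 (k - 1)))
          (treeGate θ m u (k - 2 ^ Nat.log 2 (k - 1))) := by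
        ext u; exact treeGate_of_not_le_one θ m u h
      rw [this]
      have h1 := Nat.pow_log_le_self 2 (x := k - 1) (by omega)
      have h2 := Nat.pow_pos (n := Nat.log 2 (k - 1)) (show 0 < 2 by norm_num)
      exact (θ k).continuous_productGate m (ih _ (by omega)) (ih _ (by omega))

theorem continuous_truncation {d : ℕ} (b : ℝ) :
    Continuous (truncation b : EuclideanSpace ℝ (Fin d) → ℝ) := by
  unfold truncation trapezoid relu
  fun_prop

namespace NetParams

variable {d K : ℕ} (P : NetParams d K)

theorem continuous_toFun (l b : ℝ) (m ℓ : ℕ) : Continuous (P.toFun l b m ℓ) := by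
  unfold toFun
  refine (continuous_scaling l).comp ((continuous_finsetSum _ fun j _ =>
    continuous_finsetSum _ fun k _ => continuous_const.mul ?_).add continuous_const)
  unfold hStar
  refine (continuous_treeGate _ m k).comp (continuous_const.mul
    (continuous_finsetSum _ fun i _ => ?_))
  have : Continuous fun x => P.truncated b m i j x := by
    unfold truncated
    refine GateParams.continuous_productGate _ m (continuous_truncation b) ?_
    unfold affine
    fun_prop
  exact GateParams.continuous_productGate _ m this this

theorem abs_toFun_le_one {l : ℝ} (hl : 0 < l) (b : ℝ) (m ℓ : ℕ) (x : EuclideanSpace ℝ (Fin d)) :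
    |P.toFun l b m ℓ x| ≤ 1 := abs_scaling_le_one hl _

end NetParams

theorem measurable_of_mem_hypothesisSpace {d K : ℕ} {CK0 CK1 CK l b : ℝ} (hl : 0 < l) {m ℓ : ℕ}
    {f : EuclideanSpace ℝ (Fin d) → ℝ} (hf : f ∈ hypothesisSpace d K CK0 CK1 CK l b m ℓ) :
    Measurable f ∧ ∀ x, |f x| ≤ 1 := by
  obtain ⟨P, -, rfl⟩ := hf
  exact ⟨(P.continuous_toFun l b m ℓ).measurable, P.abs_toFun_le_one hl b m ℓ⟩

/-! ### Perturbation of the parameters -/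

/-- The numbers `u` and `u'` are bounded by `U`, and their distance is at most `ε * U`. This is the form
in which perturbations of the parameters propagate through a network: a layer only increases `U`. -/
def Ctrl (ε U u u' : ℝ) : Prop := |u| ≤ U ∧ |u'| ≤ U ∧ |u - u'| ≤ ε * U

theorem Ctrl.mono {ε U V u u' : ℝ} (h : Ctrl ε U u u') (hε : 0 ≤ ε) (hUV : U ≤ V) :
    Ctrl ε V u u' :=
  ⟨h.1.trans hUV, h.2.1.trans hUV, h.2.2.trans (mul_le_mul_of_nonneg_left hUV hε)⟩

theorem abs_sum_mul_le {ι : Type*} (s : Finset ι) {a x : ι → ℝ} {A X : ℝ} (hA : 0 ≤ A)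
    (ha : ∀ k ∈ s, |a k| ≤ A) (hx : ∀ k ∈ s, |x k| ≤ X) :
    |∑ k ∈ s, a k * x k| ≤ s.card * (A * X) := by
  refine (Finset.abs_sum_le_sum_abs _ _).trans ?_
  rw [← nsmul_eq_mul]
  refine Finset.sum_le_card_nsmul _ _ _ fun k hk => ?_
  rw [abs_mul]
  exact mul_le_mul (ha k hk) (hx k hk) (abs_nonneg _) hA

theorem abs_sum_mul_sub_le {ι : Type*} (s : Finset ι) {a a' x x' : ι → ℝ} {A X D ε : ℝ}
    (hA : 0 ≤ A) (hε : 0 ≤ ε)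
    (ha : ∀ k ∈ s, |a k| ≤ A) (haa : ∀ k ∈ s, |a k - a' k| ≤ ε) (hx : ∀ k ∈ s, |x' k| ≤ X)
    (hxx : ∀ k ∈ s, |x k - x' k| ≤ D) :
    |∑ k ∈ s, a k * x k - ∑ k ∈ s, a' k * x' k| ≤ s.card * (A * D + ε * X) := by
  have : ∑ k ∈ s, a k * x k - ∑ k ∈ s, a' k * x' k =
      ∑ k ∈ s, a k * (x k - x' k) + ∑ k ∈ s, (a k - a' k) * x' k := by
    rw [← Finset.sum_sub_distrib, ← Finset.sum_add_distrib]
    exact Finset.sum_congr rfl fun k _ => by ring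
  rw [this, mul_add]
  exact (abs_add_le _ _).trans (add_le_add (abs_sum_mul_le s hA ha hxx) (abs_sum_mul_le s hε haa hx))

namespace GateParams

/-- The parameters of the first `m` layers differ by at most `ε`. This includes the
unused matrix `W 0`. -/
def Close (ε : ℝ) (m : ℕ) (θ θ' : GateParams) : Prop :=
  (∀ i, |θ.W₁ i - θ'.W₁ i| ≤ ε) ∧ (∀ j < m, ∀ i k, |θ.W j i k - θ'.W j i k| ≤ ε) ∧
  (∀ j < m, ∀ i, |θ.β j i - θ'.β j i| ≤ ε) ∧ ∀ i, |θ.a i - θ'.a i| ≤ ε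

variable {θ θ' : GateParams} {ε U : ℝ} {m : ℕ}

theorem abs_hidden_le (hθ : θ.Bounded) (hU : 1 ≤ U) {u : ℝ} (hu : |u| ≤ U) (j : ℕ) (i : Fin 5) :
    |θ.hidden u j i| ≤ 48 ^ (j + 1) * U := by
  induction j generalizing i with
  | zero =>
    refine (abs_relu_le _).trans ((abs_add_le _ _).trans ?_)
    rw [abs_mul]
    have := mul_le_mul (hθ.1 i) hu (abs_nonneg _) (by norm_num)
    have := hθ.2.2.1 0 i
    rw [zero_add, pow_one]
    linarith
  | succ j ih =>
    refine (abs_relu_le _).trans ((abs_add_le _ _).trans ?_)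
    have h1 := abs_sum_mul_le Finset.univ (a := θ.W (j + 1) i) (by norm_num : (0 : ℝ) ≤ 4)
      (fun k _ => hθ.2.1 (j + 1) i k) (fun k _ => ih k)
    have h2 := hθ.2.2.1 (j + 1) i
    have h3 : (1 : ℝ) ≤ 48 ^ (j + 1) := one_le_pow₀ (by norm_num)
    have h4 : 1 ≤ 48 ^ (j + 1) * U := by nlinarith
    rw [pow_succ]
    simp only [Finset.card_univ, Fintype.card_fin] at h1
    simp only [Matrix.mulVec, dotProduct]
    push_cast at h1
    nlinarith

theorem abs_hidden_sub_le (hθ : θ.Bounded) (hθ' : θ'.Bounded) (hε : 0 ≤ ε)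
    (hc : Close ε m θ θ') (hU : 1 ≤ U) {u u' : ℝ} (hu : Ctrl ε U u u') (j : ℕ) (hj : j < m)
    (i : Fin 5) : |θ.hidden u j i - θ'.hidden u' j i| ≤ 48 ^ (j + 1) * (2 * (ε * U)) := by
  induction j generalizing i with
  | zero =>
    refine (abs_relu_sub_relu_le _ _).trans ?_
    have e : θ.W₁ i * u + θ.β 0 i - (θ'.W₁ i * u' + θ'.β 0 i) =
        θ.W₁ i * (u - u') + (θ.W₁ i - θ'.W₁ i) * u' + (θ.β 0 i - θ'.β 0 i) := by ring
    rw [e]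
    refine (abs_add_three _ _ _).trans ?_
    rw [abs_mul, abs_mul]
    have h1 := mul_le_mul (hθ.1 i) hu.2.2 (abs_nonneg _) (by norm_num)
    have h2 := mul_le_mul (hc.1 i) hu.2.1 (abs_nonneg _) hε
    have h3 := hc.2.2.1 0 hj i
    have h4 : ε ≤ ε * U := le_mul_of_one_le_right hε hU
    rw [zero_add, pow_one]
    linarith
  | succ j ih =>
    refine (abs_relu_sub_relu_le _ _).trans ?_
    have e : ((θ.W (j + 1)).mulVec (θ.hidden u j) i + θ.β (j + 1) i) -
        ((θ'.W (j + 1)).mulVec (θ'.hidden u' j) i + θ'.β (j + 1) i) =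
        (∑ k, θ.W (j + 1) i k * θ.hidden u j k - ∑ k, θ'.W (j + 1) i k * θ'.hidden u' j k) +
        (θ.β (j + 1) i - θ'.β (j + 1) i) := by
      simp only [Matrix.mulVec, dotProduct]; ring
    rw [e]
    refine (abs_add_le _ _).trans ?_
    have h1 := abs_sum_mul_sub_le Finset.univ (a := θ.W (j + 1) i) (a' := θ'.W (j + 1) i)
      (by norm_num : (0 : ℝ) ≤ 4) hε (fun k _ => hθ.2.1 (j + 1) i k)
      (fun k _ => hc.2.1 (j + 1) hj i k) (fun k _ => abs_hidden_le hθ' hU hu.2.1 j k)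
      (fun k _ => ih (by omega) k)
    have h2 := hc.2.2.1 (j + 1) hj i
    have h3 : (1 : ℝ) ≤ 48 ^ (j + 1) := one_le_pow₀ (by norm_num)
    simp only [Finset.card_univ, Fintype.card_fin] at h1
    push_cast at h1
    have h4 : ε ≤ 48 ^ (j + 1) * (ε * U) := by
      have : ε ≤ ε * U := le_mul_of_one_le_right hε hU
      have h5 : 0 ≤ ε * U := hε.trans this
      nlinarith
    have h5 : 0 ≤ 48 ^ (j + 1) * (ε * U) := hε.trans h4
    rw [pow_succ]
    nlinarith

theorem ctrl_squareGate (hθ : θ.Bounded) (hθ' : θ'.Bounded) (hε : 0 ≤ ε) (hm : 1 ≤ m)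
    (hc : Close ε m θ θ') (hU : 1 ≤ U) {u u' : ℝ} (hu : Ctrl ε U u u') :
    Ctrl ε (45 * (48 ^ m * U)) (θ.squareGate m u) (θ'.squareGate m u') := by
  have hm1 : m - 1 + 1 = m := by omega
  have hb : ∀ {θ : GateParams}, θ.Bounded → ∀ {u}, |u| ≤ U →
      |θ.squareGate m u| ≤ 45 * (48 ^ m * U) := by
    intro θ hθ u hu
    have h1 := abs_sum_mul_le Finset.univ (a := θ.a) (by norm_num : (0 : ℝ) ≤ 4)
      (fun k _ => hθ.2.2.2 k) (fun k _ => abs_hidden_le hθ hU hu (m - 1) k)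
    simp only [Finset.card_univ, Fintype.card_fin, hm1] at h1
    push_cast at h1
    have h2 : 0 ≤ 48 ^ m * U := by positivity
    unfold squareGate dotProduct
    linarith
  refine ⟨hb hθ hu.1, hb hθ' hu.2.1, ?_⟩
  have h1 := abs_sum_mul_sub_le Finset.univ (a := θ.a) (a' := θ'.a) (by norm_num : (0 : ℝ) ≤ 4) hε
      (fun k _ => hθ.2.2.2 k) (fun k _ => hc.2.2.2 k)
      (fun k _ => abs_hidden_le hθ' hU hu.2.1 (m - 1) k)
      (fun k _ => abs_hidden_sub_le hθ hθ' hε hc hU hu (m - 1) (by omega) k)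
  simp only [Finset.card_univ, Fintype.card_fin, hm1] at h1
  push_cast at h1
  unfold squareGate dotProduct
  refine h1.trans_eq (by ring)

/-- A product gate multiplies the bound of its inputs by at most `48 ^ (m + 2)`, whereas the relative
distance `ε` is preserved. -/
theorem ctrl_productGate (hθ : θ.Bounded) (hθ' : θ'.Bounded) (hε : 0 ≤ ε) (hm : 1 ≤ m)
    (hc : Close ε m θ θ') (hU : 1 ≤ U) {u u' v v' : ℝ} (hu : Ctrl ε U u u')
    (hv : Ctrl ε U v v') :
    Ctrl ε (48 ^ (m + 2) * U) (θ.productGate m u v) (θ'.productGate m u' v') := by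
  have hs : Ctrl ε U |(u + v) / 2| |(u' + v') / 2| := by
    refine ⟨?_, ?_, (abs_abs_sub_abs_le _ _).trans ?_⟩
    · rw [abs_abs, abs_div, abs_two]; linarith [abs_add_le u v, hu.1, hv.1]
    · rw [abs_abs, abs_div, abs_two]; linarith [abs_add_le u' v', hu.2.1, hv.2.1]
    · rw [← sub_div, abs_div, abs_two, show u + v - (u' + v') = (u - u') + (v - v') by ring]
      linarith [abs_add_le (u - u') (v - v'), hu.2.2, hv.2.2]
  have hd : Ctrl ε U |(u - v) / 2| |(u' - v') / 2| := by
    refine ⟨?_, ?_, (abs_abs_sub_abs_le _ _).trans ?_⟩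
    · rw [abs_abs, abs_div, abs_two]; linarith [abs_sub u v, hu.1, hv.1]
    · rw [abs_abs, abs_div, abs_two]; linarith [abs_sub u' v', hu.2.1, hv.2.1]
    · rw [← sub_div, abs_div, abs_two, show u - v - (u' - v') = (u - u') - (v - v') by ring]
      linarith [abs_sub (u - u') (v - v'), hu.2.2, hv.2.2]
  have h1 := ctrl_squareGate hθ hθ' hε hm hc hU hs
  have h2 := ctrl_squareGate hθ hθ' hε hm hc hU hd
  have h3 : 0 ≤ 48 ^ m * U := by positivity
  have h4 : (48 : ℝ) ^ (m + 2) * U = 2304 * (48 ^ m * U) := by rw [pow_add]; ring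
  rw [h4]
  unfold productGate
  refine ⟨?_, ?_, ?_⟩
  · refine (abs_sub _ _).trans ?_
    linarith [h1.1, h2.1]
  · refine (abs_sub _ _).trans ?_
    linarith [h1.2.1, h2.2.1]
  · rw [show ∀ a b c e : ℝ, a - b - (c - e) = (a - c) - (b - e) by intros; ring]
    refine (abs_sub _ _).trans ?_
    have := mul_nonneg hε h3
    nlinarith [h1.2.2, h2.2.2]

end GateParams

theorem ctrl_treeGate {θ θ' : ℕ → GateParams} {ε U : ℝ} {m ℓ : ℕ} (hε : 0 ≤ ε) (hm : 1 ≤ m)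
    (hθ : ∀ k, (θ k).Bounded) (hθ' : ∀ k, (θ' k).Bounded)
    (hc : ∀ k ≤ 2 ^ ℓ, (θ k).Close ε m (θ' k)) (hU : 1 ≤ U) {u u' : ℝ} (hu : Ctrl ε U u u')
    (s : ℕ) (hs : s ≤ ℓ) (k : ℕ) (hk : k ≤ 2 ^ s) :
    Ctrl ε ((48 ^ (m + 2)) ^ s * U) (treeGate θ m u k) (treeGate θ' m u' k) := by
  have hΓ : (1 : ℝ) ≤ 48 ^ (m + 2) := one_le_pow₀ (by norm_num)
  induction s generalizing k with
  | zero =>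
    have hk1 : k ≤ 1 := by simpa using hk
    rw [treeGate_of_le_one θ m u hk1, treeGate_of_le_one θ' m u' hk1]
    simpa using hu
  | succ s ih =>
    have h1 : 1 ≤ (48 ^ (m + 2) : ℝ) ^ s := one_le_pow₀ hΓ
    by_cases hk1 : k ≤ 1
    · rw [treeGate_of_le_one θ m u hk1, treeGate_of_le_one θ' m u' hk1]
      exact hu.mono hε (le_mul_of_one_le_left (by linarith) (one_le_pow₀ hΓ))
    · rw [treeGate_of_not_le_one θ m u hk1, treeGate_of_not_le_one θ' m u' hk1]
      have h2 := Nat.pow_log_le_self 2 (x := k - 1) (by omega)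
      have h3 := Nat.lt_pow_succ_log_self (b := 2) (by norm_num) (k - 1)
      have hlog : Nat.log 2 (k - 1) ≤ s := by
        have : Nat.log 2 (k - 1) < s + 1 :=
          Nat.log_lt_of_lt_pow (by omega) (by omega)
        omega
      have h4 : 2 ^ Nat.log 2 (k - 1) ≤ 2 ^ s := Nat.pow_le_pow_right (by norm_num) hlog
      rw [Nat.succ_eq_add_one, pow_succ] at h3
      have := GateParams.ctrl_productGate (hθ k) (hθ' k) hε hm
        (hc k (hk.trans (Nat.pow_le_pow_right (by norm_num) hs)))
        (U := (48 ^ (m + 2)) ^ s * U) (by nlinarith)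
        (ih (by omega) (2 ^ Nat.log 2 (k - 1)) h4)
        (ih (by omega) (k - 2 ^ Nat.log 2 (k - 1)) (by omega))
      rwa [pow_succ', mul_assoc]

theorem trapezoid_le_one (b u : ℝ) (hb : 0 ≤ b) : trapezoid b u ≤ 1 := by
  unfold trapezoid relu
  rcases le_total (u + b + 1) 0 with h1 | h1 <;> rcases le_total (u + b) 0 with h2 | h2 <;>
  rcases le_total (u - b) 0 with h3 | h3 <;> rcases le_total (u - b - 1) 0 with h4 | h4 <;>
  simp only [max_eq_left, max_eq_right, h1, h2, h3, h4] <;> linarith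

theorem trapezoid_eq_one {b u : ℝ} (h : |u| ≤ b) : trapezoid b u = 1 := by
  have := abs_le.mp h
  unfold trapezoid
  rw [relu_of_nonneg (by linarith), relu_of_nonneg (by linarith), relu_of_nonpos (by linarith),
    relu_of_nonpos (by linarith)]
  ring

theorem trapezoid_nonpos {b u : ℝ} (hb : 0 ≤ b) (h : b + 1 < |u|) : trapezoid b u ≤ 0 := by
  unfold trapezoid
  rcases lt_abs.mp h with h | h
  · rw [relu_of_nonneg (by linarith), relu_of_nonneg (by linarith), relu_of_nonneg (by linarith),
      relu_of_nonneg (by linarith)]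
    linarith
  · rw [relu_of_nonpos (by linarith), relu_of_nonpos (by linarith), relu_of_nonpos (by linarith),
      relu_of_nonpos (by linarith)]
    linarith

theorem truncation_eq_one {d : ℕ} {b : ℝ} {x : EuclideanSpace ℝ (Fin d)} (h : ∀ i, |x i| ≤ b) :
    truncation b x = 1 := by
  unfold truncation
  rw [Finset.sum_congr rfl fun i _ => trapezoid_eq_one (h i)]
  simp [relu]

theorem abs_truncation_le_one {d : ℕ} {b : ℝ} (hb : 0 ≤ b) (x : EuclideanSpace ℝ (Fin d)) :
    |truncation b x| ≤ 1 := by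
  have : ∑ i, trapezoid b (x i) ≤ d := by
    refine (Finset.sum_le_sum fun i _ => trapezoid_le_one b (x i) hb).trans ?_
    simp
  unfold truncation
  rw [abs_of_nonneg (relu_nonneg _)]
  exact max_le (by linarith) (by norm_num)

/-- The truncation function vanishes outside of a cube. -/
theorem truncation_eq_zero {d : ℕ} {b : ℝ} (hb : 0 ≤ b) {x : EuclideanSpace ℝ (Fin d)} {i : Fin d}
    (h : b + 1 < |x i|) : truncation b x = 0 := by
  unfold truncation
  refine relu_of_nonpos ?_
  rw [← Finset.add_sum_erase _ _ (Finset.mem_univ i)]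
  have h1 := trapezoid_nonpos hb h
  have h2 : ∑ k ∈ Finset.univ.erase i, trapezoid b (x k) ≤ (d : ℝ) - 1 := by
    refine (Finset.sum_le_sum fun k _ => trapezoid_le_one b (x k) hb).trans ?_
    have : 1 ≤ d := i.pos
    simp [Finset.card_erase_of_mem]
    rw [Nat.cast_sub this]; simp
  linarith

theorem GateParams.productGate_zero_left (θ : GateParams) (m : ℕ) (v : ℝ) :
    θ.productGate m 0 v = 0 := by
  unfold productGate
  rw [zero_add, zero_sub, neg_div, abs_neg, sub_self]

namespace NetParams

/-- All parameters that enter the function computed by the network differ by at most `ε` (by at most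
`d * ε` for the weight vectors of the affine maps). -/
def Close {d K : ℕ} (ε : ℝ) (m ℓ : ℕ) (P P' : NetParams d K) : Prop :=
  (∀ i j, ‖P.w i j - P'.w i j‖ ≤ d * ε) ∧ (∀ i j, |P.v i j - P'.v i j| ≤ ε) ∧
  (∀ i j, (P.pre i j).Close ε m (P'.pre i j)) ∧ (∀ i j, (P.sq i j).Close ε m (P'.sq i j)) ∧
  (∀ j, ∀ k ≤ 2 ^ ℓ, (P.tree j k).Close ε m (P'.tree j k)) ∧
  (∀ k ≤ 2 ^ ℓ, ∀ j, |P.c k j - P'.c k j| ≤ ε) ∧ |P.c₀ - P'.c₀| ≤ ε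

variable {d K : ℕ} {P P' : NetParams d K} {ε CK0 CK1 CK l b U : ℝ} {m ℓ : ℕ}

theorem norm_le_of_abs_le {x : EuclideanSpace ℝ (Fin d)} {B : ℝ} (hB : 0 ≤ B)
    (h : ∀ i, |x i| ≤ B) : ‖x‖ ≤ d * B := by
  rcases Nat.eq_zero_or_pos d with hd | hd
  · subst hd
    rw [Subsingleton.elim x 0]; simp
  have hd1 : (1 : ℝ) ≤ d := by exact_mod_cast hd
  refine le_of_sq_le_sq ?_ (by positivity)
  rw [EuclideanSpace.real_norm_sq_eq]
  calc ∑ i, x i ^ 2 ≤ ∑ _i : Fin d, B ^ 2 := Finset.sum_le_sum fun i _ => by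
        rw [← sq_abs]; exact pow_le_pow_left₀ (abs_nonneg _) (h i) 2
    _ = d * B ^ 2 := by simp
    _ ≤ (d * B) ^ 2 := by 
        rw [mul_pow]
        exact mul_le_mul_of_nonneg_right (by nlinarith) (sq_nonneg B)

/-- The truncated affine maps are uniformly controlled on the whole space, because the truncation
function vanishes outside of a cube. -/
theorem ctrl_truncated (hε : 0 ≤ ε) (hm : 1 ≤ m) (hb : 0 ≤ b) (hCK0 : 0 ≤ CK0) (hCK1 : 0 ≤ CK1)
    (hP : P.Admissible CK0 CK1 CK) (hP' : P'.Admissible CK0 CK1 CK) (hc : Close ε m ℓ P P')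
    (hU : (CK0 + 1) * ((d : ℝ) ^ 2 * (b + 1)) + CK1 + 1 ≤ U) (i : Fin d) (j : Fin K)
    (x : EuclideanSpace ℝ (Fin d)) :
    Ctrl ε (48 ^ (m + 2) * U) (P.truncated b m i j x) (P'.truncated b m i j x) := by
  have hd1 : (1 : ℝ) ≤ d := by exact_mod_cast i.pos
  have hdb : 0 ≤ (d : ℝ) ^ 2 * (b + 1) := by positivity
  have hU1 : 1 ≤ U := by nlinarith [mul_nonneg hCK0 hdb]
  unfold truncated
  by_cases hx : ∃ i, b + 1 < |x i|
  · obtain ⟨i', hi'⟩ := hx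
    rw [truncation_eq_zero hb hi', GateParams.productGate_zero_left,
      GateParams.productGate_zero_left]
    have : 0 ≤ 48 ^ (m + 2) * U := by positivity
    refine ⟨by simpa, by simpa, by simpa using mul_nonneg hε this⟩
  · push Not at hx
    have hn := norm_le_of_abs_le (by linarith) hx
    have hdd : (d : ℝ) * (b + 1) ≤ (d : ℝ) ^ 2 * (b + 1) := by nlinarith
    refine GateParams.ctrl_productGate (hP.2.2.1 i j) (hP'.2.2.1 i j) hε hm (hc.2.2.1 i j) hU1
      ⟨(abs_truncation_le_one hb x).trans hU1, (abs_truncation_le_one hb x).trans hU1, by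
        rw [sub_self, abs_zero]; positivity⟩ ?_
    have haff : ∀ {P : NetParams d K}, P.Admissible CK0 CK1 CK → |P.affine i j x| ≤ U := by
      intro P hP
      unfold affine
      refine (abs_add_le _ _).trans ?_
      have h1 := abs_real_inner_le_norm (P.w i j) x
      have h2 := mul_le_mul (hP.1 i j) hn (norm_nonneg _) hCK0
      have h3 := hP.2.1 i j
      nlinarith
    refine ⟨haff hP, haff hP', ?_⟩
    unfold affine
    rw [show inner ℝ (P.w i j) x + P.v i j - (inner ℝ (P'.w i j) x + P'.v i j) =
      inner ℝ (P.w i j - P'.w i j) x + (P.v i j - P'.v i j) by rw [inner_sub_left]; ring]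
    refine (abs_add_le _ _).trans ?_
    have h1 := abs_real_inner_le_norm (P.w i j - P'.w i j) x
    have h2 := mul_le_mul (hc.1 i j) hn (norm_nonneg _) (by positivity)
    have h3 := hc.2.1 i j
    have h4 : (d : ℝ) * ε * (d * (b + 1)) = ε * ((d : ℝ) ^ 2 * (b + 1)) := by ring
    have h5 : (d : ℝ) ^ 2 * (b + 1) + 1 ≤ U := by nlinarith [mul_nonneg hCK0 hdb]
    nlinarith

theorem ctrl_hStar (hε : 0 ≤ ε) (hm : 1 ≤ m) (hb : 0 ≤ b) (hCK0 : 0 ≤ CK0) (hCK1 : 0 ≤ CK1)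
    (hd : 1 ≤ d) (hP : P.Admissible CK0 CK1 CK) (hP' : P'.Admissible CK0 CK1 CK)
    (hc : Close ε m ℓ P P')
    (hU : (CK0 + 1) * ((d : ℝ) ^ 2 * (b + 1)) + CK1 + 1 ≤ U) {k : ℕ} (hk : k ≤ 2 ^ ℓ) (j : Fin K)
    (x : EuclideanSpace ℝ (Fin d)) :
    Ctrl ε ((48 ^ (m + 2)) ^ (ℓ + 2) * U) (P.hStar b m k j x) (P'.hStar b m k j x) := by
  have hd1 : (1 : ℝ) ≤ d := by exact_mod_cast hd
  have hdb : 0 ≤ (d : ℝ) ^ 2 * (b + 1) := by positivity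
  have hU1 : 1 ≤ U := by nlinarith [mul_nonneg hCK0 hdb]
  have hΓ : (1 : ℝ) ≤ 48 ^ (m + 2) := one_le_pow₀ (by norm_num)
  have hU2 : 1 ≤ 48 ^ (m + 2) * U := by nlinarith
  have hU3 : 1 ≤ 48 ^ (m + 2) * (48 ^ (m + 2) * U) := by nlinarith
  have h1 : ∀ i, Ctrl ε (48 ^ (m + 2) * (48 ^ (m + 2) * U))
      ((P.sq i j).productGate m (P.truncated b m i j x) (P.truncated b m i j x))
      ((P'.sq i j).productGate m (P'.truncated b m i j x) (P'.truncated b m i j x)) := fun i => by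
    have := ctrl_truncated hε hm hb hCK0 hCK1 hP hP' hc hU i j x
    exact GateParams.ctrl_productGate (hP.2.2.2.1 i j) (hP'.2.2.2.1 i j) hε hm
      (hc.2.2.2.1 i j) hU2 this this
  have havg : ∀ {f : Fin d → ℝ} {B : ℝ}, (∀ i, |f i| ≤ B) → |1 / (d : ℝ) * ∑ i, f i| ≤ B := by
    intro f B hf
    rw [abs_mul, abs_of_pos (by positivity), one_div, inv_mul_le_iff₀ (by positivity)]
    refine (Finset.abs_sum_le_sum_abs _ _).trans ?_
    refine (Finset.sum_le_card_nsmul _ _ B fun i _ => hf i).trans_eq ?_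
    simp
  have := ctrl_treeGate hε hm (fun k => hP.2.2.2.2.1 j k) (fun k => hP'.2.2.2.2.1 j k)
    (hc.2.2.2.2.1 j) hU3
    (u := 1 / (d : ℝ) * ∑ i, (P.sq i j).productGate m (P.truncated b m i j x)
      (P.truncated b m i j x))
    (u' := 1 / (d : ℝ) * ∑ i, (P'.sq i j).productGate m (P'.truncated b m i j x)
      (P'.truncated b m i j x))
    ⟨havg fun i => (h1 i).1, havg fun i => (h1 i).2.1, by
      rw [← mul_sub, ← Finset.sum_sub_distrib]; exact havg fun i => (h1 i).2.2⟩ ℓ le_rfl k hk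
  have e : (48 ^ (m + 2) : ℝ) ^ (ℓ + 2) * U =
      (48 ^ (m + 2)) ^ ℓ * (48 ^ (m + 2) * (48 ^ (m + 2) * U)) := by
    rw [pow_add ((48 : ℝ) ^ (m + 2)) ℓ 2]; ring
  rw [e]
  exact this

/-- The function computed by a network depends Lipschitz continuously on the parameters. -/
theorem abs_toFun_sub_le (hε : 0 ≤ ε) (hm : 1 ≤ m) (hb : 0 ≤ b) (hl : 0 < l) (hCK0 : 0 ≤ CK0)
    (hCK1 : 0 ≤ CK1) (hCK : 0 ≤ CK) (hd : 1 ≤ d) (hP : P.Admissible CK0 CK1 CK)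
    (hP' : P'.Admissible CK0 CK1 CK) (hc : Close ε m ℓ P P')
    (x : EuclideanSpace ℝ (Fin d)) :
    |P.toFun l b m ℓ x - P'.toFun l b m ℓ x| ≤
      4 / l * ((K * 2 ^ ℓ + 1) * (CK + 1) * ((48 ^ (m + 2)) ^ (ℓ + 2) *
        ((CK0 + 1) * ((d : ℝ) ^ 2 * (b + 1)) + CK1 + 1))) * ε := by
  set U := (CK0 + 1) * ((d : ℝ) ^ 2 * (b + 1)) + CK1 + 1
  set V := (48 ^ (m + 2) : ℝ) ^ (ℓ + 2) * U with hV
  have hdb : 0 ≤ (d : ℝ) ^ 2 * (b + 1) := by positivity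
  have hU1 : 1 ≤ U := by nlinarith [mul_nonneg hCK0 hdb]
  have hV1 : 1 ≤ V := by
    have : 1 ≤ (48 ^ (m + 2) : ℝ) ^ (ℓ + 2) := one_le_pow₀ (one_le_pow₀ (by norm_num))
    nlinarith
  refine (abs_scaling_sub_scaling_le hl _ _).trans ?_
  rw [mul_assoc]
  refine mul_le_mul_of_nonneg_left ?_ (by positivity)
  rw [show ∀ s c s' c' : ℝ, s + c - (s' + c') = (s - s') + (c - c') by intros; ring]
  refine (abs_add_le _ _).trans ?_
  rw [← Finset.sum_sub_distrib]
  have h1 : |∑ j, (∑ k ∈ Finset.Icc 1 (2 ^ ℓ), P.c k j * P.hStar b m k j x -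
      ∑ k ∈ Finset.Icc 1 (2 ^ ℓ), P'.c k j * P'.hStar b m k j x)| ≤
      K * (2 ^ ℓ * (CK * (ε * V) + ε * V)) := by
    refine (Finset.abs_sum_le_sum_abs _ _).trans ?_
    refine (Finset.sum_le_card_nsmul _ _ (2 ^ ℓ * (CK * (ε * V) + ε * V)) fun j _ => ?_).trans_eq
      (by simp)
    have hk : ∀ k ∈ Finset.Icc 1 (2 ^ ℓ), k ≤ 2 ^ ℓ := fun k hk => (Finset.mem_Icc.mp hk).2
    have := abs_sum_mul_sub_le (Finset.Icc 1 (2 ^ ℓ)) (a := fun k => P.c k j)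
      (a' := fun k => P'.c k j) hCK hε (fun k _ => hP.2.2.2.2.2.1 k j)
      (fun k h => hc.2.2.2.2.2.1 k (hk k h) j)
      (fun k h => (ctrl_hStar hε hm hb hCK0 hCK1 hd hP hP' hc le_rfl (hk k h) j x).2.1)
      (fun k h => (ctrl_hStar hε hm hb hCK0 hCK1 hd hP hP' hc le_rfl (hk k h) j x).2.2)
    simpa using this
  have h2 := hc.2.2.2.2.2.2
  have h3 : 0 ≤ (K : ℝ) * 2 ^ ℓ := by positivity
  have h4 : ε ≤ ε * V := le_mul_of_one_le_right hε hV1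
  have h5 : 0 ≤ ε * V := hε.trans h4
  have h6 : 0 ≤ CK * (ε * V) := mul_nonneg hCK h5
  nlinarith

end NetParams

/-! ### Finite nets -/

/-- The set `S` has a net of at most `N` of its own points with respect to the relation `r`. -/
def HasNet {α : Type*} (S : Set α) (r : α → α → Prop) (N : ℕ) : Prop :=
  ∃ T : Finset α, T.card ≤ N ∧ (∀ y ∈ T, y ∈ S) ∧ ∀ x ∈ S, ∃ y ∈ T, r x y

namespace HasNet

variable {α β : Type*} {S : Set α} {r : α → α → Prop} {N : ℕ}

theorem pi (h : HasNet S r N) (ι : Type*) [Fintype ι] :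
    HasNet {f : ι → α | ∀ i, f i ∈ S} (fun f g => ∀ i, r (f i) (g i))
      (N ^ Fintype.card ι) := by
  classical
  obtain ⟨T, h1, h2, h3⟩ := h
  refine ⟨Fintype.piFinset fun _ => T, ?_, fun f hf i => h2 _ (Fintype.mem_piFinset.mp hf i),
    fun f hf => ?_⟩
  · rw [Fintype.card_piFinset, Finset.prod_const, Finset.card_univ]
    exact Nat.pow_le_pow_left h1 _
  · choose g hg using fun i => h3 (f i) (hf i)
    exact ⟨g, Fintype.mem_piFinset.mpr fun i => (hg i).1, fun i => (hg i).2⟩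

theorem prod (h : HasNet S r N) {S' : Set β} {r' : β → β → Prop} {N' : ℕ} (h' : HasNet S' r' N') :
    HasNet (S ×ˢ S') (fun x y => r x.1 y.1 ∧ r' x.2 y.2) (N * N') := by
  classical
  obtain ⟨T, h1, h2, h3⟩ := h
  obtain ⟨T', h1', h2', h3'⟩ := h'
  refine ⟨T ×ˢ T', ?_, fun p hp => ?_, fun p hp => ?_⟩
  · rw [Finset.card_product]; exact Nat.mul_le_mul h1 h1'
  · rw [Finset.mem_product] at hp; exact ⟨h2 _ hp.1, h2' _ hp.2⟩
  · obtain ⟨y, hy, hy'⟩ := h3 p.1 hp.1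
    obtain ⟨z, hz, hz'⟩ := h3' p.2 hp.2
    exact ⟨(y, z), Finset.mem_product.mpr ⟨hy, hz⟩, hy', hz'⟩

theorem image (h : HasNet S r N) {S' : Set β} {r' : β → β → Prop} (φ : α → β)
    (hφ : ∀ x ∈ S, φ x ∈ S')
    (hsurj : ∀ y ∈ S', ∃ x ∈ S, ∀ x' ∈ S, r x x' → r' y (φ x')) : HasNet S' r' N := by
  classical
  obtain ⟨T, h1, h2, h3⟩ := h
  refine ⟨T.image φ, Finset.card_image_le.trans h1, fun y hy => ?_, fun y hy => ?_⟩
  · obtain ⟨x, hx, rfl⟩ := Finset.mem_image.mp hy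
    exact hφ x (h2 x hx)
  · obtain ⟨x, hx, hxr⟩ := hsurj y hy
    obtain ⟨x', hx', hr⟩ := h3 x hx
    exact ⟨φ x', Finset.mem_image_of_mem φ hx', hxr x' (h2 x' hx') hr⟩

theorem restrict (h : HasNet S r N) {S' : Set α} (hS : S' ⊆ S)
    (hr : ∀ x ∈ S', ∀ y ∈ S, r x y → y ∈ S') : HasNet S' r N := by
  classical
  obtain ⟨T, h1, h2, h3⟩ := h
  refine ⟨T.filter (· ∈ S'), (Finset.card_filter_le _ _).trans h1,
    fun y hy => (Finset.mem_filter.mp hy).2, fun x hx => ?_⟩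
  obtain ⟨y, hy, hxy⟩ := h3 x (hS hx)
  exact ⟨y, Finset.mem_filter.mpr ⟨hy, hr x hx y (h2 y hy) hxy⟩, hxy⟩

theorem mono (h : HasNet S r N) {N' : ℕ} (hN : N ≤ N') : HasNet S r N' :=
  ⟨h.choose, h.choose_spec.1.trans hN, h.choose_spec.2⟩

end HasNet

/-- A net of an interval whose points are obtained by rounding towards zero, so that norm constraints
on vectors are preserved when their coordinates are rounded. -/
theorem hasNet_abs_le {ε B : ℝ} (hε : 0 < ε) {g : ℕ} (hg : 2 * (B / ε) + 1 ≤ g) :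
    HasNet {x : ℝ | |x| ≤ B} (fun x y => |x - y| ≤ ε ∧ |y| ≤ |x|) g := by
  classical
  by_cases hB : 0 ≤ B
  swap
  · exact ⟨∅, by simp, by simp, fun x hx => absurd ((abs_nonneg x).trans hx) hB⟩
  set M := ⌊B / ε⌋₊ with hM
  have hM1 : (M : ℝ) ≤ B / ε := Nat.floor_le (by positivity)
  refine ⟨(Finset.Icc (-(M : ℤ)) M).image fun k : ℤ => ε * k, ?_, ?_, ?_⟩
  · refine Finset.card_image_le.trans ?_
    rw [Int.card_Icc]
    have : ((2 * M + 1 : ℕ) : ℝ) ≤ g := by push_cast; linarith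
    have := Nat.cast_le.mp this
    omega
  · intro y hy
    obtain ⟨k, hk, rfl⟩ := Finset.mem_image.mp hy
    rw [Finset.mem_Icc] at hk
    have hk1 : |(k : ℝ)| ≤ M := by
      rw [abs_le]; constructor <;> exact_mod_cast by omega
    rw [Set.mem_ofPred_eq, abs_mul, abs_of_pos hε, mul_comm]
    rw [le_div_iff₀ hε] at hM1
    exact (mul_le_mul_of_nonneg_right hk1 hε.le).trans hM1
  · intro x hx
    have hx : |x| ≤ B := hx
    set a := ⌊|x| / ε⌋₊ with ha
    have h1 : (a : ℝ) * ε ≤ |x| := by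
      rw [← le_div_iff₀ hε]; exact Nat.floor_le (by positivity)
    have h2 : |x| < (a + 1) * ε := by
      rw [← div_lt_iff₀ hε]; exact Nat.lt_floor_add_one _
    have h3 : a ≤ M := Nat.floor_le_floor (by gcongr)
    rcases le_total 0 x with h | h
    · rw [abs_of_nonneg h] at h1 h2
      refine ⟨ε * (a : ℤ), Finset.mem_image_of_mem _ (Finset.mem_Icc.mpr ⟨by omega, by omega⟩), ?_, ?_⟩
      · rw [abs_le]; push_cast; constructor <;> nlinarith
      · rw [abs_of_nonneg h, abs_of_nonneg (by positivity)]; push_cast; linarith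
    · rw [abs_of_nonpos h] at h1 h2
      refine ⟨ε * ((-(a : ℤ) : ℤ) : ℝ), Finset.mem_image_of_mem _
        (Finset.mem_Icc.mpr ⟨by omega, by omega⟩), ?_, ?_⟩
      · rw [abs_le]; push_cast; constructor <;> nlinarith
      · rw [abs_of_nonpos h]; push_cast
        rw [mul_neg, abs_neg, abs_of_nonneg (by positivity)]; linarith

theorem hasNet_norm_le {d : ℕ} {ε B : ℝ} (hε : 0 < ε) {g : ℕ} (hg : 2 * (B / ε) + 1 ≤ g) :
    HasNet {w : EuclideanSpace ℝ (Fin d) | ‖w‖ ≤ B} (fun x y => ‖x - y‖ ≤ d * ε) (g ^ d) := by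
  have h1 := ((hasNet_abs_le hε hg).pi (Fin d)).image
    (S' := {w : EuclideanSpace ℝ (Fin d) | ∀ i, |w i| ≤ B})
    (r' := fun x y => ‖x - y‖ ≤ d * ε ∧ ‖y‖ ≤ ‖x‖) (fun f => WithLp.toLp 2 f)
    (fun f hf => hf) (fun w hw => ⟨w.ofLp, hw, fun f _ hr => ⟨?_, ?_⟩⟩)
  · rw [Fintype.card_fin] at h1
    obtain ⟨T, t1, t2, t3⟩ := h1.restrict (S' := {w : EuclideanSpace ℝ (Fin d) | ‖w‖ ≤ B})
      (fun w hw i => (PiLp.norm_apply_le w i).trans hw) (fun w hw y _ hy => hy.2.trans hw)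
    exact ⟨T, t1, t2, fun x hx => (t3 x hx).imp fun y hy => ⟨hy.1, hy.2.1⟩⟩
  · exact NetParams.norm_le_of_abs_le hε.le fun i => (hr i).1
  · rw [EuclideanSpace.norm_eq, EuclideanSpace.norm_eq]
    exact Real.sqrt_le_sqrt (Finset.sum_le_sum fun i _ =>
      pow_le_pow_left₀ (norm_nonneg _) (hr i).2 2)

theorem hasNet_gateParams {ε : ℝ} (hε : 0 < ε) {g : ℕ} (hg : 2 * (4 / ε) + 1 ≤ g) (m : ℕ) :
    HasNet {θ : GateParams | θ.Bounded} (GateParams.Close ε m) (g ^ (30 * m + 10)) := by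
  have h0 := hasNet_abs_le hε hg
  have h5 := h0.pi (Fin 5)
  have hW := (h5.pi (Fin 5)).pi (Fin m)
  have hβ := h5.pi (Fin m)
  have h := ((h5.prod hW).prod (hβ.prod h5)).image (S' := {θ : GateParams | θ.Bounded})
    (r' := GateParams.Close ε m)
    (fun p => ⟨p.1.1, fun j => if h : j < m then Matrix.of (p.1.2 ⟨j, h⟩) else 0,
      fun j => if h : j < m then p.2.1 ⟨j, h⟩ else 0, p.2.2⟩) ?_ ?_
  · refine h.mono (le_of_eq ?_)
    simp only [Fintype.card_fin, ← pow_mul, ← pow_add]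
    congr 1; ring
  · rintro ⟨⟨w, W⟩, β, a⟩ ⟨⟨hw, hW⟩, hβ, ha⟩
    refine ⟨hw, fun j i k => ?_, fun j i => ?_, ha⟩
    · by_cases h : j < m
      · simpa [h] using hW ⟨j, h⟩ i k
      · simp [h]
    · by_cases h : j < m
      · simpa [h] using hβ ⟨j, h⟩ i
      · simp [h]
  · intro θ hθ
    refine ⟨((θ.W₁, fun j => θ.W j), (fun j => θ.β j, θ.a)),
      ⟨⟨hθ.1, fun j i k => hθ.2.1 j i k⟩, fun j i => hθ.2.2.1 j i, hθ.2.2.2⟩, ?_⟩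
    rintro ⟨⟨w, W⟩, β, a⟩ - ⟨⟨h1, h2⟩, h3, h4⟩
    refine ⟨fun i => (h1 i).1, fun j hj i k => ?_, fun j hj i => ?_, fun i => (h4 i).1⟩
    · simpa [hj] using (h2 ⟨j, hj⟩ i k).1
    · simpa [hj] using (h3 ⟨j, hj⟩ i).1

theorem hasNet_netParams {d K : ℕ} {ε CK0 CK1 CK : ℝ} (hε : 0 < ε) (hCK : 0 ≤ CK) {g : ℕ}
    (hg4 : 2 * (4 / ε) + 1 ≤ g) (hg0 : 2 * (CK0 / ε) + 1 ≤ g) (hg1 : 2 * (CK1 / ε) + 1 ≤ g)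
    (hg : 2 * (CK / ε) + 1 ≤ g) (m ℓ : ℕ) :
    HasNet {P : NetParams d K | P.Admissible CK0 CK1 CK} (NetParams.Close ε m ℓ)
      (g ^ (d * K * d + d * K + 2 * (d * K * (30 * m + 10)) +
        (2 ^ ℓ + 1) * K * (30 * m + 10) + (2 ^ ℓ + 1) * K + 1)) := by
  classical
  have hw := ((hasNet_norm_le (d := d) hε hg0).pi (Fin K)).pi (Fin d)
  have hv := ((hasNet_abs_le hε hg1).pi (Fin K)).pi (Fin d)
  have hG := hasNet_gateParams hε hg4 m
  have hp := (hG.pi (Fin K)).pi (Fin d)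
  have ht := (hG.pi (Fin (2 ^ ℓ + 1))).pi (Fin K)
  have hA := hasNet_abs_le hε hg
  have hc := (hA.pi (Fin K)).pi (Fin (2 ^ ℓ + 1))
  set θ₀ : GateParams := ⟨0, 0, 0, 0⟩
  have hθ₀ : θ₀.Bounded :=
    ⟨fun i => by simp [θ₀], fun j i k => by simp [θ₀], fun j i => by simp [θ₀],
      fun i => by simp [θ₀]⟩
  have h := ((hw.prod hv).prod ((hp.prod hp).prod (ht.prod (hc.prod hA)))).image
    (S' := {P : NetParams d K | P.Admissible CK0 CK1 CK}) (r' := NetParams.Close ε m ℓ)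
    (fun p => ⟨p.1.1, p.1.2, p.2.1.1, p.2.1.2,
      fun j k => if h : k < 2 ^ ℓ + 1 then p.2.2.1 j ⟨k, h⟩ else θ₀,
      fun k j => if h : k < 2 ^ ℓ + 1 then p.2.2.2.1 ⟨k, h⟩ j else 0, p.2.2.2.2⟩) ?_ ?_
  · refine h.mono (le_of_eq ?_)
    simp only [Fintype.card_fin, ← pow_mul, ← pow_add, ← pow_succ]
    congr 1; ring
  · rintro ⟨⟨w, v⟩, ⟨pre, sq⟩, tree, c, c₀⟩ ⟨⟨hw, hv⟩, ⟨hpre, hsq⟩, ht, hc, hc₀⟩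
    refine ⟨hw, hv, hpre, hsq, fun j k => ?_, fun k j => ?_, hc₀⟩
    · by_cases h : k < 2 ^ ℓ + 1
      · simpa [h] using ht j ⟨k, h⟩
      · simpa [h] using hθ₀
    · by_cases h : k < 2 ^ ℓ + 1
      · simpa [h] using hc ⟨k, h⟩ j
      · simpa [h] using hCK
  · intro P hP
    refine ⟨((P.w, P.v), ((P.pre, P.sq), (fun j k => P.tree j k, (fun k j => P.c k j, P.c₀)))),
      ⟨⟨hP.1, hP.2.1⟩, ⟨hP.2.2.1, hP.2.2.2.1⟩, fun j k => hP.2.2.2.2.1 j k,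
        fun k j => hP.2.2.2.2.2.1 k j, hP.2.2.2.2.2.2⟩, ?_⟩
    rintro ⟨⟨w, v⟩, ⟨pre, sq⟩, tree, c, c₀⟩ - ⟨⟨h1, h2⟩, ⟨h3, h4⟩, h5, h6, h7⟩
    refine ⟨h1, fun i j => (h2 i j).1, h3, h4, fun j k hk => ?_, fun k hk j => ?_, h7.1⟩
    · have hk' : k < 2 ^ ℓ + 1 := Nat.lt_succ_of_le hk
      simpa [hk'] using h5 j ⟨k, hk'⟩
    · have hk' : k < 2 ^ ℓ + 1 := Nat.lt_succ_of_le hk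
      simpa [hk'] using (h6 ⟨k, hk'⟩ j).1

/-- A finite uniform net of the hypothesis space. -/
theorem hasNet_hypothesisSpace {d K : ℕ} {ε CK0 CK1 CK l b : ℝ} (hε : 0 < ε) (hCK0 : 0 ≤ CK0)
    (hCK1 : 0 ≤ CK1) (hCK : 0 ≤ CK) (hd : 1 ≤ d) (hb : 0 ≤ b) (hl : 0 < l) {g : ℕ}
    (hg4 : 2 * (4 / ε) + 1 ≤ g) (hg0 : 2 * (CK0 / ε) + 1 ≤ g) (hg1 : 2 * (CK1 / ε) + 1 ≤ g)
    (hg : 2 * (CK / ε) + 1 ≤ g) {m : ℕ} (hm : 1 ≤ m) (ℓ : ℕ) :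
    HasNet (hypothesisSpace d K CK0 CK1 CK l b m ℓ)
      (fun f f' => ∀ x, |f x - f' x| ≤
        4 / l * ((K * 2 ^ ℓ + 1) * (CK + 1) * ((48 ^ (m + 2)) ^ (ℓ + 2) *
          ((CK0 + 1) * ((d : ℝ) ^ 2 * (b + 1)) + CK1 + 1))) * ε)
      (g ^ (d * K * d + d * K + 2 * (d * K * (30 * m + 10)) +
        (2 ^ ℓ + 1) * K * (30 * m + 10) + (2 ^ ℓ + 1) * K + 1)) := by
  refine (hasNet_netParams hε hCK hg4 hg0 hg1 hg m ℓ).image (fun P => P.toFun l b m ℓ)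
    (fun P hP => ⟨P, hP, rfl⟩) ?_
  rintro f ⟨P, hP, rfl⟩
  exact ⟨P, hP, fun P' hP' hc x =>
    NetParams.abs_toFun_sub_le hε.le hm hb hl hCK0 hCK1 hCK hd hP hP' hc x⟩

/-! ### Functions computed by squaring gates -/

/-- The function `f` is computed on `[0, 1]` by a gate with `m` hidden layers. The input weights are
kept in `[-1, 1]`, so that gates can be composed without leaving the range of the weights. -/
def IsGate (m : ℕ) (f : ℝ → ℝ) : Prop :=
  ∃ θ : GateParams, θ.Bounded ∧ (∀ i, |θ.W₁ i| ≤ 1) ∧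
    ∀ u ∈ Set.Icc (0 : ℝ) 1, θ.squareGate m u = f u

theorem isGate_id {m : ℕ} : IsGate m id := by
  set θ : GateParams := ⟨![1, 0, 0, 0, 0], fun _ => !![1, 0, 0, 0, 0; 0, 0, 0, 0, 0; 0, 0, 0, 0, 0;
    0, 0, 0, 0, 0; 0, 0, 0, 0, 0], 0, ![1, 0, 0, 0, 0]⟩ with hθ
  have hh : ∀ u ∈ Set.Icc (0 : ℝ) 1, ∀ j, θ.hidden u j = ![u, 0, 0, 0, 0] := by
    intro u hu j
    induction j with
    | zero => ext i; fin_cases i <;> simp [GateParams.hidden, hθ, relu, hu.1]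
    | succ j ih =>
      ext i
      rw [GateParams.hidden, ih]
      fin_cases i <;> simp [hθ, relu, hu.1, Matrix.mulVec, dotProduct, Fin.sum_univ_five]
  refine ⟨θ, ⟨fun i => ?_, fun j i k => ?_, fun j i => ?_, fun i => ?_⟩, fun i => ?_,
    fun u hu => ?_⟩
  · fin_cases i <;> norm_num [hθ]
  · fin_cases i <;> fin_cases k <;> norm_num [hθ]
  · simp [hθ]
  · fin_cases i <;> norm_num [hθ]
  · fin_cases i <;> norm_num [hθ]
  · rw [GateParams.squareGate, hh u hu]
    simp [hθ, dotProduct, Fin.sum_univ_five]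

/-- The tent map of `[0, 1]`. -/
def tent (y : ℝ) : ℝ := 2 * y - 4 * relu (y - 1 / 2)

theorem tent_of_le {y : ℝ} (h : y ≤ 1 / 2) : tent y = 2 * y := by
  rw [tent, relu_of_nonpos (by linarith)]; ring

theorem tent_of_ge {y : ℝ} (h : 1 / 2 ≤ y) : tent y = 2 - 2 * y := by
  rw [tent, relu_of_nonneg (by linarith)]; ring

theorem tent_mem {y : ℝ} (hy : y ∈ Set.Icc (0 : ℝ) 1) : tent y ∈ Set.Icc (0 : ℝ) 1 := by
  rcases le_total y (1 / 2) with h | h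
  · rw [tent_of_le h]; constructor <;> linarith [hy.1]
  · rw [tent_of_ge h]; constructor <;> linarith [hy.2]

theorem iterate_tent_mem {y : ℝ} (hy : y ∈ Set.Icc (0 : ℝ) 1) (j : ℕ) :
    tent^[j] y ∈ Set.Icc (0 : ℝ) 1 := by
  induction j with
  | zero => exact hy
  | succ j ih => rw [Function.iterate_succ_apply']; exact tent_mem ih

/-- The partial sums of the expansion `y - y ^ 2 = ∑ s ≥ 1, 4⁻ˢ * tent^[s] y`. -/
def tentSum (j : ℕ) (y : ℝ) : ℝ := ∑ s ∈ Finset.range j, (1 / 4) ^ (s + 1) * tent^[s + 1] y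

theorem tentSum_nonneg {y : ℝ} (hy : y ∈ Set.Icc (0 : ℝ) 1) (j : ℕ) : 0 ≤ tentSum j y :=
  Finset.sum_nonneg fun s _ => mul_nonneg (by positivity) (iterate_tent_mem hy _).1

/-- The remainder of the expansion of `y - y ^ 2`: it solves
`g y = (tent y + g (tent y)) / 4` for `g y = y - y ^ 2`. -/
theorem sub_sq_sub_tentSum (j : ℕ) (y : ℝ) : y - y ^ 2 - tentSum j y =
    (1 / 4) ^ j * (tent^[j] y - (tent^[j] y) ^ 2) := by
  induction j with
  | zero => simp [tentSum]
  | succ j ih =>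
    rw [tentSum, Finset.sum_range_succ, ← sub_sub, ← tentSum, ih, Function.iterate_succ_apply']
    set x := tent^[j] y
    rcases le_total x (1 / 2) with h | h
    · rw [tent_of_le h]; ring
    · rw [tent_of_ge h]; ring

/-- The approximation of the square function on `[0, 1]` by a gate: the piecewise linear interpolation
at the multiples of `2⁻¹ ^ j`, which lies above the square. -/
def sqApprox (j : ℕ) (y : ℝ) : ℝ := y - tentSum j y

theorem sqApprox_sub_sq {y : ℝ} (hy : y ∈ Set.Icc (0 : ℝ) 1) (j : ℕ) :
    0 ≤ sqApprox j y - y ^ 2 ∧ sqApprox j y - y ^ 2 ≤ (1 / 4) ^ j / 4 := by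
  have h1 := sub_sq_sub_tentSum j y
  have h2 := iterate_tent_mem hy j
  rw [show sqApprox j y - y ^ 2 = y - y ^ 2 - tentSum j y by unfold sqApprox; ring, h1]
  set x := tent^[j] y
  have h3 : 0 ≤ x - x ^ 2 := by nlinarith [h2.1, h2.2]
  have h4 : x - x ^ 2 ≤ 1 / 4 := by nlinarith [sq_nonneg (x - 1 / 2)]
  have h5 : (0 : ℝ) < (1 / 4) ^ j := by positivity
  constructor
  · positivity
  · nlinarith

theorem sqApprox_mem {y : ℝ} (hy : y ∈ Set.Icc (0 : ℝ) 1) (j : ℕ) :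
    sqApprox j y ∈ Set.Icc (0 : ℝ) 1 := by
  constructor
  · linarith [(sqApprox_sub_sq hy j).1, sq_nonneg y]
  · unfold sqApprox; linarith [tentSum_nonneg hy j, hy.2]

theorem sqApprox_zero (j : ℕ) : sqApprox j 0 = 0 := by
  have h : ∀ s, tent^[s] 0 = 0 := fun s => Function.iterate_fixed (by simp [tent, relu]) s
  simp [sqApprox, tentSum, h]

/-- The weights of a gate whose hidden layers carry the iterated tent maps of the input, together
with the partial sums `tentSum` and the input itself. The output weights `a` are free. -/
def tentParams (a : Fin 5 → ℝ) : GateParams where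
  W₁ := ![1, 1, 0, 1, 0]
  W j := !![2, -4, 0, 0, 0; 2, -4, 0, 0, 0; 2 * (1 / 4) ^ j, -4 * (1 / 4) ^ j, 1, 0, 0;
    0, 0, 0, 1, 0; 0, 0, 0, 0, 0]
  β _ := ![0, -1 / 2, 0, 0, 0]
  a := a

theorem tentParams_hidden (a : Fin 5 → ℝ) {u : ℝ} (hu : u ∈ Set.Icc (0 : ℝ) 1) (j : ℕ) :
    (tentParams a).hidden u j =
      ![tent^[j] u, relu (tent^[j] u - 1 / 2), tentSum j u, u, 0] := by
  induction j with
  | zero =>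
    ext i
    fin_cases i
    · simp [GateParams.hidden, tentParams, relu_of_nonneg hu.1]
    · simp [GateParams.hidden, tentParams, sub_eq_add_neg, neg_div]
    · simp [GateParams.hidden, tentParams, tentSum, relu]
    · simp [GateParams.hidden, tentParams, relu_of_nonneg hu.1]
    · simp [GateParams.hidden, tentParams, relu]
  | succ j ih =>
    ext i
    rw [GateParams.hidden, ih]
    have hm := iterate_tent_mem hu (j + 1)
    have hT : tent^[j + 1] u = 2 * tent^[j] u - 4 * relu (tent^[j] u - 1 / 2) :=
      Function.iterate_succ_apply' _ _ _
    have hs : tentSum (j + 1) u = tentSum j u + (1 / 4) ^ (j + 1) * tent^[j + 1] u := by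
      rw [tentSum, Finset.sum_range_succ, ← tentSum]
    have hs0 := tentSum_nonneg hu (j + 1)
    rw [hT] at hm hs
    rw [hT]
    fin_cases i
    · rw [← relu_of_nonneg hm.1]
      simp [tentParams, Matrix.mulVec, dotProduct, Fin.sum_univ_five, sub_eq_add_neg]
    · simp only [tentParams, Matrix.mulVec, dotProduct, Fin.sum_univ_five]
      simp
      congr 1; ring
    · rw [← relu_of_nonneg hs0, hs]
      simp [tentParams, Matrix.mulVec, dotProduct, Fin.sum_univ_five]
      congr 1; ring
    · simp [tentParams, Matrix.mulVec, dotProduct, Fin.sum_univ_five, relu_of_nonneg hu.1]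
    · simp [tentParams, Matrix.mulVec, dotProduct, Fin.sum_univ_five, relu]

theorem tentParams_bounded {a : Fin 5 → ℝ} (ha : ∀ i, |a i| ≤ 4) : (tentParams a).Bounded := by
  refine ⟨fun i => ?_, fun j i k => ?_, fun j i => ?_, ha⟩
  · fin_cases i <;> norm_num [tentParams]
  · have h1 : (0 : ℝ) ≤ (1 / 4) ^ j := by positivity
    have h2 : ((1 : ℝ) / 4) ^ j ≤ 1 := pow_le_one₀ (by norm_num) (by norm_num)
    have h3 : |2 * ((1 : ℝ) / 4) ^ j| ≤ 4 := by rw [abs_of_nonneg (by linarith)]; linarith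
    have h4 : |-4 * ((1 : ℝ) / 4) ^ j| ≤ 4 := by rw [abs_of_nonpos (by linarith)]; linarith
    fin_cases i <;> fin_cases k <;> first | exact h3 | exact h4 | norm_num [tentParams]
  · fin_cases i <;> norm_num [tentParams, abs_le]

theorem isGate_tentParams {a : Fin 5 → ℝ} (ha : ∀ i, |a i| ≤ 4) (m : ℕ) :
    IsGate m fun u => a ⬝ᵥ ![tent^[m - 1] u, relu (tent^[m - 1] u - 1 / 2), tentSum (m - 1) u, u, 0] :=
  ⟨tentParams a, tentParams_bounded ha, fun i => by fin_cases i <;> norm_num [tentParams],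
    fun u hu => by rw [GateParams.squareGate, tentParams_hidden a hu]; rfl⟩

theorem isGate_sqApprox (m : ℕ) : IsGate m (sqApprox (m - 1)) := by
  obtain ⟨θ, h1, h2, h3⟩ := isGate_tentParams (a := ![0, 0, -1, 1, 0])
    (fun i => by fin_cases i <;> norm_num) m
  refine ⟨θ, h1, h2, fun u hu => ?_⟩
  rw [h3 u hu]
  simp [dotProduct, Fin.sum_univ_five, sqApprox]
  ring

theorem isGate_iterate_tent {m : ℕ} (hm : 1 ≤ m) : IsGate m tent^[m] := by
  obtain ⟨θ, h1, h2, h3⟩ := isGate_tentParams (a := ![2, -4, 0, 0, 0])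
    (fun i => by fin_cases i <;> norm_num) m
  refine ⟨θ, h1, h2, fun u hu => ?_⟩
  obtain ⟨m, rfl⟩ := Nat.exists_eq_add_of_le' hm
  rw [h3 u hu, Function.iterate_succ_apply']
  simp [dotProduct, Fin.sum_univ_five, tent]
  ring

/-- Continuous piecewise linear functions with `n` knots and nonnegative changes of the slope (when
read from right to left) are computed by gates with `n` hidden layers. -/
theorem isGate_sum_relu {n : ℕ} (hn : 1 ≤ n) {c₀ : ℝ} (hc₀ : 0 ≤ c₀) (hc₀' : c₀ ≤ 4) {c κ : ℕ → ℝ}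
    (hc : ∀ k, 0 ≤ c k) (hc4 : ∀ k, c k ≤ 4) (hκ : ∀ k, |κ k| ≤ 3) :
    IsGate n fun u => c₀ + ∑ k ∈ Finset.range n, c k * relu (1 - u - κ k) := by
  -- The three active channels carry `1 - u`, one relu term, and the accumulated sum.
  set θ : GateParams := ⟨![-1, -1, 0, 0, 0], fun j => !![1, 0, 0, 0, 0; 1, 0, 0, 0, 0;
    0, c (j - 1), 1, 0, 0; 0, 0, 0, 0, 0; 0, 0, 0, 0, 0],
    fun j => if j = 0 then ![1, 1 - κ 0, c₀, 0, 0] else ![0, -κ j, 0, 0, 0],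
    ![0, c (n - 1), 1, 0, 0]⟩ with hθ
  have hh : ∀ u ∈ Set.Icc (0 : ℝ) 1, ∀ j, θ.hidden u j = ![1 - u, relu (1 - u - κ j),
      c₀ + ∑ k ∈ Finset.range j, c k * relu (1 - u - κ k), 0, 0] := by
    intro u hu j
    have hz : 0 ≤ 1 - u := by linarith [hu.2]
    induction j with
    | zero =>
      ext i
      fin_cases i
      · rw [← relu_of_nonneg hz]; simp [GateParams.hidden, hθ]; congr 1; ring
      · simp [GateParams.hidden, hθ]; congr 1; ring
      · simp [GateParams.hidden, hθ, relu_of_nonneg hc₀]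
      · simp [GateParams.hidden, hθ, relu]
      · simp [GateParams.hidden, hθ, relu]
    | succ j ih =>
      ext i
      rw [GateParams.hidden, ih]
      fin_cases i
      · simp [hθ, Matrix.mulVec, dotProduct, Fin.sum_univ_five, relu_of_nonneg hz]
      · simp [hθ, Matrix.mulVec, dotProduct, Fin.sum_univ_five]; congr 1
      · have h0 : 0 ≤ c₀ + ∑ k ∈ Finset.range (j + 1), c k * relu (1 - u - κ k) :=
          add_nonneg hc₀ (Finset.sum_nonneg fun k _ => mul_nonneg (hc k) (relu_nonneg _))
        rw [← relu_of_nonneg h0, Finset.sum_range_succ]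
        simp [hθ, Matrix.mulVec, dotProduct, Fin.sum_univ_five]; congr 1; ring
      · simp [hθ, Matrix.mulVec, dotProduct, Fin.sum_univ_five, relu]
      · simp [hθ, Matrix.mulVec, dotProduct, Fin.sum_univ_five, relu]
  have hc' : ∀ k, |c k| ≤ 4 := fun k => by rw [abs_of_nonneg (hc k)]; exact hc4 k
  refine ⟨θ, ⟨fun i => ?_, fun j i k => ?_, fun j i => ?_, fun i => ?_⟩, fun i => ?_,
    fun u hu => ?_⟩
  · fin_cases i <;> norm_num [hθ]
  · fin_cases i <;> fin_cases k <;> first | exact hc' _ | norm_num [hθ]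
  · have h1 := abs_le.mp (hκ 0)
    have h2 := hκ j
    have h3 : |1 - κ 0| ≤ 4 := by rw [abs_le]; constructor <;> linarith
    have h4 : |-κ j| ≤ 4 := by rw [abs_neg]; linarith
    have h5 : |c₀| ≤ 4 := by rwa [abs_of_nonneg hc₀]
    simp only [hθ]
    split_ifs <;> fin_cases i <;> first | exact h3 | exact h4 | exact h5 | norm_num
  · fin_cases i <;> first | exact hc' _ | norm_num [hθ]
  · fin_cases i <;> norm_num [hθ]
  · obtain ⟨n, rfl⟩ := Nat.exists_eq_add_of_le' hn
    rw [GateParams.squareGate, hh u hu, Nat.add_sub_cancel]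
    simp [Finset.sum_range_succ, hθ, dotProduct, Fin.sum_univ_five]
    ring

/-- The output weights of the first gate and the input weights of the second one are merged into one
matrix of rank one, whose entries stay in `[-4, 4]` since the input weights are in `[-1, 1]`. -/
theorem IsGate.comp {m₁ m₂ : ℕ} {f g : ℝ → ℝ} (hg : IsGate m₂ g) (hf : IsGate m₁ f) (hm₁ : 1 ≤ m₁)
    (hm₂ : 1 ≤ m₂) (hmem : ∀ u ∈ Set.Icc (0 : ℝ) 1, f u ∈ Set.Icc (0 : ℝ) 1) :
    IsGate (m₁ + m₂) (g ∘ f) := by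
  obtain ⟨θ₁, b₁, w₁, e₁⟩ := hf
  obtain ⟨θ₂, b₂, w₂, e₂⟩ := hg
  set θ : GateParams := ⟨θ₁.W₁,
    fun j => if j < m₁ then θ₁.W j else if j = m₁ then Matrix.of fun i k => θ₂.W₁ i * θ₁.a k
      else θ₂.W (j - m₁),
    fun j => if j < m₁ then θ₁.β j else θ₂.β (j - m₁), θ₂.a⟩ with hθ
  have h1 : ∀ u, ∀ j < m₁, θ.hidden u j = θ₁.hidden u j := by
    intro u j hj
    induction j with
    | zero => ext i; simp [GateParams.hidden, hθ, hj]
    | succ j ih =>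
      ext i
      rw [GateParams.hidden, ih (by omega), GateParams.hidden]
      simp [hθ, hj]
  have h2 : ∀ u j, θ.hidden u (m₁ + j) = θ₂.hidden (θ₁.squareGate m₁ u) j := by
    intro u j
    induction j with
    | zero =>
      obtain ⟨k, rfl⟩ := Nat.exists_eq_add_of_le' hm₁
      ext i
      rw [add_zero]
      show relu ((θ.W (k + 1)).mulVec (θ.hidden u k) i + θ.β (k + 1) i) = _
      rw [h1 u k (by omega)]
      simp [GateParams.hidden, hθ, GateParams.squareGate, Matrix.mulVec, dotProduct, Finset.mul_sum, mul_assoc]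
    | succ j ih =>
      ext i
      show relu ((θ.W (m₁ + j + 1)).mulVec (θ.hidden u (m₁ + j)) i + θ.β (m₁ + j + 1) i) =
        relu ((θ₂.W (j + 1)).mulVec (θ₂.hidden (θ₁.squareGate m₁ u) j) i + θ₂.β (j + 1) i)
      rw [ih]
      have e1 : ¬ (m₁ + j + 1 < m₁) := by omega
      have e2 : ¬ (m₁ + j + 1 = m₁) := by omega
      have e3 : m₁ + j + 1 - m₁ = j + 1 := by omega
      simp [hθ, e1, e2, e3]
  refine ⟨θ, ⟨b₁.1, fun j i k => ?_, fun j i => ?_, b₂.2.2.2⟩, w₁, fun u hu => ?_⟩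
  · simp only [hθ]
    split_ifs
    · exact b₁.2.1 j i k
    · rw [Matrix.of_apply, abs_mul]
      calc _ ≤ 1 * 4 := mul_le_mul (w₂ i) (b₁.2.2.2 k) (abs_nonneg _) zero_le_one
        _ = 4 := one_mul _
    · exact b₂.2.1 _ i k
  · simp only [hθ]
    split_ifs
    · exact b₁.2.2.1 j i
    · exact b₂.2.2.1 _ i
  · rw [GateParams.squareGate, show m₁ + m₂ - 1 = m₁ + (m₂ - 1) by omega, h2]
    show θ₂.squareGate m₂ (θ₁.squareGate m₁ u) = _
    rw [e₁ u hu, e₂ _ (hmem u hu)]; rfl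

/-- The product gate made of approximate squares. -/
theorem abs_productGate_sub_mul_le {θ : GateParams} {m j : ℕ}
    (hθ : ∀ u ∈ Set.Icc (0 : ℝ) 1, θ.squareGate m u = sqApprox j u) {u v : ℝ} (hu : |u| ≤ 1)
    (hv : |v| ≤ 1) :
    |θ.productGate m u v - u * v| ≤ (1 / 4) ^ j ∧ |θ.productGate m u v| ≤ 1 := by
  have hs : |(u + v) / 2| ∈ Set.Icc (0 : ℝ) 1 := by
    refine ⟨abs_nonneg _, ?_⟩
    rw [abs_div, abs_two]; linarith [abs_add_le u v]
  have hd : |(u - v) / 2| ∈ Set.Icc (0 : ℝ) 1 := by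
    refine ⟨abs_nonneg _, ?_⟩
    rw [abs_div, abs_two]; linarith [abs_sub u v]
  rw [GateParams.productGate, hθ _ hs, hθ _ hd]
  have h1 := sqApprox_sub_sq hs j
  have h2 := sqApprox_sub_sq hd j
  have h3 := sqApprox_mem hs j
  have h4 := sqApprox_mem hd j
  rw [sq_abs] at h1 h2
  have h5 : u * v = ((u + v) / 2) ^ 2 - ((u - v) / 2) ^ 2 := by ring
  have h6 : (0 : ℝ) < (1 / 4) ^ j := by positivity
  constructor
  · rw [h5, abs_le]; constructor <;> linarith
  · rw [abs_le]; constructor <;> linarith [h3.1, h3.2, h4.1, h4.2]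

/-- A product gate on the diagonal computes any function that its gate computes, up to a constant. This
makes tree networks more than networks of multiplications. -/
theorem productGate_self {θ : GateParams} {m : ℕ} {f : ℝ → ℝ}
    (hθ : ∀ u ∈ Set.Icc (0 : ℝ) 1, θ.squareGate m u = f u) {u : ℝ} (hu : u ∈ Set.Icc (0 : ℝ) 1) :
    θ.productGate m u u = f u - f 0 := by
  rw [GateParams.productGate, sub_self, zero_div, abs_zero, ← two_mul, mul_div_cancel_left₀ u
    two_ne_zero, abs_of_nonneg hu.1, hθ u hu, hθ 0 (by simp)]

theorem productGate_one_left {θ : GateParams} {m : ℕ}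
    (hθ : ∀ u ∈ Set.Icc (0 : ℝ) 1, θ.squareGate m u = u) {v : ℝ} (hv : |v| ≤ 1) :
    θ.productGate m 1 v = v := by
  have := abs_le.mp hv
  have e1 : |(1 + v) / 2| = (1 + v) / 2 := abs_of_nonneg (by linarith)
  have e2 : |(1 - v) / 2| = (1 - v) / 2 := abs_of_nonneg (by linarith)
  rw [GateParams.productGate, e1, e2, hθ _ ⟨by linarith, by linarith⟩,
    hθ _ ⟨by linarith, by linarith⟩]
  ring

/-! ### Approximation of exponential functions on the unit interval -/

/-- The iterated tent map is a zigzag function, with zeros at the even multiples of `2⁻¹ ^ p`. -/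
theorem iterate_tent_eq (p : ℕ) {y : ℝ} (hy : y ∈ Set.Icc (0 : ℝ) 1) {i : ℤ}
    (h1 : 2 * (i : ℝ) - 1 ≤ 2 ^ p * y) (h2 : 2 ^ p * y ≤ 2 * i + 1) :
    tent^[p] y = |2 ^ p * y - 2 * i| := by
  induction p generalizing y i with
  | zero =>
    simp only [pow_zero, one_mul, Function.iterate_zero, id_eq] at h1 h2 ⊢
    have hi1 : (i : ℝ) ≤ 1 := by linarith [hy.2]
    have hi0 : (-1 : ℝ) < i := by linarith [hy.1]
    have hi1' : i ≤ 1 := by exact_mod_cast hi1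
    have hi0' : -1 < i := by exact_mod_cast hi0
    obtain rfl | rfl : i = 0 ∨ i = 1 := by omega
    · simp [abs_of_nonneg hy.1]
    · have : y = 1 := le_antisymm hy.2 (by push_cast at h1; linarith)
      rw [this]; norm_num
  | succ p ih =>
    rw [Function.iterate_succ_apply]
    rcases le_total y (1 / 2) with h | h
    · have e : (2 : ℝ) ^ p * (2 * y) = 2 ^ (p + 1) * y := by ring
      rw [tent_of_le h, ih (y := 2 * y) (i := i) ⟨by linarith [hy.1], by linarith⟩
        (by rwa [e]) (by rwa [e]), e]
    · have e : (2 : ℝ) ^ p * (2 - 2 * y) = 2 ^ (p + 1) - 2 ^ (p + 1) * y := by ring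
      have e' : (2 : ℝ) ^ (p + 1) = 2 * 2 ^ p := by ring
      rw [tent_of_ge h, ih (y := 2 - 2 * y) (i := 2 ^ p - i) ⟨by linarith [hy.2], by linarith⟩
        (by rw [e]; push_cast; linarith) (by rw [e]; push_cast; linarith), e]
      rw [abs_sub_comm]
      push_cast
      congr 1
      linear_combination e'

/-- The change of the slope at the knot `k` of the piecewise linear function with values `E k` at
the integers `k`, constant on the left of `0`. -/
def slopeChange (E : ℕ → ℝ) : ℕ → ℝ
  | 0 => E 1 - E 0
  | k + 1 => E (k + 2) - 2 * E (k + 1) + E k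

theorem sum_slopeChange_mul (E : ℕ → ℝ) (i : ℕ) (t : ℝ) :
    E 0 + ∑ k ∈ Finset.range (i + 1), slopeChange E k * (t - k) =
      E i + (E (i + 1) - E i) * (t - i) := by
  induction i with
  | zero => simp [slopeChange]
  | succ i ih =>
    rw [Finset.sum_range_succ, ← add_assoc, ih, slopeChange]
    push_cast; ring

theorem sum_slopeChange_mul_relu (E : ℕ → ℝ) {i n : ℕ} (hi : i < n) {t : ℝ} (h1 : (i : ℝ) ≤ t)
    (h2 : t ≤ i + 1) :
    E 0 + ∑ k ∈ Finset.range n, slopeChange E k * relu (t - k) =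
      E i + (E (i + 1) - E i) * (t - i) := by
  rw [← sum_slopeChange_mul]
  congr 1
  rw [← Finset.sum_subset (Finset.range_subset_range.mpr (Nat.succ_le_of_lt hi))]
  · refine Finset.sum_congr rfl fun k hk => ?_
    have : (k : ℝ) ≤ i := by exact_mod_cast Nat.lt_succ_iff.mp (Finset.mem_range.mp hk)
    rw [relu_of_nonneg (by linarith)]
  · intro k _ hk
    have : ((i + 1 : ℕ) : ℝ) ≤ k := by
      rw [Finset.mem_range, not_lt] at hk; exact_mod_cast hk
    rw [relu_of_nonpos (by push_cast at this; linarith), mul_zero]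

/-- The values of `y ↦ exp (-(2 ^ (p + 1) * R * y))` at the points
`y = 1 - (2 * k - 1) / 2 ^ (p + 1)`. The first and the last one, for `k = 0` and `k = 2 ^ p + 1`, lie
outside of the unit interval. -/
def expNode (p : ℕ) (R : ℝ) (k : ℕ) : ℝ := Real.exp (-(2 * 2 ^ p * R) - R + 2 * R * k)

/-- The piecewise linear interpolation of `y ↦ exp (-(2 ^ (p + 1) * R * y))` with knots at the odd
multiples of `2⁻¹ ^ (p + 1)`, where the iterated tent map `tent^[p + 1]` has the value `1`. -/
def expInterp (p : ℕ) (R y : ℝ) : ℝ :=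
  expNode p R 0 + ∑ k ∈ Finset.range (2 ^ p + 1),
    slopeChange (expNode p R) k * relu ((2 * 2 ^ p * (1 - y) + 1) / 2 - k)

/-- Every point of the unit interval lies in one of the cells between two odd multiples of
`2⁻¹ ^ (p + 1)`. On this cell, with the local coordinate `σ`, the exponential function is
`v * exp (R * σ)`, and its interpolation is affine in `σ`. -/
theorem exists_expInterp_eq (p : ℕ) {y : ℝ} (hy : y ∈ Set.Icc (0 : ℝ) 1) :
    ∃ σ : ℝ, |σ| ≤ 1 ∧ (tent^[p + 1] y) ^ 2 = σ ^ 2 ∧ ∃ v : ℝ → ℝ, (∀ R, 0 ≤ R →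
      v R ≤ 1) ∧ (∀ R, 0 < v R) ∧ (∀ R, v R = v (R / 2) ^ 2) ∧
      (∀ R, Real.exp (-(2 * 2 ^ p * R * y)) = v R * Real.exp (R * σ)) ∧
      ∀ R, expInterp p R y = v R * (Real.cosh R + σ * Real.sinh R) := by
  set t : ℝ := (2 * 2 ^ p * (1 - y) + 1) / 2 with ht
  have hM : (0 : ℝ) < 2 ^ p := by positivity
  have ht0 : 0 ≤ t := by
    have : 0 ≤ 2 ^ p * (1 - y) := mul_nonneg hM.le (by linarith [hy.2])
    rw [ht]; linarith
  have htM : t < (2 ^ p + 1 : ℕ) := by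
    have : 2 ^ p * (1 - y) ≤ 2 ^ p := mul_le_of_le_one_right hM.le (by linarith [hy.1])
    rw [ht]; push_cast; linarith
  set i := ⌊t⌋₊ with hi
  have hi1 : (i : ℝ) ≤ t := Nat.floor_le ht0
  have hi2 : t ≤ i + 1 := (Nat.lt_floor_add_one t).le
  have hiM : i < 2 ^ p + 1 := (Nat.floor_lt ht0).mpr htM
  have hiM' : (i : ℝ) ≤ 2 ^ p := by exact_mod_cast Nat.lt_succ_iff.mp hiM
  have hty : 2 * 2 ^ p * y = 2 * 2 ^ p + 1 - 2 * t := by rw [ht]; ring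
  refine ⟨2 * (t - i) - 1, by rw [abs_le]; constructor <;> linarith, ?_,
    fun R => Real.exp (-(2 * 2 ^ p * R) + 2 * R * i), fun R hR => ?_, fun R => Real.exp_pos _,
    fun R => ?_, fun R => ?_, fun R => ?_⟩
  · have e : (2 : ℝ) ^ (p + 1) * y = 2 * 2 ^ p + 1 - 2 * t := by rw [← hty]; ring
    rw [iterate_tent_eq (p + 1) hy (i := 2 ^ p - i) (by rw [e]; push_cast; linarith)
      (by rw [e]; push_cast; linarith), sq_abs, e]
    push_cast; ring
  · rw [Real.exp_le_one_iff]
    nlinarith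
  · beta_reduce
    rw [sq, ← Real.exp_add]; congr 1; ring
  · rw [← Real.exp_add]; congr 1
    rw [show 2 * 2 ^ p * R * y = R * (2 * 2 ^ p * y) by ring, hty]; ring
  · rw [expInterp, ← ht, sum_slopeChange_mul_relu _ hiM hi1 hi2, expNode, expNode, Real.cosh_eq,
      Real.sinh_eq]
    have e1 : Real.exp (-(2 * 2 ^ p * R) - R + 2 * R * (i : ℝ)) =
        Real.exp (-(2 * 2 ^ p * R) + 2 * R * i) * Real.exp (-R) := by
      rw [← Real.exp_add]; congr 1; ring
    have e2 : Real.exp (-(2 * 2 ^ p * R) - R + 2 * R * ((i + 1 : ℕ) : ℝ)) =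
        Real.exp (-(2 * 2 ^ p * R) + 2 * R * i) * Real.exp R := by
      rw [← Real.exp_add]; congr 1; push_cast; ring
    rw [e1, e2]; ring

theorem expInterp_mem {p : ℕ} {R y : ℝ} (hR : 0 ≤ R) (hy : y ∈ Set.Icc (0 : ℝ) 1) :
    expInterp p R y ∈ Set.Icc 0 (Real.exp R) := by
  obtain ⟨σ, hσ, -, v, hv1, hv0, -, -, hV⟩ := exists_expInterp_eq p hy
  have h := abs_le.mp hσ
  have hs := Real.sinh_nonneg_iff.mpr hR
  have h1 : Real.cosh R + σ * Real.sinh R ≤ Real.exp R := by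
    rw [← Real.cosh_add_sinh]; nlinarith
  have h2 : 0 ≤ Real.cosh R + σ * Real.sinh R := by
    have := Real.exp_pos (-R)
    rw [← Real.cosh_sub_sinh] at this
    nlinarith
  rw [hV]
  exact ⟨mul_nonneg (hv0 R).le h2, (mul_le_of_le_one_left h2 (hv1 R hR)).trans h1⟩

theorem slopeChange_expNode_nonneg (p : ℕ) {R : ℝ} (hR : 0 ≤ R) (k : ℕ) :
    0 ≤ slopeChange (expNode p R) k := by
  cases k with
  | zero =>
    rw [slopeChange, sub_nonneg, expNode, expNode, Real.exp_le_exp]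
    push_cast; linarith
  | succ k =>
    have e1 : expNode p R (k + 2) = expNode p R (k + 1) * Real.exp (2 * R) := by
      rw [expNode, expNode, ← Real.exp_add]; congr 1; push_cast; ring
    have e2 : expNode p R k = expNode p R (k + 1) * Real.exp (-(2 * R)) := by
      rw [expNode, expNode, ← Real.exp_add]; congr 1; push_cast; ring
    have h1 : 1 ≤ Real.cosh (2 * R) := Real.one_le_cosh _
    rw [Real.cosh_eq] at h1
    have h0 : 0 < expNode p R (k + 1) := Real.exp_pos _
    rw [slopeChange, e1, e2]
    nlinarith

theorem expNode_le (p : ℕ) {R : ℝ} (hR : 0 ≤ R) {k : ℕ} (hk : k ≤ 2 ^ p + 1) :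
    expNode p R k ≤ Real.exp R := by
  rw [expNode, Real.exp_le_exp]
  have : (k : ℝ) ≤ 2 ^ p + 1 := by exact_mod_cast hk
  nlinarith

theorem slopeChange_expNode_le (p : ℕ) {R : ℝ} (hR : 0 ≤ R) {k : ℕ} (hk : k ≤ 2 ^ p) :
    slopeChange (expNode p R) k ≤ 2 * Real.exp R := by
  have h0 : ∀ k, 0 < expNode p R k := fun k => Real.exp_pos _
  cases k with
  | zero =>
    rw [slopeChange]
    linarith [expNode_le p hR (Nat.le_add_left 1 (2 ^ p)), h0 0, Real.exp_pos R]
  | succ k =>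
    rw [slopeChange]
    linarith [expNode_le p hR (Nat.succ_le_succ hk), h0 (k + 1),
      expNode_le p hR (show k ≤ 2 ^ p + 1 from (Nat.le_succ k).trans (hk.trans (Nat.le_succ _)))]

/-- The normalized interpolation is a gate. The changes of the slope, read from right to left, are
nonnegative by monotonicity and convexity, and after the normalization they are small enough for the
range of the weights. -/
theorem isGate_expInterp (p : ℕ) {R : ℝ} (hR : 0 ≤ R) :
    IsGate (2 ^ p + 1) fun y => expInterp p R y / (2 * 2 ^ p * Real.exp R) := by
  set Λ : ℝ := 2 * 2 ^ p * Real.exp R with hΛ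
  have hM : (1 : ℝ) ≤ 2 ^ p := one_le_pow₀ (by norm_num)
  have hE := Real.exp_pos R
  have hΛ0 : 0 < Λ := by positivity
  have h0 : 0 ≤ expNode p R 0 / Λ := div_nonneg (Real.exp_pos _).le hΛ0.le
  have h1 : expNode p R 0 / Λ ≤ 4 := by
    rw [div_le_iff₀ hΛ0]
    have := expNode_le p hR (Nat.zero_le (2 ^ p + 1))
    nlinarith
  obtain ⟨θ, b, w, h⟩ := isGate_sum_relu (n := 2 ^ p + 1) (Nat.le_add_left 1 _) h0 h1
    (c := fun k => if k ≤ 2 ^ p then slopeChange (expNode p R) k * 2 ^ p / Λ else 0)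
    (κ := fun k => if k ≤ 2 ^ p then (2 * k - 1) / (2 * 2 ^ p) else 0)
    (fun k => by
      split_ifs
      · have := slopeChange_expNode_nonneg p hR k; positivity
      · exact le_rfl)
    (fun k => by
      split_ifs with hk
      · rw [div_le_iff₀ hΛ0]
        have := slopeChange_expNode_le p hR hk
        calc _ ≤ 2 * Real.exp R * 2 ^ p := by gcongr
          _ ≤ _ := by rw [hΛ]; nlinarith
      · norm_num)
    (fun k => by
      split_ifs with hk
      · have hk' : (k : ℝ) ≤ 2 ^ p := by exact_mod_cast hk
        have : (0 : ℝ) ≤ k := k.cast_nonneg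
        rw [abs_le, le_div_iff₀ (by positivity), div_le_iff₀ (by positivity)]
        constructor <;> linarith
      · simp)
  refine ⟨θ, b, w, fun u hu => ?_⟩
  rw [h u hu]
  simp only
  rw [expInterp, add_div, Finset.sum_div]
  congr 1
  refine Finset.sum_congr rfl fun k hk => ?_
  have hk' : k ≤ 2 ^ p := Nat.lt_succ_iff.mp (Finset.mem_range.mp hk)
  rw [if_pos hk', if_pos hk']
  have e : (2 * 2 ^ p * (1 - u) + 1) / 2 - k = 2 ^ p * (1 - u - (2 * k - 1) / (2 * 2 ^ p)) := by
    field_simp; ring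
  have e2 : ∀ x, relu (2 ^ p * x) = 2 ^ p * relu x := fun x => by
    rw [relu, relu, mul_max_of_nonneg _ _ (by positivity), mul_zero]
  rw [e, e2]; ring

theorem abs_exp_sub_sum_le (x : ℝ) (J : ℕ) :
    |Real.exp x - ∑ n ∈ Finset.range J, x ^ n / n.factorial| ≤
      |x| ^ J / J.factorial * Real.exp |x| := by
  have hs : ∀ x : ℝ, HasSum (fun n : ℕ => x ^ n / n.factorial) (Real.exp x) := fun x => by
    rw [Real.exp_eq_exp_ℝ]; exact NormedSpace.expSeries_div_hasSum_exp x
  have h1 := (hasSum_nat_add_iff' J).mpr (hs x)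
  have h2 := (hs |x|).mul_left (|x| ^ J / J.factorial)
  refine h1.norm_le_of_bounded h2 fun n => ?_
  rw [Real.norm_eq_abs, abs_div, abs_pow, Nat.abs_cast, div_mul_div_comm, ← pow_add, add_comm J]
  gcongr
  rw [add_comm n]
  exact_mod_cast Nat.le_of_dvd (Nat.factorial_pos _) (Nat.factorial_mul_factorial_dvd_factorial_add J n)

theorem sum_range_two_mul (f : ℕ → ℝ) (a : ℕ) : ∑ n ∈ Finset.range (2 * a), f n =
    ∑ k ∈ Finset.range a, f (2 * k) + ∑ k ∈ Finset.range a, f (2 * k + 1) := by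
  induction a with
  | zero => simp
  | succ a ih =>
    rw [show 2 * (a + 1) = 2 * a + 1 + 1 by ring, Finset.sum_range_succ, Finset.sum_range_succ, ih,
      Finset.sum_range_succ, Finset.sum_range_succ]
    ring

/-- Division with remainder of a polynomial by `1 - w`, with a bound of the quotient. -/
theorem exists_sum_mul_pow_eq (c : ℕ → ℝ) (a : ℕ) : ∃ γ : ℕ → ℝ,
    (∀ j, |γ j| ≤ ∑ k ∈ Finset.range a, |c k|) ∧ ∀ w : ℝ, ∑ k ∈ Finset.range a, c k * w ^ k =
      ∑ k ∈ Finset.range a, c k + (1 - w) * ∑ k ∈ Finset.range a, γ k * w ^ k := by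
  induction a with
  | zero => exact ⟨0, by simp, by simp⟩
  | succ a ih =>
    obtain ⟨γ, h1, h2⟩ := ih
    refine ⟨fun j => if j < a then γ j - c a else 0, fun j => ?_, fun w => ?_⟩
    · rw [Finset.sum_range_succ]
      simp only
      split_ifs
      · exact (abs_sub _ _).trans (by linarith [h1 j])
      · rw [abs_zero]; exact add_nonneg (Finset.sum_nonneg fun _ _ => abs_nonneg _) (abs_nonneg _)
    · have e : ∑ k ∈ Finset.range a, (if k < a then γ k - c a else 0) * w ^ k =
          ∑ k ∈ Finset.range a, γ k * w ^ k - c a * ∑ k ∈ Finset.range a, w ^ k := by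
        rw [Finset.mul_sum, ← Finset.sum_sub_distrib]
        refine Finset.sum_congr rfl fun k hk => ?_
        rw [if_pos (Finset.mem_range.mp hk)]; ring
      rw [Finset.sum_range_succ, h2, Finset.sum_range_succ, Finset.sum_range_succ, e]
      simp only [lt_irrefl, if_false]
      have := mul_neg_geom_sum w a
      linear_combination c a * this

/-- The exponential function is approximated with the help of the piecewise linear interpolations
for the rates `R` and `R / 2`, and of powers of the square of the iterated tent map. The coefficients
do not depend on the cell, since in the notation of `exists_expInterp_eq` only `v` and `σ` do. -/
theorem exists_abs_exp_sub_le {R : ℝ} (hR : 1 ≤ R) (a : ℕ) : ∃ α γ : ℕ → ℝ,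
    (∀ k, |α k| ≤ 1) ∧ (∀ k, |γ k| ≤ 8 * Real.exp R) ∧ ∀ p : ℕ, ∀ y ∈ Set.Icc (0 : ℝ) 1,
      |Real.exp (-(2 * 2 ^ p * R * y)) -
        ∑ k ∈ Finset.range a, (α k * (expInterp p R y * (tent^[p + 1] y ^ 2) ^ k) +
          γ k * ((expInterp p R y - expInterp p (R / 2) y ^ 2) * (tent^[p + 1] y ^ 2) ^ k))| ≤
        4 * (R ^ (2 * a) / (2 * a).factorial * Real.exp R) := by
  have hR0 : 0 < R := by linarith
  have hsR : 0 < Real.sinh R := Real.sinh_pos_iff.mpr hR0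
  have hs2 : R / 2 ≤ Real.sinh (R / 2) := Real.self_le_sinh_iff.mpr (by linarith)
  have hs2' : 0 < Real.sinh (R / 2) := by linarith
  set co : ℝ := Real.cosh R / Real.sinh R with hco
  have hco0 : 0 < co := div_pos (Real.cosh_pos _) hsR
  have hco2 : co ≤ 2 := by
    rw [hco, div_le_iff₀ hsR]
    have h1 : Real.exp (-R) ≤ Real.exp (-1) := Real.exp_le_exp.mpr (by linarith)
    have h2 : Real.exp 1 ≤ Real.exp R := Real.exp_le_exp.mpr hR
    have h3 := Real.exp_one_gt_d9
    have h4 := Real.exp_neg_one_lt_d9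
    rw [Real.cosh_eq, Real.sinh_eq]; linarith
  set T := R ^ (2 * a) / (2 * a).factorial * Real.exp R with hT
  -- The coefficients of the even part and of the odd part of the Taylor polynomial of `exp (R * σ)`.
  set ce : ℕ → ℝ := fun k => R ^ (2 * k) / (2 * k).factorial with hce
  set so : ℕ → ℝ := fun k => R ^ (2 * k + 1) / (2 * k + 1).factorial with hso
  have hce0 : ∀ k, 0 ≤ ce k := fun k => by positivity
  have hso0 : ∀ k, 0 ≤ so k := fun k => by positivity
  have key : ∀ σ : ℝ, |σ| ≤ 1 → |Real.exp (R * σ) - (∑ k ∈ Finset.range a, ce k * (σ ^ 2) ^ k +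
      σ * ∑ k ∈ Finset.range a, so k * (σ ^ 2) ^ k)| ≤ T := by
    intro σ hσ
    have h := abs_exp_sub_sum_le (R * σ) (2 * a)
    rw [sum_range_two_mul] at h
    have e1 : ∀ k, (R * σ) ^ (2 * k) / (2 * k).factorial = ce k * (σ ^ 2) ^ k := fun k => by
      rw [hce, mul_pow, pow_mul σ]; ring
    have e2 : ∀ k, (R * σ) ^ (2 * k + 1) / (2 * k + 1).factorial = σ * (so k * (σ ^ 2) ^ k) :=
      fun k => by rw [hso, mul_pow, pow_succ σ, pow_mul σ]; ring
    simp only [e1, e2, ← Finset.mul_sum] at h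
    refine h.trans ?_
    have h3 : |R * σ| ≤ R := by
      rw [abs_mul, abs_of_pos hR0]; exact mul_le_of_le_one_right hR0.le hσ
    rw [hT]
    gcongr
  -- At `σ = 1` and `σ = -1` this compares the sums of the coefficients with `cosh R` and `sinh R`.
  have k1 := abs_le.mp (key 1 (by simp))
  have k2 := abs_le.mp (key (-1) (by simp))
  simp only [mul_one, one_pow, mul_neg, neg_mul, one_mul, neg_sq] at k1 k2
  have hC : |∑ k ∈ Finset.range a, ce k - Real.cosh R| ≤ T := by
    rw [Real.cosh_eq, abs_le]; constructor <;> linarith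
  have hS : |∑ k ∈ Finset.range a, so k - Real.sinh R| ≤ T := by
    rw [Real.sinh_eq, abs_le]; constructor <;> linarith
  have hCle : ∀ a, ∑ k ∈ Finset.range a, ce k + ∑ k ∈ Finset.range a, so k ≤ Real.exp R := by
    intro a
    rw [hce, hso]
    have := sum_range_two_mul (fun n => R ^ n / n.factorial) a
    rw [← this]
    exact Real.sum_le_exp_of_nonneg hR0.le _
  have hsole : ∀ k, so k ≤ Real.sinh R := by
    intro k
    exact le_hasSum (Real.hasSum_sinh R) k fun i _ => hso0 i
  have hcele : ∑ k ∈ Finset.range a, ce k ≤ Real.exp R := by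
    linarith [hCle a, Finset.sum_nonneg fun k (_ : k ∈ Finset.range a) => hso0 k]
  have hsosum : ∑ k ∈ Finset.range a, so k ≤ Real.exp R := by
    linarith [hCle a, Finset.sum_nonneg fun k (_ : k ∈ Finset.range a) => hce0 k]
  -- As `v * σ = V / sinh R - co * v`, the odd part is expressed by `V`, at the cost of an even term
  -- `-co * so k`. The resulting even polynomial almost vanishes at `w = 1`, and its quotient by
  -- `1 - w` is multiplied by `V - W ^ 2`, a multiple of `v * (1 - w)`.
  obtain ⟨γ, hγ, hγ'⟩ := exists_sum_mul_pow_eq (fun k => ce k - co * so k) a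
  have hcosum : co * ∑ k ∈ Finset.range a, so k ≤ Real.cosh R := by
    have := sum_le_hasSum (Finset.range a) (fun i _ => hso0 i) (Real.hasSum_sinh R)
    rw [hco, div_mul_eq_mul_div, div_le_iff₀ hsR]
    exact mul_le_mul_of_nonneg_left this (Real.cosh_pos R).le
  have hγ2 : ∀ j, |γ j| ≤ 2 * Real.exp R := by
    intro j
    refine (hγ j).trans ?_
    calc _ ≤ ∑ k ∈ Finset.range a, (ce k + co * so k) := by
          refine Finset.sum_le_sum fun k _ => (abs_sub _ _).trans ?_
          rw [abs_of_nonneg (hce0 k), abs_of_nonneg (mul_nonneg hco0.le (hso0 k))]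
      _ ≤ _ := by
          rw [Finset.sum_add_distrib, ← Finset.mul_sum]
          have : Real.cosh R ≤ Real.exp R := by rw [← Real.cosh_add_sinh]; linarith
          linarith
  refine ⟨fun k => so k / Real.sinh R, fun k => γ k / Real.sinh (R / 2) ^ 2, fun k => ?_,
    fun k => ?_, fun p y hy => ?_⟩
  · rw [abs_div, abs_of_nonneg (hso0 k), abs_of_pos hsR]
    exact div_le_one_of_le₀ (hsole k) hsR.le
  · rw [abs_div, abs_of_pos (pow_pos hs2' 2), div_le_iff₀ (pow_pos hs2' 2)]
    have : 1 / 4 ≤ Real.sinh (R / 2) ^ 2 := by nlinarith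
    nlinarith [hγ2 k, Real.exp_pos R]
  obtain ⟨σ, hσ, hw, v, hv1, hv0, hv2, hve, hV⟩ := exists_expInterp_eq p hy
  have hV1 := hV R
  have hV2 := hV (R / 2)
  rw [hw, Finset.sum_add_distrib]
  set V := expInterp p R y
  set W := expInterp p (R / 2) y
  set w := σ ^ 2 with hwdef
  have e1 : ∑ k ∈ Finset.range a, so k / Real.sinh R * (V * w ^ k) =
      v R * (co + σ) * ∑ k ∈ Finset.range a, so k * w ^ k := by
    rw [Finset.mul_sum, hV1]
    refine Finset.sum_congr rfl fun k _ => ?_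
    rw [hco]; field_simp
  have hVW : V - W ^ 2 = v R * Real.sinh (R / 2) ^ 2 * (1 - w) := by
    have h1 := Real.cosh_two_mul (R / 2)
    have h2 := Real.sinh_two_mul (R / 2)
    rw [mul_div_cancel₀ R two_ne_zero] at h1 h2
    rw [hV1, hV2, hv2 R, h1, h2, hwdef]; ring
  have e2 : ∑ k ∈ Finset.range a, γ k / Real.sinh (R / 2) ^ 2 * ((V - W ^ 2) * w ^ k) =
      v R * ((1 - w) * ∑ k ∈ Finset.range a, γ k * w ^ k) := by
    rw [Finset.mul_sum, Finset.mul_sum, hVW]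
    refine Finset.sum_congr rfl fun k _ => ?_
    field_simp
  have e3 : ∑ k ∈ Finset.range a, ce k * w ^ k - co * ∑ k ∈ Finset.range a, so k * w ^ k =
      ∑ k ∈ Finset.range a, ce k - co * ∑ k ∈ Finset.range a, so k +
        (1 - w) * ∑ k ∈ Finset.range a, γ k * w ^ k := by
    have := hγ' w
    simp only [Finset.sum_sub_distrib, ← Finset.mul_sum] at this
    rw [← this]
    simp only [sub_mul, Finset.sum_sub_distrib, mul_assoc, ← Finset.mul_sum]
  have e4 : ∀ x y z : ℝ, ∀ s t : ℝ, v R * x - (v R * (co + σ) * s + v R * t) =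
      v R * ((x - (z + σ * s)) + (z - co * s - t)) := fun x y z s t => by ring
  rw [hve, e1, e2, e4 _ 0 (∑ k ∈ Finset.range a, ce k * w ^ k), e3, add_sub_cancel_right]
  have h1 := abs_le.mp (key σ hσ)
  have h2 := abs_le.mp hC
  have h3 := abs_le.mp hS
  have hcos : co * Real.sinh R = Real.cosh R := by rw [hco]; field_simp
  have hT0 : 0 ≤ T := by positivity
  have h4 : |co * (∑ k ∈ Finset.range a, so k - Real.sinh R)| ≤ 2 * T := by
    rw [abs_mul, abs_of_pos hco0]
    exact mul_le_mul hco2 hS (abs_nonneg _) (by norm_num)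
  rw [mul_sub, hcos] at h4
  have h4 := abs_le.mp h4
  rw [abs_mul, abs_of_pos (hv0 R)]
  refine (mul_le_of_le_one_left (abs_nonneg _) (hv1 R hR0.le)).trans ?_
  rw [abs_le]; constructor <;> linarith

/-! ### Tree networks computing powers -/

theorem treeGate_two {θ : ℕ → GateParams} {m : ℕ}
    (hθ : ∀ t ∈ Set.Icc (0 : ℝ) 1, (θ 2).squareGate m t = t) {u : ℝ} (hu : u ∈ Set.Icc (0 : ℝ) 1) :
    treeGate θ m u 2 = u := by
  have h := treeGate_two_pow_add θ m u (j := 0) (i := 1) le_rfl le_rfl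
  norm_num [treeGate_one] at h
  rw [h, productGate_self (f := id) hθ hu]; simp

theorem treeGate_three {θ : ℕ → GateParams} {m : ℕ} {f : ℝ → ℝ}
    (hθ : ∀ t ∈ Set.Icc (0 : ℝ) 1, (θ 2).squareGate m t = t)
    (hf : ∀ t ∈ Set.Icc (0 : ℝ) 1, (θ 3).squareGate m t = f t) {u : ℝ}
    (hu : u ∈ Set.Icc (0 : ℝ) 1) : treeGate θ m u 3 = f u - f 0 := by
  have h := treeGate_two_pow_add θ m u (j := 1) (i := 1) le_rfl (by norm_num)
  norm_num [treeGate_one] at h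
  rw [h, treeGate_two hθ hu, productGate_self hf hu]

theorem treeGate_four {θ : ℕ → GateParams} {m : ℕ}
    (hθ : ∀ t ∈ Set.Icc (0 : ℝ) 1, (θ 2).squareGate m t = t)
    (hθ4 : ∀ t ∈ Set.Icc (0 : ℝ) 1, (θ 4).squareGate m t = t) {u : ℝ}
    (hu : u ∈ Set.Icc (0 : ℝ) 1) : treeGate θ m u 4 = u := by
  have h := treeGate_two_pow_add θ m u (j := 1) (i := 2) (by norm_num) (by norm_num)
  norm_num at h
  rw [h, treeGate_two hθ hu, productGate_self (f := id) hθ4 hu]; simp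

theorem treeGate_five {θ : ℕ → GateParams} {m : ℕ} {f : ℝ → ℝ}
    (hθ : ∀ t ∈ Set.Icc (0 : ℝ) 1, (θ 2).squareGate m t = t)
    (hθ4 : ∀ t ∈ Set.Icc (0 : ℝ) 1, (θ 4).squareGate m t = t)
    (hf : ∀ t ∈ Set.Icc (0 : ℝ) 1, (θ 5).squareGate m t = f t) {u : ℝ}
    (hu : u ∈ Set.Icc (0 : ℝ) 1) : treeGate θ m u 5 = f u - f 0 := by
  have h := treeGate_two_pow_add θ m u (j := 2) (i := 1) le_rfl (by norm_num)
  norm_num [treeGate_one] at h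
  rw [h, treeGate_four hθ hθ4 hu, productGate_self hf hu]

theorem treeGate_eight {θ : ℕ → GateParams} {m : ℕ} {f : ℝ → ℝ}
    (hθ : ∀ t ∈ Set.Icc (0 : ℝ) 1, (θ 2).squareGate m t = t)
    (hθ4 : ∀ t ∈ Set.Icc (0 : ℝ) 1, (θ 4).squareGate m t = t)
    (hf : ∀ t ∈ Set.Icc (0 : ℝ) 1, (θ 8).squareGate m t = f t) {u : ℝ}
    (hu : u ∈ Set.Icc (0 : ℝ) 1) : treeGate θ m u 8 = f u - f 0 := by
  have h := treeGate_two_pow_add θ m u (j := 2) (i := 4) (by norm_num) (by norm_num)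
  norm_num at h
  rw [h, treeGate_four hθ hθ4 hu, productGate_self hf hu]

/-- If all the gates beyond the eighth one multiply approximately, then the output `8 * a + r` of the
tree network is approximately the product of the output `r` and the `a`-th power of the output
`8`. -/
theorem abs_treeGate_sub_pow_mul_le {θ : ℕ → GateParams} {m j : ℕ} {u ε : ℝ} {x : ℕ → ℝ}
    (hθ : ∀ k, 9 ≤ k → ∀ t ∈ Set.Icc (0 : ℝ) 1, (θ k).squareGate m t = sqApprox j t)
    (hε : (1 / 4) ^ j ≤ ε)
    (hx : ∀ r, 1 ≤ r → r ≤ 8 → |treeGate θ m u r| ≤ 1 ∧ |treeGate θ m u r - x r| ≤ ε ∧ |x r| ≤ 1)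
    (a r : ℕ) (h1 : 1 ≤ r) (h8 : r ≤ 8) :
    |treeGate θ m u (8 * a + r)| ≤ 1 ∧
      |treeGate θ m u (8 * a + r) - x 8 ^ a * x r| ≤ (2 * a + 1) * ε := by
  induction a using Nat.strong_induction_on generalizing r with
  | _ a ih =>
    rcases Nat.eq_zero_or_pos a with rfl | ha
    · have := hx r h1 h8
      simpa using ⟨this.1, this.2.1⟩
    set k := 8 * a + r with hk
    set s := Nat.log 2 (k - 1) with hs
    -- The output `k` is the product of the outputs `2 ^ s = 8 * (b + 1)` and `8 * a' + r`.
    have hs3 : 3 ≤ s := by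
      rw [hs]
      exact Nat.le_log_of_pow_le (by norm_num) (by omega)
    obtain ⟨t, ht⟩ := Nat.exists_eq_add_of_le' hs3
    have hp : 2 ^ s = 8 * 2 ^ t := by rw [ht, pow_add]; ring
    have ht0 : 0 < 2 ^ t := by positivity
    have hsk : 2 ^ s ≤ k - 1 := Nat.pow_log_le_self 2 (by omega)
    have hks : k - 1 < 2 ^ (s + 1) := Nat.lt_pow_succ_log_self (by norm_num) _
    rw [pow_succ] at hks
    obtain ⟨b, hb⟩ : ∃ b, 2 ^ t = b + 1 := ⟨2 ^ t - 1, by omega⟩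
    have e1 : 2 ^ s = 8 * b + 8 := by omega
    obtain ⟨a', ha'⟩ : ∃ a', a = b + 1 + a' := ⟨a - (b + 1), by omega⟩
    have e2 : k = 2 ^ s + (8 * a' + r) := by omega
    rw [e2, treeGate_two_pow_add θ m u (by omega) (by omega), ← e2, e1]
    obtain ⟨p1, p2⟩ := ih b (by omega) 8 (by norm_num) le_rfl
    obtain ⟨q1, q2⟩ := ih a' (by omega) r h1 h8
    obtain ⟨r1, r2⟩ := abs_productGate_sub_mul_le (hθ k (by omega)) p1 q1
    refine ⟨r2, ?_⟩
    set y := treeGate θ m u (8 * b + 8)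
    set z := treeGate θ m u (8 * a' + r)
    have hx8 := (hx 8 (by norm_num) le_rfl).2.2
    have hxr := (hx r h1 h8).2.2
    have hxa : |x 8 ^ a' * x r| ≤ 1 := by
      rw [abs_mul, abs_pow]; exact mul_le_one₀ (pow_le_one₀ (abs_nonneg _) hx8) (abs_nonneg _) hxr
    have e3 : (θ k).productGate m y z - x 8 ^ a * x r = ((θ k).productGate m y z - y * z) +
        (y * (z - x 8 ^ a' * x r) + (y - x 8 ^ b * x 8) * (x 8 ^ a' * x r)) := by
      rw [ha']; ring
    rw [e3]
    refine (abs_add_le _ _).trans ((add_le_add r1 (abs_add_le _ _)).trans ?_)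
    rw [abs_mul, abs_mul]
    have f1 : |y| * |z - x 8 ^ a' * x r| ≤ (2 * a' + 1) * ε :=
      (mul_le_of_le_one_left (abs_nonneg _) p1).trans q2
    have f2 : |y - x 8 ^ b * x 8| * |x 8 ^ a' * x r| ≤ (2 * b + 1) * ε :=
      (mul_le_of_le_one_right (abs_nonneg _) hxa).trans p2
    have f3 : (a : ℝ) = b + 1 + a' := by exact_mod_cast ha'
    rw [f3]
    nlinarith

/-- Combinations of the outputs `8 * k + r`, for a fixed `r`, as combinations of all outputs. -/
theorem exists_sum_Icc_eq (A : ℕ → ℝ) (a r : ℕ) (hr : 1 ≤ r) {n : ℕ} (hn : ∀ q < a, 8 * q + r ≤ n) :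
    ∃ c : ℕ → ℝ, (∀ B, 0 ≤ B → (∀ q, |A q| ≤ B) → ∀ k, |c k| ≤ B) ∧
      ∀ h : ℕ → ℝ, ∑ k ∈ Finset.Icc 1 n, c k * h k = ∑ q ∈ Finset.range a, A q * h (8 * q + r) := by
  have hinj : Function.Injective fun q : ℕ => 8 * q + r := fun p q h => by
    simp only at h; omega
  refine ⟨fun k => if k ∈ (Finset.range a).image (fun q => 8 * q + r) then A ((k - r) / 8) else 0,
    fun B hB hA k => ?_, fun h => ?_⟩
  · simp only
    split_ifs
    · exact hA _
    · simpa using hB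
  · simp only [ite_mul, zero_mul]
    rw [← Finset.sum_filter, Finset.filter_mem_eq_inter, Finset.inter_eq_right.mpr,
      Finset.sum_image fun p _ q _ h => hinj h]
    · refine Finset.sum_congr rfl fun q _ => ?_
      rw [Nat.add_sub_cancel, Nat.mul_div_cancel_left q (by norm_num)]
    · intro k hk
      obtain ⟨q, hq, rfl⟩ := Finset.mem_image.mp hk
      rw [Finset.mem_Icc]
      exact ⟨by omega, hn q (Finset.mem_range.mp hq)⟩

theorem abs_sum_mul_sub_sum_mul_le {A y z : ℕ → ℝ} {a : ℕ} {B e : ℝ} (hA : ∀ q, |A q| ≤ B)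
    (h : ∀ q < a, |y q - z q| ≤ e) :
    |∑ q ∈ Finset.range a, A q * y q - ∑ q ∈ Finset.range a, A q * z q| ≤ a * (B * e) := by
  rw [← Finset.sum_sub_distrib]
  refine (Finset.abs_sum_le_sum_abs _ _).trans ?_
  calc _ ≤ ∑ q ∈ Finset.range a, B * e := by
        refine Finset.sum_le_sum fun q hq => ?_
        rw [← mul_sub, abs_mul]
        exact mul_le_mul (hA q) (h q (Finset.mem_range.mp hq)) (abs_nonneg _)
          ((abs_nonneg _).trans (hA q))
    _ = _ := by simp

/-- A tree network whose outputs `3`, `5` and `8` are, up to constants, the interpolations of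
`y ↦ exp (-(2 ^ (p + 1) * R * y))` and, approximately, of the square of the interpolation for the
rate `R / 2`, and the square of the iterated tent map. The further outputs multiply them by powers
of the latter. -/
theorem exists_treeGate_expInterp {p m : ℕ} (hp : 2 ≤ p) (hm : m = (p + 1) * 2 ^ p) {R : ℝ}
    (hR0 : 0 ≤ R) : ∃ θ : ℕ → GateParams, (∀ k, (θ k).Bounded) ∧
      ∀ u ∈ Set.Icc (0 : ℝ) 1, ∀ q : ℕ,
        |treeGate θ m u (8 * q + 3) - (tent^[p + 1] u ^ 2) ^ q *
          ((expInterp p R u - expInterp p R 0) / (2 * 2 ^ p * Real.exp R))| ≤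
            (2 * (q : ℝ) + 1) * (1 / 4) ^ (p * 2 ^ p - 2) ∧
        |treeGate θ m u (8 * q + 5) - (tent^[p + 1] u ^ 2) ^ q *
          ((expInterp p (R / 2) u ^ 2 - expInterp p (R / 2) 0 ^ 2) /
            (2 * 2 ^ p * Real.exp (R / 2)) ^ 2)| ≤ (2 * (q : ℝ) + 1) * (1 / 4) ^ (p * 2 ^ p - 2) ∧
        |treeGate θ m u (8 * q + 8) - (tent^[p + 1] u ^ 2) ^ q * tent^[p + 1] u ^ 2| ≤
          (2 * (q : ℝ) + 1) * (1 / 4) ^ (p * 2 ^ p - 2) := by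
  have hN : 4 ≤ 2 ^ p := by
    calc 4 = 2 ^ 2 := by norm_num
      _ ≤ 2 ^ p := Nat.pow_le_pow_right (by norm_num) hp
  have hpN : p < 2 ^ p := Nat.lt_two_pow_self
  have hm' : m = p * 2 ^ p + 2 ^ p := by rw [hm]; ring
  have hpp : 8 ≤ p * 2 ^ p := by nlinarith
  set j := p * 2 ^ p - 2 with hj
  set ε : ℝ := (1 / 4) ^ j with hε
  have hε0 : 0 ≤ ε := by positivity
  have hanti : ∀ j', j ≤ j' → ((1 : ℝ) / 4) ^ j' ≤ ε := fun j' h =>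
    pow_le_pow_of_le_one (by norm_num) (by norm_num) h
  set Λ : ℝ := 2 * 2 ^ p * Real.exp R with hΛ
  set Λ' : ℝ := 2 * 2 ^ p * Real.exp (R / 2) with hΛ'
  have hN1 : (1 : ℝ) ≤ 2 ^ p := one_le_pow₀ (by norm_num)
  have hE : 0 < Real.exp R := Real.exp_pos R
  have hE' : 0 < Real.exp (R / 2) := Real.exp_pos _
  have hΛ0 : 0 < Λ := by positivity
  have hΛ0' : 0 < Λ' := by positivity
  have hmem : ∀ u ∈ Set.Icc (0 : ℝ) 1, expInterp p R u / Λ ∈ Set.Icc (0 : ℝ) 1 := fun u hu => by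
    have := expInterp_mem (p := p) hR0 hu
    refine ⟨div_nonneg this.1 hΛ0.le, div_le_one_of_le₀ (this.2.trans ?_) hΛ0.le⟩
    rw [hΛ]; nlinarith
  have hmem' : ∀ u ∈ Set.Icc (0 : ℝ) 1, expInterp p (R / 2) u / Λ' ∈ Set.Icc (0 : ℝ) 1 :=
    fun u hu => by
    have := expInterp_mem (p := p) (R := R / 2) (by linarith) hu
    refine ⟨div_nonneg this.1 hΛ0'.le, div_le_one_of_le₀ (this.2.trans ?_) hΛ0'.le⟩
    rw [hΛ']; nlinarith
  -- The gates are padded by the identity, or composed with approximate squares, up to depth `m`.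
  have g3 := (isGate_id (m := p * 2 ^ p - 1)).comp (isGate_expInterp p hR0)
    (Nat.le_add_left 1 _) (by omega) hmem
  have g5 := (isGate_sqApprox (p * 2 ^ p - 1)).comp (isGate_expInterp p (R := R / 2) (by linarith))
    (Nat.le_add_left 1 _) (by omega) hmem'
  have g8 := (isGate_sqApprox (m - (p + 1))).comp (isGate_iterate_tent (m := p + 1) (by omega))
    (by omega) (by omega) fun u hu => iterate_tent_mem hu _
  rw [show 2 ^ p + 1 + (p * 2 ^ p - 1) = m by omega] at g3 g5
  rw [show p + 1 + (m - (p + 1)) = m by omega] at g8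
  obtain ⟨θ₃, b3, -, e3⟩ := g3
  obtain ⟨θ₅, b5, -, e5⟩ := g5
  obtain ⟨θ₈, b8, -, e8⟩ := g8
  obtain ⟨θi, bi, -, ei⟩ := isGate_id (m := m)
  obtain ⟨θs, bs, -, es⟩ := isGate_sqApprox m
  set θ : ℕ → GateParams := fun k => if k = 2 then θi else if k = 4 then θi else if k = 3 then θ₃
    else if k = 5 then θ₅ else if k = 8 then θ₈ else θs with hθ
  have t2 : ∀ t ∈ Set.Icc (0 : ℝ) 1, (θ 2).squareGate m t = t := fun t ht => ei t ht
  have t4 : ∀ t ∈ Set.Icc (0 : ℝ) 1, (θ 4).squareGate m t = t := fun t ht => ei t ht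
  refine ⟨θ, fun k => ?_, fun u hu q => ?_⟩
  · simp only [hθ]
    split_ifs <;> assumption
  set V₀ := expInterp p R 0
  set W₀ := expInterp p (R / 2) 0
  set V := expInterp p R u
  set W := expInterp p (R / 2) u
  set w := tent^[p + 1] u ^ 2
  set h := treeGate θ m u with hh
  have z01 : (0 : ℝ) ∈ Set.Icc (0 : ℝ) 1 := by simp
  have abs_sub_le_one : ∀ s ∈ Set.Icc (0 : ℝ) 1, ∀ t ∈ Set.Icc (0 : ℝ) 1, |s - t| ≤ 1 :=
    fun s hs t ht => by rw [abs_le]; constructor <;> linarith [hs.1, hs.2, ht.1, ht.2]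
  have hu1 : |u| ≤ 1 := by rw [abs_of_nonneg hu.1]; exact hu.2
  have hw01 : w ∈ Set.Icc (0 : ℝ) 1 := by
    have := iterate_tent_mem hu (p + 1)
    exact ⟨sq_nonneg _, pow_le_one₀ this.1 this.2⟩
  have ht0 : tent^[p + 1] 0 = 0 := Function.iterate_fixed (by simp [tent, relu]) _
  have v1 : h 1 = u := treeGate_one θ m u
  have v2 : h 2 = u := treeGate_two t2 hu
  have v4 : h 4 = u := treeGate_four t2 t4 hu
  have v3 : h 3 = V / Λ - V₀ / Λ := treeGate_three (f := fun t => expInterp p R t / Λ) t2 e3 hu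
  have v5 : h 5 = sqApprox (p * 2 ^ p - 1 - 1) (W / Λ') - sqApprox (p * 2 ^ p - 1 - 1) (W₀ / Λ') :=
    treeGate_five t2 t4 (fun t ht => e5 t ht) hu
  have v8 : h 8 = sqApprox (m - (p + 1) - 1) (tent^[p + 1] u) := by
    have := treeGate_eight t2 t4 (fun t ht => e8 t ht) hu
    rwa [Function.comp_apply, Function.comp_apply, ht0, sqApprox_zero, sub_zero] at this
  have b3' : |h 3| ≤ 1 := by rw [v3]; exact abs_sub_le_one _ (hmem u hu) _ (hmem 0 z01)
  have v6 : |h 6| ≤ 1 := by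
    have e := treeGate_two_pow_add θ m u (j := 2) (i := 2) (by norm_num) (by norm_num)
    norm_num at e
    rw [hh, e]
    exact (abs_productGate_sub_mul_le es (by rw [← hh, v4]; exact hu1)
      (by rw [← hh, v2]; exact hu1)).2
  have v7 : |h 7| ≤ 1 := by
    have e := treeGate_two_pow_add θ m u (j := 2) (i := 3) (by norm_num) (by norm_num)
    norm_num at e
    rw [hh, e]
    exact (abs_productGate_sub_mul_le es (by rw [← hh, v4]; exact hu1) b3').2
  -- The exact values that the first eight outputs stand for. Only `5` and `8` are approximate.
  set x : ℕ → ℝ := fun r => if r = 8 then w else if r = 5 then W ^ 2 / Λ' ^ 2 - W₀ ^ 2 / Λ' ^ 2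
    else h r with hx
  have sq5 := sqApprox_sub_sq (hmem' u hu) (p * 2 ^ p - 1 - 1)
  have sq50 := sqApprox_sub_sq (hmem' 0 z01) (p * 2 ^ p - 1 - 1)
  have sq8 := sqApprox_sub_sq (iterate_tent_mem hu (p + 1)) (m - (p + 1) - 1)
  have h5ε := hanti (p * 2 ^ p - 1 - 1) (by omega)
  have h8ε := hanti (m - (p + 1) - 1) (by omega)
  have hx' : ∀ r, 1 ≤ r → r ≤ 8 → |h r| ≤ 1 ∧ |h r - x r| ≤ ε ∧ |x r| ≤ 1 := by
    intro r h1 h8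
    have triv : ∀ y : ℝ, |y| ≤ 1 → |y| ≤ 1 ∧ |y - y| ≤ ε ∧ |y| ≤ 1 := fun y hy =>
      ⟨hy, by simpa using hε0, hy⟩
    interval_cases r
    · exact triv _ (by rw [v1]; exact hu1)
    · exact triv _ (by rw [v2]; exact hu1)
    · exact triv _ b3'
    · exact triv _ (by rw [v4]; exact hu1)
    · refine ⟨?_, ?_, ?_⟩
      · rw [v5]
        exact abs_sub_le_one _ (sqApprox_mem (hmem' u hu) _) _ (sqApprox_mem (hmem' 0 z01) _)
      · show |h 5 - (W ^ 2 / Λ' ^ 2 - W₀ ^ 2 / Λ' ^ 2)| ≤ ε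
        rw [v5, ← div_pow, ← div_pow, abs_le]
        constructor <;> linarith
      · show |W ^ 2 / Λ' ^ 2 - W₀ ^ 2 / Λ' ^ 2| ≤ 1
        rw [← div_pow, ← div_pow]
        have p1 := hmem' u hu
        have p2 := hmem' 0 z01
        exact abs_sub_le_one _ ⟨pow_nonneg p1.1 2, pow_le_one₀ p1.1 p1.2⟩ _
          ⟨pow_nonneg p2.1 2, pow_le_one₀ p2.1 p2.2⟩
    · exact triv _ v6
    · exact triv _ v7
    · refine ⟨?_, ?_, ?_⟩
      · rw [v8]
        have := sqApprox_mem (iterate_tent_mem hu (p + 1)) (m - (p + 1) - 1)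
        rw [abs_of_nonneg this.1]; exact this.2
      · show |h 8 - w| ≤ ε
        rw [v8, abs_of_nonneg sq8.1]; linarith [sq8.2]
      · show |w| ≤ 1
        rw [abs_of_nonneg hw01.1]; exact hw01.2
  have htree : ∀ r, 1 ≤ r → r ≤ 8 → |h (8 * q + r) - w ^ q * x r| ≤ (2 * q + 1) * ε := by
    intro r h1 h8
    refine (abs_treeGate_sub_pow_mul_le (j := m - 1) (x := x) (fun k hk t ht => ?_)
      (hanti _ (by omega)) hx' q r h1 h8).2
    have : θ k = θs := by
      simp only [hθ]
      rw [if_neg (by omega), if_neg (by omega), if_neg (by omega), if_neg (by omega),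
        if_neg (by omega)]
    rw [this]; exact es t ht
  refine ⟨?_, ?_, htree 8 (by norm_num) le_rfl⟩
  · have := htree 3 (by norm_num) (by norm_num)
    rw [show x 3 = (V - V₀) / Λ by rw [sub_div, ← v3]; rfl] at this
    exact this
  · have := htree 5 (by norm_num) (by norm_num)
    rw [show x 5 = (W ^ 2 - W₀ ^ 2) / Λ' ^ 2 by rw [sub_div]; rfl] at this
    exact this

/-- A tree network approximates `u ↦ exp (-(2 ^ (p + 1) * R * u))` on the unit interval. -/
theorem exists_treeGate_exp {p m : ℕ} (hp : 2 ≤ p) (hm : m = (p + 1) * 2 ^ p) {R : ℝ} (hR : 1 ≤ R) :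
    ∃ (θ : ℕ → GateParams) (c : ℕ → ℝ) (c₀ : ℝ), (∀ k, (θ k).Bounded) ∧
      (∀ k, |c k| ≤ 67 * 4 ^ p * Real.exp R ^ 2) ∧ |c₀| ≤ 67 * 4 ^ p * Real.exp R ^ 2 ∧
      ∀ u ∈ Set.Icc (0 : ℝ) 1, |Real.exp (-(2 * 2 ^ p * R * u)) -
        (∑ k ∈ Finset.Icc 1 (2 ^ (p + 1)), c k * treeGate θ m u k + c₀)| ≤
        4 * (R ^ 2 ^ (p - 1) / (2 ^ (p - 1)).factorial * Real.exp R) +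
          4 ^ p * (67 * 4 ^ p * Real.exp R ^ 2) * (1 / 4) ^ (p * 2 ^ p - 2) := by
  have hR0 : 0 ≤ R := by linarith
  have hN : 4 ≤ 2 ^ p := by
    calc 4 = 2 ^ 2 := by norm_num
      _ ≤ 2 ^ p := Nat.pow_le_pow_right (by norm_num) hp
  obtain ⟨θ, hθ, htr⟩ := exists_treeGate_expInterp hp hm hR0
  set ε : ℝ := (1 / 4) ^ (p * 2 ^ p - 2) with hε
  have hε0 : 0 ≤ ε := by positivity
  set Λ : ℝ := 2 * 2 ^ p * Real.exp R with hΛ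
  set Λ' : ℝ := 2 * 2 ^ p * Real.exp (R / 2) with hΛ'
  have hN1 : (1 : ℝ) ≤ 2 ^ p := one_le_pow₀ (by norm_num)
  have hE : 0 < Real.exp R := Real.exp_pos R
  have hE' : 0 < Real.exp (R / 2) := Real.exp_pos _
  have hΛ0 : 0 < Λ := by positivity
  have hΛ0' : 0 < Λ' := by positivity
  obtain ⟨α, γ, hα, hγ, happ⟩ := exists_abs_exp_sub_le hR (2 ^ (p - 2))
  have ha0 : 0 < 2 ^ (p - 2) := by positivity
  have h8a : 8 * 2 ^ (p - 2) = 2 ^ (p + 1) := by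
    rw [show p + 1 = 3 + (p - 2) by omega, pow_add]; norm_num
  have h2a : 2 * 2 ^ (p - 2) = 2 ^ (p - 1) := by
    rw [show p - 1 = 1 + (p - 2) by omega, pow_add]; norm_num
  have h4a : (4 * 2 ^ (p - 2) : ℝ) = 2 ^ p := by
    have : 4 * 2 ^ (p - 2) = 2 ^ p := by
      conv_rhs => rw [show p = 2 + (p - 2) by omega, pow_add]
      norm_num
    exact_mod_cast this
  rw [h2a] at happ
  set a := 2 ^ (p - 2) with ha
  set V₀ := expInterp p R 0
  set W₀ := expInterp p (R / 2) 0
  have hV₀ := expInterp_mem (p := p) hR0 (show (0 : ℝ) ∈ Set.Icc (0 : ℝ) 1 by simp)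
  have hW₀ := expInterp_mem (p := p) (R := R / 2) (by linarith) (show (0 : ℝ) ∈ Set.Icc (0 : ℝ) 1 by simp)
  have hEE : Real.exp (R / 2) ^ 2 = Real.exp R := by rw [sq, ← Real.exp_add]; congr 1; ring
  -- The interpolations are available only up to their values at `0`, and after normalization. The
  -- resulting constants `D q` multiply powers of `w`, which are the outputs `8 * (q - 1) + 8`.
  set A₃ : ℕ → ℝ := fun q => (α q + γ q) * Λ with hA₃
  set A₅ : ℕ → ℝ := fun q => -γ q * Λ' ^ 2 with hA₅
  set D : ℕ → ℝ := fun q => (α q + γ q) * V₀ - γ q * W₀ ^ 2 with hD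
  obtain ⟨c₃, hc₃, s₃⟩ := exists_sum_Icc_eq A₃ a 3 (by norm_num) (n := 2 ^ (p + 1))
    (fun q hq => by omega)
  obtain ⟨c₅, hc₅, s₅⟩ := exists_sum_Icc_eq A₅ a 5 (by norm_num) (n := 2 ^ (p + 1))
    (fun q hq => by omega)
  obtain ⟨c₈, hc₈, s₈⟩ := exists_sum_Icc_eq (fun q => D (q + 1)) (a - 1) 8 (by norm_num)
    (n := 2 ^ (p + 1)) (fun q hq => by omega)
  have hE1 : 1 ≤ Real.exp R := Real.one_le_exp hR0
  have hαγ : ∀ q, |α q + γ q| ≤ 9 * Real.exp R := fun q =>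
    (abs_add_le _ _).trans (by linarith [hα q, hγ q])
  set E := Real.exp R
  have h4p : (4 : ℝ) ^ p = 2 ^ p * 2 ^ p := by rw [← mul_pow]; norm_num
  have bA₃ : ∀ q, |A₃ q| ≤ 18 * 4 ^ p * E ^ 2 := fun q => by
    rw [hA₃, abs_mul, abs_of_pos hΛ0]
    calc _ ≤ 9 * E * Λ := mul_le_mul_of_nonneg_right (hαγ q) hΛ0.le
      _ = 18 * 2 ^ p * E ^ 2 := by rw [hΛ]; ring
      _ ≤ _ := by rw [h4p]; gcongr; nlinarith
  have bA₅ : ∀ q, |A₅ q| ≤ 32 * 4 ^ p * E ^ 2 := fun q => by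
    rw [hA₅, abs_mul, abs_neg, abs_of_pos (pow_pos hΛ0' 2)]
    calc _ ≤ 8 * E * Λ' ^ 2 := mul_le_mul_of_nonneg_right (hγ q) (pow_pos hΛ0' 2).le
      _ = 32 * (2 ^ p * 2 ^ p) * E * Real.exp (R / 2) ^ 2 := by rw [hΛ']; ring
      _ = _ := by rw [hEE, h4p]; ring
  have bD : ∀ q, |D q| ≤ 17 * 4 ^ p * E ^ 2 := fun q => by
    have h1 : |(α q + γ q) * V₀| ≤ 9 * E * E := by
      rw [abs_mul, abs_of_nonneg hV₀.1]
      exact mul_le_mul (hαγ q) hV₀.2 hV₀.1 (by positivity)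
    have h2 : |γ q * W₀ ^ 2| ≤ 8 * E * E := by
      rw [abs_mul, abs_of_nonneg (pow_nonneg hW₀.1 2), ← hEE]
      refine mul_le_mul ?_ (pow_le_pow_left₀ hW₀.1 hW₀.2 2) (pow_nonneg hW₀.1 2) (by positivity)
      rw [hEE]; exact hγ q
    have h3 : (1 : ℝ) ≤ 4 ^ p := one_le_pow₀ (by norm_num)
    calc _ ≤ 9 * E * E + 8 * E * E := (abs_sub _ _).trans (add_le_add h1 h2)
      _ = 17 * 1 * E ^ 2 := by ring
      _ ≤ _ := by gcongr
  have hB : 0 ≤ (4 : ℝ) ^ p * E ^ 2 := by positivity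
  refine ⟨θ, fun k => c₃ k + c₅ k + c₈ k, D 0, fun k => ?_, fun k => ?_, ?_, fun u hu => ?_⟩
  · exact hθ k
  · have h1 := hc₃ _ (by positivity) bA₃ k
    have h2 := hc₅ _ (by positivity) bA₅ k
    have h3 := hc₈ _ (by positivity) (fun q => bD (q + 1)) k
    refine (abs_add_le _ _).trans ((add_le_add_left (abs_add_le _ _) _).trans ?_)
    linarith
  · refine (bD 0).trans ?_
    nlinarith
  set V := expInterp p R u
  set W := expInterp p (R / 2) u
  set w := tent^[p + 1] u ^ 2
  set h := treeGate θ m u with hh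
  have hle : ∀ q < a, (2 * q + 1 : ℝ) * ε ≤ 2 * a * ε := fun q hq => by
    have : (q : ℝ) + 1 ≤ a := by exact_mod_cast hq
    exact mul_le_mul_of_nonneg_right (by linarith) hε0
  set x₃ := (V - V₀) / Λ with hx₃
  set x₅ := (W ^ 2 - W₀ ^ 2) / Λ' ^ 2 with hx₅
  have d3 := abs_le.mp (abs_sum_mul_sub_sum_mul_le bA₃ fun q hq => (htr u hu q).1.trans (hle q hq))
  have d5 := abs_le.mp (abs_sum_mul_sub_sum_mul_le bA₅ fun q hq => (htr u hu q).2.1.trans (hle q hq))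
  have d8 := abs_le.mp (abs_sum_mul_sub_sum_mul_le (a := a - 1) (fun q => bD (q + 1))
    fun q hq => (htr u hu q).2.2.trans (hle q (by omega)))
  have hsum : ∑ k ∈ Finset.range a, (α k * (V * w ^ k) + γ k * ((V - W ^ 2) * w ^ k)) =
      ∑ q ∈ Finset.range a, A₃ q * (w ^ q * x₃) + ∑ q ∈ Finset.range a, A₅ q * (w ^ q * x₅) +
        (∑ q ∈ Finset.range (a - 1), D (q + 1) * (w ^ q * w) + D 0) := by
    have e1 : ∑ q ∈ Finset.range (a - 1), D (q + 1) * (w ^ q * w) + D 0 =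
        ∑ q ∈ Finset.range a, D q * w ^ q := by
      obtain ⟨a', ha'⟩ : ∃ a', a = a' + 1 := ⟨a - 1, by omega⟩
      rw [ha', Nat.add_sub_cancel, Finset.sum_range_succ', pow_zero, mul_one]
      congr 1
    have x3 : Λ * x₃ = V - V₀ := mul_div_cancel₀ _ hΛ0.ne'
    have x5 : Λ' ^ 2 * x₅ = W ^ 2 - W₀ ^ 2 := mul_div_cancel₀ _ (pow_pos hΛ0' 2).ne'
    rw [e1, ← Finset.sum_add_distrib, ← Finset.sum_add_distrib]
    refine Finset.sum_congr rfl fun q _ => ?_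
    simp only [hA₃, hA₅, hD]
    linear_combination (-(α q + γ q) * w ^ q) * x3 + γ q * w ^ q * x5
  have hfin := abs_le.mp (happ p u hu)
  rw [hsum] at hfin
  have hout : ∑ k ∈ Finset.Icc 1 (2 ^ (p + 1)), (c₃ k + c₅ k + c₈ k) * h k =
      ∑ q ∈ Finset.range a, A₃ q * h (8 * q + 3) + ∑ q ∈ Finset.range a, A₅ q * h (8 * q + 5) +
        ∑ q ∈ Finset.range (a - 1), D (q + 1) * h (8 * q + 8) := by
    rw [← s₃, ← s₅, ← s₈, ← Finset.sum_add_distrib, ← Finset.sum_add_distrib]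
    exact Finset.sum_congr rfl fun k _ => by ring
  rw [hout]
  have haa : ((a - 1 : ℕ) : ℝ) ≤ a := by exact_mod_cast Nat.sub_le a 1
  have hX : 0 ≤ 17 * (4 : ℝ) ^ p * E ^ 2 * (2 * a * ε) := by positivity
  have d8' := mul_le_mul_of_nonneg_right haa hX
  have e16 : (a : ℝ) * (4 ^ p * E ^ 2 * (2 * a * ε)) * 67 ≤
      4 ^ p * (67 * 4 ^ p * E ^ 2) * ε := by
    have : (2 : ℝ) * (a * a) ≤ 4 ^ p := by
      rw [h4p, ← h4a, ha]; push_cast; nlinarith [sq_nonneg ((2 : ℝ) ^ (p - 2))]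
    have := mul_le_mul_of_nonneg_right this (show 0 ≤ 67 * 4 ^ p * E ^ 2 * ε by positivity)
    linarith
  rw [abs_le]
  constructor <;> linarith

/-! ### Size of the approximation error -/

section Asymptotics

open Filter Real

theorem eventually_mul_succ_le_two_pow (A : ℝ) {c : ℝ} (hc : 0 < c) :
    ∀ᶠ p : ℕ in atTop, A * (p + 1) ≤ c * 2 ^ p := by
  have h := ((tendsto_pow_const_div_const_pow_of_one_lt 1 (r := (2 : ℝ)) (by norm_num)).comp
    (tendsto_add_atTop_nat 1)).const_mul (2 * |A|)
  rw [mul_zero] at h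
  filter_upwards [h.eventually (gt_mem_nhds hc)] with p hp
  have h2 : (0 : ℝ) < 2 ^ p := by positivity
  have h3 : 2 * |A| * (((p + 1 : ℕ) : ℝ) ^ 1 / 2 ^ (p + 1)) = |A| * (p + 1) / 2 ^ p := by
    push_cast; rw [pow_succ (2 : ℝ)]; field_simp
  rw [Function.comp_apply, h3, div_lt_iff₀ h2] at hp
  have : (0 : ℝ) ≤ p := p.cast_nonneg
  nlinarith [le_abs_self A]

theorem eventually_add_log_le (A : ℝ) {B c : ℝ} (hB : 0 < B) (hc : 0 < c) :
    ∀ᶠ p : ℕ in atTop, A + Real.log (B * ((p : ℝ) + 1)) ≤ c * (p + 1) := by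
  have ht : Tendsto (fun p : ℕ => (p : ℝ) + 1) atTop atTop :=
    tendsto_atTop_add_const_right _ _ tendsto_natCast_atTop_atTop
  have h := ht.eventually (Real.isLittleO_log_id_atTop.bound (half_pos hc))
  have h' := ht.eventually_ge_atTop (2 * (A + Real.log B) / c)
  filter_upwards [h, h'] with p hp hp'
  have h0 : (0 : ℝ) < p + 1 := by positivity
  rw [id, Real.norm_eq_abs, Real.norm_eq_abs, abs_of_pos h0] at hp
  rw [div_le_iff₀ hc] at hp'
  rw [Real.log_mul hB.ne' h0.ne']
  linarith [le_abs_self (Real.log ((p : ℝ) + 1))]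

theorem pow_div_factorial_le_exp {R : ℝ} (hR : 0 < R) {J : ℕ} (hJ : 0 < J) :
    R ^ J / J.factorial ≤ Real.exp (J * (Real.log R + 1 - Real.log J)) := by
  have h := Real.pow_div_factorial_le_exp (J : ℝ) J.cast_nonneg J
  have hJ' : (0 : ℝ) < J := by exact_mod_cast hJ
  have e : Real.exp (J * (Real.log R + 1 - Real.log J)) = R ^ J * Real.exp J / (J : ℝ) ^ J := by
    rw [mul_sub, mul_add, mul_one, Real.exp_sub, Real.exp_add, Real.exp_nat_mul, Real.exp_nat_mul,
      Real.exp_log hR, Real.exp_log hJ']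
  rw [e, div_le_div_iff₀ (by positivity) (by positivity)]
  rw [div_le_iff₀ (by positivity)] at h
  calc _ ≤ R ^ J * (Real.exp J * J.factorial) := by gcongr
    _ = _ := by ring

/-- The error bounds of the approximating networks are almost as small as `2 ^ (-m / 2)`, where
`m = (p + 1) * 2 ^ p`. -/
theorem eventually_error_le {κ : ℝ} (hκ : 0 < κ) {ξ : ℝ} (hξ : 0 < ξ) (S : ℝ) :
    ∀ᶠ p : ℕ in atTop, ∀ (m : ℕ) (R : ℝ), m = (p + 1) * 2 ^ p → R = κ / 2 * (p + 1) →
      S * (κ * m * (1 / 4) ^ (m - 1) +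
        (4 * (R ^ 2 ^ (p - 1) / (2 ^ (p - 1)).factorial * Real.exp R) +
          4 ^ p * (67 * 4 ^ p * Real.exp R ^ 2) * (1 / 4) ^ (p * 2 ^ p - 2))) ≤
        Real.exp (-((Real.log 2 / 2 - ξ) * m)) := by
  have hl2 : 0 < Real.log 2 := Real.log_pos (by norm_num)
  have hl4 : Real.log 4 = 2 * Real.log 2 := by
    rw [show (4 : ℝ) = 2 ^ 2 by norm_num, Real.log_pow]; norm_num
  have q4 : ∀ k : ℕ, ((1 : ℝ) / 4) ^ k = Real.exp (-(2 * Real.log 2 * k)) := fun k => by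
    rw [← hl4, Real.exp_neg, mul_comm, Real.exp_nat_mul, Real.exp_log (by norm_num), one_div,
      inv_pow]
  have p4 : ∀ k : ℕ, (4 : ℝ) ^ k = Real.exp (2 * Real.log 2 * k) := fun k => by
    rw [← hl4, mul_comm, Real.exp_nat_mul, Real.exp_log (by norm_num)]
  filter_upwards [eventually_ge_atTop 2, eventually_mul_succ_le_two_pow (3 * |S|) (half_pos hξ),
    eventually_mul_succ_le_two_pow (8 * κ) (pow_pos hl2 2),
    eventually_add_log_le (9 + κ + 4 * Real.log 2) (half_pos hκ) hξ,
    eventually_mul_succ_le_two_pow (67 + κ + 8 * Real.log 2) hl2] with p hp h1 h2 h3 h4 m R hm hR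
  have hp1 : (2 : ℝ) ≤ p := by exact_mod_cast hp
  have hN : (1 : ℝ) ≤ 2 ^ p := one_le_pow₀ (by norm_num)
  have hm' : (m : ℝ) = (p + 1) * 2 ^ p := by rw [hm]; push_cast; ring
  have hmN : (2 : ℝ) ^ p ≤ m := by rw [hm']; nlinarith
  have hNp : (p : ℝ) + 1 ≤ 2 ^ p := by exact_mod_cast Nat.lt_two_pow_self (n := p)
  have hR0 : 0 < R := by rw [hR]; positivity
  set X := Real.exp (-((Real.log 2 / 2 - ξ / 2) * m)) with hX
  have hS : 3 * |S| * X ≤ Real.exp (-((Real.log 2 / 2 - ξ) * m)) := by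
    have e : Real.exp (-((Real.log 2 / 2 - ξ) * m)) = Real.exp (ξ / 2 * m) * X := by
      rw [hX, ← Real.exp_add]; congr 1; ring
    rw [e]
    refine mul_le_mul_of_nonneg_right ?_ (Real.exp_pos _).le
    have := Real.add_one_le_exp (ξ / 2 * m)
    nlinarith [abs_nonneg S]
  -- The term `t2` is the dominant one: `R ^ J / J!` with `J = 2 ^ (p - 1)` and `log R = O(log p)`.
  have t1 : κ * m * (1 / 4) ^ (m - 1) ≤ X := by
    have hm1 : 1 ≤ m := by exact_mod_cast hN.trans hmN
    have e1 : κ * m * 4 ≤ Real.exp (Real.log 2 * m) := by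
      refine le_trans ?_ (Real.quadratic_le_exp_of_nonneg (by positivity))
      have : 8 * κ ≤ Real.log 2 ^ 2 * m := by nlinarith [sq_nonneg (Real.log 2)]
      nlinarith
    calc κ * m * (1 / 4) ^ (m - 1) = κ * m * 4 * Real.exp (-(2 * Real.log 2 * m)) := by
          obtain ⟨k, hk⟩ := Nat.exists_eq_add_of_le' hm1
          rw [← q4, hk, Nat.add_sub_cancel, pow_succ]; ring
      _ ≤ Real.exp (Real.log 2 * m) * Real.exp (-(2 * Real.log 2 * m)) := by gcongr
      _ ≤ X := by
        rw [hX, ← Real.exp_add, Real.exp_le_exp]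
        nlinarith
  have t2 : 4 * (R ^ 2 ^ (p - 1) / (2 ^ (p - 1)).factorial * Real.exp R) ≤ X := by
    have hJ := pow_div_factorial_le_exp hR0 (J := 2 ^ (p - 1)) (by positivity)
    have hJ2 : ((2 ^ (p - 1) : ℕ) : ℝ) = 2 ^ p / 2 := by
      obtain ⟨k, rfl⟩ := Nat.exists_eq_add_of_le' (show 1 ≤ p by omega)
      push_cast [Nat.add_sub_cancel]; rw [pow_succ]; ring
    have hlJ : Real.log ((2 ^ (p - 1) : ℕ) : ℝ) = (p - 1) * Real.log 2 := by
      push_cast; rw [Real.log_pow, Nat.cast_sub (by omega)]; norm_num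
    rw [hlJ, hJ2] at hJ
    have e4 : (4 : ℝ) ≤ Real.exp 4 := by linarith [Real.add_one_le_exp (4 : ℝ)]
    calc _ ≤ Real.exp 4 * (Real.exp (2 ^ p / 2 * (Real.log R + 1 - (p - 1) * Real.log 2)) *
          Real.exp R) := by gcongr
      _ ≤ X := by
        rw [← Real.exp_add, ← Real.exp_add, hX, Real.exp_le_exp, hm']
        rw [← hR] at h3
        have h5 := mul_le_mul_of_nonneg_left h3 (zero_le_one.trans hN)
        have h6 : R ≤ κ / 2 * 2 ^ p := by rw [hR]; gcongr
        have h7 : 0 ≤ 2 ^ p * Real.log 2 := by positivity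
        linarith
  have t3 : 4 ^ p * (67 * 4 ^ p * Real.exp R ^ 2) * (1 / 4) ^ (p * 2 ^ p - 2) ≤ X := by
    have e67 : (67 : ℝ) ≤ Real.exp 67 := by linarith [Real.add_one_le_exp (67 : ℝ)]
    have hpp : 2 ≤ p * 2 ^ p := by nlinarith [Nat.one_le_two_pow (n := p)]
    rw [q4, p4, Nat.cast_sub hpp, ← Real.exp_nat_mul]
    calc _ ≤ Real.exp (2 * Real.log 2 * p) * (Real.exp 67 * Real.exp (2 * Real.log 2 * p) *
          Real.exp ((2 : ℕ) * R)) * Real.exp (-(2 * Real.log 2 * ((p * 2 ^ p : ℕ) - (2 : ℕ)))) := by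
          gcongr
      _ ≤ X := by
        rw [← Real.exp_add, ← Real.exp_add, ← Real.exp_add, ← Real.exp_add, hX, Real.exp_le_exp, hm',
          hR]
        push_cast
        have h5 : 0 ≤ Real.log 2 * 2 ^ p * (p - 1) := by
          apply mul_nonneg (by positivity); linarith
        have h6 : 0 ≤ ξ * ((p + 1) * 2 ^ p) := by positivity
        have h7 : 0 ≤ Real.log 2 * p := by positivity
        linarith
  calc _ ≤ |S| * (κ * m * (1 / 4) ^ (m - 1) +
        (4 * (R ^ 2 ^ (p - 1) / (2 ^ (p - 1)).factorial * Real.exp R) +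
          4 ^ p * (67 * 4 ^ p * Real.exp R ^ 2) * (1 / 4) ^ (p * 2 ^ p - 2))) := by
        refine mul_le_mul_of_nonneg_right (le_abs_self S) (by positivity)
    _ ≤ |S| * (X + (X + X)) := by gcongr
    _ = 3 * |S| * X := by ring
    _ ≤ _ := hS

theorem eventually_coeff_le (κ : ℝ) {c : ℝ} (hc : 0 < c) :
    ∀ᶠ p : ℕ in atTop, ∀ (m : ℕ) (R : ℝ), m = (p + 1) * 2 ^ p → R = κ / 2 * (p + 1) →
      67 * 4 ^ p * Real.exp R ^ 2 ≤ Real.exp (c * m) := by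
  filter_upwards [eventually_mul_succ_le_two_pow (67 + Real.log 4 + κ) hc] with p hp m R hm hR
  have h67 : (67 : ℝ) ≤ Real.exp 67 := by linarith [Real.add_one_le_exp (67 : ℝ)]
  have h4 : (4 : ℝ) ^ p = Real.exp (p * Real.log 4) := by
    rw [Real.exp_nat_mul, Real.exp_log (by norm_num)]
  rw [h4, ← Real.exp_nat_mul]
  calc _ ≤ Real.exp 67 * Real.exp (p * Real.log 4) * Real.exp (((2 : ℕ) : ℝ) * R) := by gcongr
    _ = Real.exp (67 + p * Real.log 4 + 2 * R) := by rw [← Real.exp_add, ← Real.exp_add]; norm_cast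
    _ ≤ _ := by
      rw [Real.exp_le_exp, hm, hR]
      have hl : 0 < Real.log 4 := Real.log_pos (by norm_num)
      have hp0 : (0 : ℝ) ≤ p := p.cast_nonneg
      have h2 : c * 2 ^ p ≤ c * (((p + 1) * 2 ^ p : ℕ) : ℝ) := by
        push_cast
        have : (0 : ℝ) < 2 ^ p := by positivity
        apply mul_le_mul_of_nonneg_left _ hc.le
        nlinarith
      nlinarith

end Asymptotics

/-! ### Networks approximating the discriminant function -/

theorem exists_quadForm_inv_eq_sum_inner {d : ℕ} {S : Matrix (Fin d) (Fin d) ℝ} (hS : S.PosDef)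
    {σ : ℝ} (hσ : ∀ i, σ ≤ hS.isHermitian.eigenvalues i) (hσ0 : 0 < σ) :
    ∃ r : Fin d → EuclideanSpace ℝ (Fin d),
      (∀ x : EuclideanSpace ℝ (Fin d),
        x.ofLp ⬝ᵥ (S⁻¹).mulVec x.ofLp = ∑ i, inner ℝ (r i) x ^ 2) ∧ ∀ i, ‖r i‖ ≤ 1 / Real.sqrt σ := by
  obtain ⟨B, hB, -⟩ := exists_inv_eq_transpose_mul_self hS
  set r : Fin d → EuclideanSpace ℝ (Fin d) := fun i => WithLp.toLp 2 (B i) with hr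
  have h1 : ∀ x : EuclideanSpace ℝ (Fin d),
      x.ofLp ⬝ᵥ (S⁻¹).mulVec x.ofLp = ∑ i, inner ℝ (r i) x ^ 2 := by
    intro x
    rw [hB, dotProduct_transpose_mul_self, EuclideanSpace.real_norm_sq_eq]
    refine Finset.sum_congr rfl fun i _ => ?_
    congr 1
    simp [hr, PiLp.inner_apply, Matrix.mulVec, dotProduct, mul_comm]
  refine ⟨r, h1, fun i => ?_⟩
  have h2 := mul_quadForm_inv_le_norm_sq hS hσ hσ0 (r i)
  have h3 : inner ℝ (r i) (r i) ^ 2 ≤ ∑ k, inner ℝ (r k) (r i) ^ 2 :=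
    Finset.single_le_sum (f := fun k => inner ℝ (r k) (r i) ^ 2) (fun k _ => sq_nonneg _)
      (Finset.mem_univ i)
  rw [h1] at h2
  rw [real_inner_self_eq_norm_sq] at h3
  have h4 : ‖r i‖ ^ 2 ≤ 1 / σ := by
    rw [le_div_iff₀ hσ0]
    by_contra! h
    have h5 : 0 < ‖r i‖ ^ 2 := by nlinarith
    nlinarith
  calc ‖r i‖ = Real.sqrt (‖r i‖ ^ 2) := (Real.sqrt_sq (norm_nonneg _)).symm
    _ ≤ Real.sqrt (1 / σ) := Real.sqrt_le_sqrt h4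
    _ = 1 / Real.sqrt σ := by rw [Real.sqrt_div zero_le_one, Real.sqrt_one]

theorem norm_le_sqrt_mul {d : ℕ} {b : ℝ} (hb : 0 ≤ b) {x : EuclideanSpace ℝ (Fin d)}
    (hx : ∀ i, |x i| ≤ b) : ‖x‖ ≤ Real.sqrt d * b := by
  rw [EuclideanSpace.norm_eq, ← Real.sqrt_sq hb, ← Real.sqrt_mul (Nat.cast_nonneg d)]
  refine Real.sqrt_le_sqrt ?_
  calc ∑ i, ‖x i‖ ^ 2 ≤ ∑ _i : Fin d, b ^ 2 :=
        Finset.sum_le_sum fun i _ => pow_le_pow_left₀ (norm_nonneg _) (hx i) 2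
    _ = d * b ^ 2 := by simp

theorem productGate_sqApprox_self {θ : GateParams} {m j : ℕ}
    (hθ : ∀ u ∈ Set.Icc (0 : ℝ) 1, θ.squareGate m u = sqApprox j u) {s : ℝ} (hs : |s| ≤ 1) :
    θ.productGate m s s = sqApprox j |s| := by
  rw [GateParams.productGate, sub_self, zero_div, abs_zero, ← two_mul,
    mul_div_cancel_left₀ s two_ne_zero, hθ _ ⟨abs_nonneg s, hs⟩, hθ 0 (by simp), sqApprox_zero,
    sub_zero]

theorem abs_exp_neg_mul_sub_le {L u v e : ℝ} (hL : 0 ≤ L) (hv : 0 ≤ v) (h1 : v ≤ u)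
    (h2 : u - v ≤ e) : |Real.exp (-(L * u)) - Real.exp (-(L * v))| ≤ L * e := by
  have h3 : Real.exp (-(L * u)) ≤ Real.exp (-(L * v)) := Real.exp_le_exp.mpr (by nlinarith)
  have h4 : Real.exp (-(L * u)) = Real.exp (-(L * v)) * Real.exp (-(L * (u - v))) := by
    rw [← Real.exp_add]; congr 1; ring
  have h5 := Real.add_one_le_exp (-(L * (u - v)))
  have h6 : Real.exp (-(L * v)) ≤ 1 := Real.exp_le_one_iff.mpr (by nlinarith)
  have h7 := Real.exp_pos (-(L * v))
  rw [abs_sub_comm, abs_of_nonneg (by linarith), h4]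
  have h8 : L * (u - v) ≤ L * e := by gcongr
  have h9 : 0 ≤ L * (u - v) := mul_nonneg hL (by linarith)
  nlinarith

/-- The mean of the approximate squares of coordinates in `[-1, 1]`. -/
theorem mean_sqApprox_mem {d : ℕ} (hd : 1 ≤ d) {s : Fin d → ℝ} (hs : ∀ i, |s i| ≤ 1) (j : ℕ) :
    1 / (d : ℝ) * ∑ i, sqApprox j |s i| ∈ Set.Icc (0 : ℝ) 1 ∧
      1 / (d : ℝ) * ∑ i, s i ^ 2 ≤ 1 / (d : ℝ) * ∑ i, sqApprox j |s i| ∧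
      1 / (d : ℝ) * ∑ i, sqApprox j |s i| - 1 / (d : ℝ) * ∑ i, s i ^ 2 ≤ (1 / 4) ^ j := by
  have hd0 : (0 : ℝ) < d := by exact_mod_cast hd
  have hsq := fun i => sqApprox_sub_sq (y := |s i|) ⟨abs_nonneg _, hs i⟩ j
  have hmem := fun i => sqApprox_mem (y := |s i|) ⟨abs_nonneg _, hs i⟩ j
  simp only [sq_abs] at hsq
  refine ⟨⟨mul_nonneg (by positivity) (Finset.sum_nonneg fun i _ => (hmem i).1), ?_⟩, ?_, ?_⟩
  · rw [one_div_mul_eq_div, div_le_one hd0]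
    calc _ ≤ ∑ _i : Fin d, (1 : ℝ) := Finset.sum_le_sum fun i _ => (hmem i).2
      _ = d := by simp
  · refine mul_le_mul_of_nonneg_left (Finset.sum_le_sum fun i _ => ?_) (by positivity)
    linarith [(hsq i).1]
  · rw [← mul_sub, ← Finset.sum_sub_distrib, one_div_mul_eq_div, div_le_iff₀ hd0]
    calc _ ≤ ∑ _i : Fin d, ((1 : ℝ) / 4) ^ j := Finset.sum_le_sum fun i _ =>
          (hsq i).2.trans (by linarith [show (0 : ℝ) ≤ (1 / 4) ^ j by positivity])
      _ = _ := by simp [mul_comm]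

/-- Where the truncation function is `1`, identity gates pass on the affine maps. -/
theorem NetParams.hStar_eq_treeGate {d K : ℕ} {P : NetParams d K} {m j' : ℕ} {b : ℝ} {j : Fin K}
    {x : EuclideanSpace ℝ (Fin d)}
    (hpre : ∀ i, ∀ u ∈ Set.Icc (0 : ℝ) 1, (P.pre i j).squareGate m u = u)
    (hsq : ∀ i, ∀ u ∈ Set.Icc (0 : ℝ) 1, (P.sq i j).squareGate m u = sqApprox j' u)
    (hx : ∀ i, |x i| ≤ b) (hs : ∀ i, |P.affine i j x| ≤ 1) (k : ℕ) :
    P.hStar b m k j x =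
      treeGate (P.tree j) m (1 / (d : ℝ) * ∑ i, sqApprox j' |P.affine i j x|) k := by
  rw [NetParams.hStar]
  congr 2
  refine Finset.sum_congr rfl fun i _ => ?_
  have : P.truncated b m i j x = P.affine i j x := by
    rw [NetParams.truncated, truncation_eq_one hx]
    exact productGate_one_left (hpre i) (hs i)
  rw [this]
  exact productGate_sqApprox_self (hsq i) (hs i)

variable {d K : ℕ} (G : GaussianMixture d K)

/-- The quadratic form of a component is a sum of squares of affine maps. They are scaled so that
they are bounded by `1` on the cube of radius `b`. -/
theorem GaussianMixture.exists_affine_maps (hd : 1 ≤ d) {b : ℝ} (hb : 1 ≤ b) (j : Fin K) :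
    ∃ (w : Fin d → EuclideanSpace ℝ (Fin d)) (v : Fin d → ℝ),
      (∀ i, ‖w i‖ ≤ Real.sqrt d / Real.sqrt G.eigMin) ∧
      (∀ i, |v i| ≤ G.meanBound / Real.sqrt G.eigMin) ∧
      ∀ x : EuclideanSpace ℝ (Fin d), ((∀ i, |x i| ≤ b) → ∀ i, |inner ℝ (w i) x + v i| ≤ 1) ∧
        (x - G.mean j).ofLp ⬝ᵥ ((G.cov j)⁻¹).mulVec (x - G.mean j).ofLp =
          (((Real.sqrt d + G.meanBound) / Real.sqrt G.eigMin + 1) * b) ^ 2 *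
            ∑ i, (inner ℝ (w i) x + v i) ^ 2 := by
  have hσ := G.eigMin_pos hd
  have hsσ := Real.sqrt_pos.mpr hσ
  have hμ := G.meanBound_nonneg
  have hd1 : (1 : ℝ) ≤ Real.sqrt d := Real.one_le_sqrt.mpr (by exact_mod_cast hd)
  set κ₁ := (Real.sqrt d + G.meanBound) / Real.sqrt G.eigMin + 1 with hκ₁
  have hκ₁1 : 1 ≤ κ₁ := by
    rw [hκ₁]; linarith [show 0 ≤ (Real.sqrt d + G.meanBound) / Real.sqrt G.eigMin by positivity]
  set M := κ₁ * b with hM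
  have hM1 : 1 ≤ M := one_le_mul_of_one_le_of_one_le hκ₁1 hb
  have hM0 : 0 < M := by linarith
  have hM' : |1 / M| ≤ 1 := by
    rw [abs_of_pos (by positivity)]; exact div_le_one_of_le₀ hM1 hM0.le
  obtain ⟨r, hr, hr1⟩ := exists_quadForm_inv_eq_sum_inner (σ := G.eigMin) (G.cov_posDef j)
    (fun i => ciInf_le (f := fun q : Fin K × Fin d => (G.cov_posDef q.1).isHermitian.eigenvalues q.2)
      (Set.finite_range _).bddBelow (j, i)) hσ
  have haff : ∀ x i, inner ℝ ((1 / M) • r i) x + -(1 / M) * inner ℝ (r i) (G.mean j) =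
      1 / M * inner ℝ (r i) (x - G.mean j) := fun x i => by
    rw [real_inner_smul_left, inner_sub_right]; ring
  refine ⟨fun i => (1 / M) • r i, fun i => -(1 / M) * inner ℝ (r i) (G.mean j), fun i => ?_,
    fun i => ?_, fun x => ⟨fun hx i => ?_, ?_⟩⟩
  · rw [norm_smul, Real.norm_eq_abs]
    refine (mul_le_of_le_one_left (norm_nonneg _) hM').trans ((hr1 i).trans ?_)
    gcongr
  · rw [abs_mul, abs_neg]
    refine (mul_le_of_le_one_left (abs_nonneg _) hM').trans ((abs_real_inner_le_norm _ _).trans ?_)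
    calc _ ≤ 1 / Real.sqrt G.eigMin * G.meanBound :=
          mul_le_mul (hr1 i) (G.norm_mean_le j) (norm_nonneg _) (by positivity)
      _ = G.meanBound / Real.sqrt G.eigMin := by ring
  · have h1 : ‖x - G.mean j‖ ≤ (Real.sqrt d + G.meanBound) * b := by
      have h2 := norm_le_sqrt_mul (by linarith) hx
      have h3 := G.norm_mean_le j
      have h4 := norm_sub_le x (G.mean j)
      nlinarith
    rw [haff, abs_mul, abs_of_pos (show 0 < 1 / M by positivity), one_div_mul_eq_div,
      div_le_one hM0]
    refine (abs_real_inner_le_norm _ _).trans ?_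
    calc _ ≤ 1 / Real.sqrt G.eigMin * ((Real.sqrt d + G.meanBound) * b) :=
          mul_le_mul (hr1 i) h1 (norm_nonneg _) (by positivity)
      _ = (κ₁ - 1) * b := by rw [hκ₁]; ring
      _ ≤ M := by rw [hM]; nlinarith
  · rw [hr]
    simp only [haff, mul_pow, ← Finset.mul_sum]
    field_simp

/-- Networks of the architecture of the hypothesis space, without the scaling unit, approximate the
discriminant function on the cube on which the truncation is inactive. -/
theorem GaussianMixture.eventually_exists_net (hd : 1 ≤ d) {CK0 CK1 c₂ c₃ c : ℝ}
    (hCK0 : Real.sqrt d / Real.sqrt G.eigMin ≤ CK0) (hCK1 : G.meanBound / Real.sqrt G.eigMin ≤ CK1)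
    (hc₂ : ∑ j, |G.coeff j| ≤ c₂) (hc₃ : 0 < c₃) (hc : 0 < c) {ξ : ℝ} (hξ : 0 < ξ) :
    ∀ᶠ p : ℕ in Filter.atTop, ∀ (m : ℕ) (b CK : ℝ), m = (p + 1) * 2 ^ p → b = Real.sqrt (c * m) →
      CK = c₂ * Real.exp (c₃ * b ^ 2) → ∃ P : NetParams d K, P.Admissible CK0 CK1 CK ∧
        ∀ x : EuclideanSpace ℝ (Fin d), (∀ i, |x i| ≤ b) →
          |(∑ j, ∑ k ∈ Finset.Icc 1 (2 ^ (p + 1)), P.c k j * P.hStar b m k j x + P.c₀) -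
            G.discr x| ≤ Real.exp (-((Real.log 2 / 2 - ξ) * m)) := by
  have hsσ := Real.sqrt_pos.mpr (G.eigMin_pos hd)
  have hμ := G.meanBound_nonneg
  have hd0 : (0 : ℝ) < d := by exact_mod_cast hd
  set κ₁ := (Real.sqrt d + G.meanBound) / Real.sqrt G.eigMin + 1 with hκ₁
  have hκ₁0 : 0 < κ₁ := by positivity
  set κ := d * κ₁ ^ 2 * c / 2 with hκ
  have hκ0 : 0 < κ := by positivity
  have hS := G.sum_abs_coeff_pos
  filter_upwards [Filter.eventually_ge_atTop 2, eventually_mul_succ_le_two_pow 1 hc,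
    eventually_error_le hκ0 hξ (∑ j, |G.coeff j|), eventually_coeff_le κ (mul_pos hc₃ hc),
    Filter.eventually_ge_atTop ⌈2 / κ⌉₊] with p hp hp1 hp2 hp3 hp4 m b CK hm hb hCK
  set R := κ / 2 * ((p : ℝ) + 1) with hR
  have hR1 : 1 ≤ R := by
    have := (Nat.le_ceil (2 / κ)).trans (Nat.cast_le.mpr hp4)
    rw [div_le_iff₀ hκ0] at this
    rw [hR]; nlinarith
  have hm' : (m : ℝ) = (p + 1) * 2 ^ p := by rw [hm]; push_cast; ring
  have hb2 : b ^ 2 = c * m := by rw [hb, Real.sq_sqrt (by positivity)]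
  have hb1 : 1 ≤ b := by
    rw [hb, Real.one_le_sqrt, hm']
    have : (0 : ℝ) < 2 ^ p := by positivity
    have h0 : (0 : ℝ) ≤ p := p.cast_nonneg
    nlinarith [mul_nonneg h0 (mul_pos hc this).le]
  -- The exponent `κ * m` times the mean of squares is distributed to `2 ^ p` cells of the rate `R`.
  have hL : d * (κ₁ * b) ^ 2 / 2 = κ * m := by rw [mul_pow, hb2, hκ]; ring
  have hLm : 2 * 2 ^ p * R = κ * m := by rw [hR, hm']; ring
  obtain ⟨θ, cc, cc₀, hθ, hcc, hcc₀, happ⟩ := exists_treeGate_exp hp hm hR1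
  obtain ⟨θi, bi, -, ei⟩ := isGate_id (m := m)
  obtain ⟨θs, bs, -, es⟩ := isGate_sqApprox m
  choose w v hw hv hwv using fun j => G.exists_affine_maps hd hb1 j
  have hBCK : (∑ j, |G.coeff j|) * (67 * 4 ^ p * Real.exp R ^ 2) ≤ CK := by
    rw [hCK, hb2, ← mul_assoc c₃]
    exact mul_le_mul hc₂ (hp3 m R hm rfl) (by positivity) (hS.le.trans hc₂)
  have hcoeff : ∀ (k : ℕ) (j : Fin K), |G.coeff j * cc k| ≤ CK := by
    intro k j
    rw [abs_mul]
    refine (mul_le_mul ?_ (hcc k) (abs_nonneg _) hS.le).trans hBCK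
    exact Finset.single_le_sum (f := fun j => |G.coeff j|) (fun _ _ => abs_nonneg _)
      (Finset.mem_univ j)
  have hbias : |∑ j, G.coeff j * cc₀| ≤ CK := by
    rw [← Finset.sum_mul, abs_mul]
    exact (mul_le_mul (Finset.abs_sum_le_sum_abs _ _) hcc₀ (abs_nonneg _) hS.le).trans hBCK
  refine ⟨⟨fun i j => w j i, fun i j => v j i, fun _ _ => θi, fun _ _ => θs, fun _ => θ,
    fun k j => G.coeff j * cc k, ∑ j, G.coeff j * cc₀⟩,
    ⟨fun i j => (hw j i).trans hCK0, fun i j => (hv j i).trans hCK1, fun _ _ => bi, fun _ _ => bs,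
    fun _ k => hθ k, hcoeff, hbias⟩, fun x hx => ?_⟩
  set P : NetParams d K := ⟨fun i j => w j i, fun i j => v j i, fun _ _ => θi, fun _ _ => θs,
    fun _ => θ, fun k j => G.coeff j * cc k, ∑ j, G.coeff j * cc₀⟩
  clear_value R
  refine le_trans ?_ (hp2 m R hm rfl)
  generalize 4 * (R ^ 2 ^ (p - 1) / (2 ^ (p - 1)).factorial * Real.exp R) +
    4 ^ p * (67 * 4 ^ p * Real.exp R ^ 2) * (1 / 4) ^ (p * 2 ^ p - 2) = T at happ
  have hcomp : ∀ j, |∑ k ∈ Finset.Icc 1 (2 ^ (p + 1)), cc k * P.hStar b m k j x + cc₀ -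
      Real.exp (-(1 / 2) * ((x - G.mean j).ofLp ⬝ᵥ ((G.cov j)⁻¹).mulVec (x - G.mean j).ofLp))| ≤
      κ * m * (1 / 4) ^ (m - 1) + T := by
    intro j
    obtain ⟨hs, hQ⟩ := hwv j x
    have hs1 : ∀ i, |P.affine i j x| ≤ 1 := hs hx
    have hQ' : (x - G.mean j).ofLp ⬝ᵥ ((G.cov j)⁻¹).mulVec (x - G.mean j).ofLp =
      (κ₁ * b) ^ 2 * ∑ i, P.affine i j x ^ 2 := hQ
    have hst : ∀ k, P.hStar b m k j x = treeGate θ m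
        (1 / (d : ℝ) * ∑ i, sqApprox (m - 1) |P.affine i j x|) k := fun k =>
      NetParams.hStar_eq_treeGate (P := P) (fun _ => ei) (fun _ => es) hx hs1 k
    obtain ⟨hu01, hd1, hd2⟩ := mean_sqApprox_mem hd hs1 (m - 1)
    have hu'0 : 0 ≤ 1 / (d : ℝ) * ∑ i, P.affine i j x ^ 2 :=
      mul_nonneg (by positivity) (Finset.sum_nonneg fun i _ => sq_nonneg _)
    have hexp : -(1 / 2) * ((κ₁ * b) ^ 2 * ∑ i, P.affine i j x ^ 2) =
        -(κ * m * (1 / (d : ℝ) * ∑ i, P.affine i j x ^ 2)) := by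
      rw [← hL]; field_simp
    rw [hQ', hexp]
    simp only [hst]
    have e2 := happ _ hu01
    generalize 1 / (d : ℝ) * ∑ i, sqApprox (m - 1) |P.affine i j x| = u at *
    generalize 1 / (d : ℝ) * ∑ i, P.affine i j x ^ 2 = u' at *
    have e1 := abs_exp_neg_mul_sub_le (L := κ * m) (by positivity) hu'0 hd1 hd2
    rw [abs_sub_comm, hLm] at e2
    calc _ = |(∑ k ∈ Finset.Icc 1 (2 ^ (p + 1)), cc k * treeGate θ m u k + cc₀ -
          Real.exp (-(κ * m * u))) + (Real.exp (-(κ * m * u)) - Real.exp (-(κ * m * u')))| := by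
          congr 1; ring
      _ ≤ T + κ * m * (1 / 4) ^ (m - 1) := (abs_add_le _ _).trans (add_le_add e2 e1)
      _ = _ := add_comm _ _
  have hsum : (∑ j, ∑ k ∈ Finset.Icc 1 (2 ^ (p + 1)), P.c k j * P.hStar b m k j x + P.c₀) -
      G.discr x = ∑ j, G.coeff j * (∑ k ∈ Finset.Icc 1 (2 ^ (p + 1)), cc k * P.hStar b m k j x + cc₀ -
      Real.exp (-(1 / 2) * ((x - G.mean j).ofLp ⬝ᵥ ((G.cov j)⁻¹).mulVec (x - G.mean j).ofLp))) := by
    rw [G.discr_eq_sum_coeff]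
    show (∑ j, ∑ k ∈ Finset.Icc 1 (2 ^ (p + 1)), G.coeff j * cc k * P.hStar b m k j x +
      ∑ j, G.coeff j * cc₀) - _ = _
    simp only [mul_sub, mul_add, Finset.sum_sub_distrib, Finset.sum_add_distrib, Finset.mul_sum,
      mul_assoc]
  rw [hsum, Finset.sum_mul]
  refine (Finset.abs_sum_le_sum_abs _ _).trans (Finset.sum_le_sum fun j _ => ?_)
  rw [abs_mul]
  exact mul_le_mul_of_nonneg_left (hcomp j) (abs_nonneg _)

/-! ### The size of the hypothesis space -/

theorem le_exp_mul {A X : ℝ} (hA : 0 ≤ A) (hX : 1 ≤ X) : A ≤ Real.exp (A * X) := by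
  have := Real.add_one_le_exp (A * X)
  nlinarith

theorem pow_pow_le_exp {m ℓ : ℕ} (hℓ : ℓ ≤ m) (hm : 1 ≤ m) :
    ((48 : ℝ) ^ (m + 2)) ^ (ℓ + 2) ≤ Real.exp (36 * m ^ 2) := by
  have h48 : (48 : ℝ) ≤ Real.exp 4 := by
    have := Real.exp_one_gt_d9
    have h4 : Real.exp 4 = Real.exp 1 ^ 4 := by rw [← Real.exp_nat_mul]; norm_num
    rw [h4]
    calc (48 : ℝ) ≤ 2.7 ^ 4 := by norm_num
      _ ≤ _ := by gcongr; linarith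
  have hℓm' : (ℓ : ℝ) ≤ m := by exact_mod_cast hℓ
  have hm1 : (1 : ℝ) ≤ m := by exact_mod_cast hm
  have h9 : ((m : ℝ) + 2) * (ℓ + 2) ≤ 9 * m ^ 2 := by
    calc ((m : ℝ) + 2) * (ℓ + 2) ≤ (m + 2) * (m + 2) := by gcongr
      _ ≤ 9 * m ^ 2 := by nlinarith
  rw [← pow_mul]
  calc (48 : ℝ) ^ ((m + 2) * (ℓ + 2)) ≤ Real.exp 4 ^ ((m + 2) * (ℓ + 2)) :=
        pow_le_pow_left₀ (by norm_num) h48 _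
    _ = Real.exp (((m + 2) * (ℓ + 2) : ℕ) * 4) := by rw [Real.exp_nat_mul]
    _ ≤ _ := Real.exp_le_exp.mpr (by push_cast; linarith)

/-- The factor between the distance of the parameters and the distance of the networks is at most
exponential in `X`, which stands for `m ^ 2 + log n`. -/
theorem distance_factor_le {d K m ℓ : ℕ} {CK0 CK1 CK b c₂ c' c X l q : ℝ} (hCK0 : 0 ≤ CK0)
    (hCK1 : 0 ≤ CK1) (hc₂ : 0 ≤ c₂) (hc' : 0 ≤ c') (hX1 : 1 ≤ X)
    (hCK' : 0 ≤ CK) (hCK : CK ≤ c₂ * Real.exp (c' * X)) (hb0 : 0 ≤ b) (hb : b ^ 2 ≤ c * X)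
    (hl0 : 0 < l) (hl : 1 / l ≤ Real.exp (1 / q * X)) (hℓ : (2 : ℝ) ^ ℓ ≤ 2 * X)
    (h48 : ((48 : ℝ) ^ (m + 2)) ^ (ℓ + 2) ≤ Real.exp (36 * X)) :
    CK + 1 ≤ Real.exp ((1 + c₂ + c') * X) ∧
    4 / l * ((K * 2 ^ ℓ + 1) * (CK + 1) * ((48 ^ (m + 2)) ^ (ℓ + 2) *
      ((CK0 + 1) * ((d : ℝ) ^ 2 * (b + 1)) + CK1 + 1))) ≤
    Real.exp ((4 + 1 / q + (2 * K + (1 + c₂ + c') +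
      (36 + ((CK0 + 1) * (d ^ 2 * (2 + c)) + CK1)))) * X) := by
  have b1 : 4 / l ≤ Real.exp ((4 + 1 / q) * X) := by
    rw [add_mul, Real.exp_add, div_eq_mul_one_div]
    exact mul_le_mul (le_exp_mul (by norm_num) hX1) hl (by positivity) (Real.exp_pos _).le
  have b2 : (K * 2 ^ ℓ + 1 : ℝ) ≤ Real.exp (2 * K * X) := by
    refine (Real.add_one_le_exp _).trans (Real.exp_le_exp.mpr ?_)
    calc (K : ℝ) * 2 ^ ℓ ≤ K * (2 * X) := by gcongr
      _ = _ := by ring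
  have b3 : CK + 1 ≤ Real.exp ((1 + c₂ + c') * X) := by
    have h1 : CK ≤ Real.exp ((c₂ + c') * X) := by
      rw [add_mul, Real.exp_add]
      exact hCK.trans (mul_le_mul_of_nonneg_right (le_exp_mul hc₂ hX1) (Real.exp_pos _).le)
    have h2 : 2 ≤ Real.exp (1 * X) := by linarith [Real.add_one_le_exp (1 * X)]
    have h3 : 1 ≤ Real.exp ((c₂ + c') * X) := Real.one_le_exp (by positivity)
    rw [add_assoc, add_mul, Real.exp_add]
    nlinarith
  have hb2 : b + 1 ≤ (2 + c) * X := by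
    have : b ≤ 1 + b ^ 2 := by nlinarith [sq_nonneg (b - 1)]
    nlinarith
  have b5 : (CK0 + 1) * ((d : ℝ) ^ 2 * (b + 1)) + CK1 + 1 ≤
      Real.exp (((CK0 + 1) * (d ^ 2 * (2 + c)) + CK1) * X) := by
    refine (Real.add_one_le_exp _).trans (Real.exp_le_exp.mpr ?_)
    have h1 : (CK0 + 1) * ((d : ℝ) ^ 2 * (b + 1)) ≤ (CK0 + 1) * ((d : ℝ) ^ 2 * ((2 + c) * X)) := by
      gcongr
    nlinarith
  refine ⟨b3, ?_⟩
  have e : ∀ x y z w v : ℝ, Real.exp ((x + (y + z + (w + v))) * X) = Real.exp (x * X) *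
      (Real.exp (y * X) * Real.exp (z * X) * (Real.exp (w * X) * Real.exp (v * X))) := by
    intro x y z w v
    simp only [← Real.exp_add]; congr 1; ring
  rw [e]
  have p5 : 0 ≤ (CK0 + 1) * ((d : ℝ) ^ 2 * (b + 1)) + CK1 + 1 := by positivity
  exact mul_le_mul b1 (mul_le_mul (mul_le_mul b2 b3 (by positivity) (Real.exp_pos _).le)
    (mul_le_mul h48 b5 p5 (Real.exp_pos _).le) (by positivity) (by positivity)) (by positivity)
    (Real.exp_pos _).le

/-- The number of free parameters of the networks, as it appears in the size of the net. -/
theorem numParams_le (d K : ℕ) {m ℓ : ℕ} (hm : 1 ≤ m) (hℓ : 2 ^ ℓ ≤ 2 * m) :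
    d * K * d + d * K + 2 * (d * K * (30 * m + 10)) + (2 ^ ℓ + 1) * K * (30 * m + 10) +
      (2 ^ ℓ + 1) * K + 1 ≤ (K * (d ^ 2 + 81 * d + 123) + 1) * m ^ 2 := by
  have h1 : 30 * m + 10 ≤ 40 * m := by omega
  have h2 : 2 ^ ℓ + 1 ≤ 3 * m := by omega
  have h3 : m ≤ m ^ 2 := Nat.le_self_pow (by norm_num) m
  have h4 : 1 ≤ m ^ 2 := hm.trans h3
  calc _ ≤ d * K * d * m ^ 2 + d * K * m ^ 2 + 2 * (d * K * (40 * m ^ 2)) + (3 * m) * K * (40 * m) +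
      (3 * m ^ 2) * K + 1 * m ^ 2 := by
        refine add_le_add (add_le_add (add_le_add (add_le_add (add_le_add
          (Nat.le_mul_of_pos_right _ h4) (Nat.le_mul_of_pos_right _ h4)) ?_) ?_) ?_) (by omega)
        · exact Nat.mul_le_mul_left 2 (Nat.mul_le_mul_left _ (by omega))
        · exact Nat.mul_le_mul (Nat.mul_le_mul_right K h2) h1
        · exact Nat.mul_le_mul_right K (by omega)
    _ = _ := by ring

/-- The logarithm of the number of elements of a net at distance `1 / n` grows polynomially. -/
theorem exists_hasNet_log_le (d K : ℕ) (hd : 1 ≤ d) {CK0 CK1 c₂ c₃ c q : ℝ} (hCK0 : 0 ≤ CK0)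
    (hCK1 : 0 ≤ CK1) (hc₂ : 0 ≤ c₂) (hc₃ : 0 ≤ c₃) (hc : 0 ≤ c) (hq : 0 < q) :
    ∃ C : ℝ, 0 ≤ C ∧ ∀ (n ℓ m : ℕ) (l b CK : ℝ), 3 ≤ n → 1 ≤ ℓ → m = ℓ * 2 ^ (ℓ - 1) →
      l = (n : ℝ) ^ (-(1 / q)) → b = Real.sqrt (c * m) → CK = c₂ * Real.exp (c₃ * b ^ 2) →
      ∃ N : ℕ, HasNet (hypothesisSpace d K CK0 CK1 CK l b m ℓ)
        (fun f g => ∀ x, |f x - g x| ≤ 1 / (n : ℝ)) N ∧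
        Real.log (N + 1) ≤ C * ((m : ℝ) ^ 2 * ((m : ℝ) ^ 2 + Real.log n)) := by
  set a₁ : ℝ := 4 + 1 / q + (2 * K + (1 + c₂ + c₃ * c) +
    (36 + ((CK0 + 1) * (d ^ 2 * (2 + c)) + CK1))) with ha₁
  set a₂ : ℝ := (2 * (5 + CK0 + CK1)) + (1 + c₂ + c₃ * c) + (1 + a₁) with ha₂
  set a₃ : ℝ := K * (d ^ 2 + 81 * d + 123) + 1 with ha₃
  have ha₁0 : 0 ≤ a₁ := by positivity
  have ha₂0 : 0 ≤ a₂ := by positivity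
  have ha₃0 : 0 ≤ a₃ := by positivity
  refine ⟨1 + a₃ * a₂, by positivity, ?_⟩
  intro n ℓ m l b CK hn hℓ hm hl hb hCK
  have hn0 : (0 : ℝ) < n := by exact_mod_cast (by omega : 0 < n)
  have hlog0 : 0 ≤ Real.log n := Real.log_natCast_nonneg n
  have h2ℓ : 2 ^ ℓ = 2 * 2 ^ (ℓ - 1) := by
    obtain ⟨k, rfl⟩ := Nat.exists_eq_add_of_le' hℓ
    rw [Nat.add_sub_cancel, pow_succ]; ring
  have hm1 : 1 ≤ m := by rw [hm]; exact Nat.mul_pos hℓ (by positivity)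
  have h2m : 2 ^ ℓ ≤ 2 * m := by
    rw [h2ℓ, hm]; exact Nat.mul_le_mul_left 2 (Nat.le_mul_of_pos_left _ hℓ)
  have hℓm : ℓ ≤ m := by rw [hm]; exact Nat.le_mul_of_pos_right _ (by positivity)
  have hm1' : (1 : ℝ) ≤ m := by exact_mod_cast hm1
  have h2m' : (2 : ℝ) ^ ℓ ≤ 2 * m := by exact_mod_cast h2m
  set X : ℝ := (m : ℝ) ^ 2 + Real.log n with hX
  have hmm : (m : ℝ) ≤ m ^ 2 := by nlinarith
  have hmX : (m : ℝ) ≤ X := by rw [hX]; linarith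
  have hm2X : (m : ℝ) ^ 2 ≤ X := by rw [hX]; linarith
  have hnX : Real.log n ≤ X := by rw [hX]; linarith
  have hX1 : 1 ≤ X := by linarith
  have hcm : b ^ 2 = c * m := by rw [hb, Real.sq_sqrt (by positivity)]
  have hb0 : 0 ≤ b := by rw [hb]; positivity
  have hl0 : 0 < l := by rw [hl]; positivity
  have hCK' : 0 ≤ CK := by rw [hCK]; positivity
  obtain ⟨f1, f2⟩ := distance_factor_le (d := d) (K := K) (m := m) (ℓ := ℓ) (CK := CK) (b := b)
    (c' := c₃ * c) (l := l) (q := q) hCK0 hCK1 hc₂ (by positivity) hX1 hCK'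
    (by
      rw [hCK, hcm, ← mul_assoc]
      gcongr)
    hb0 (by rw [hcm]; gcongr) hl0
    (by
      have e : 1 / l = Real.exp (1 / q * Real.log n) := by
        rw [hl, Real.rpow_neg hn0.le, one_div, inv_inv, Real.rpow_def_of_pos hn0, mul_comm]
      rw [e]; gcongr)
    (by linarith) ((pow_pow_le_exp hℓm hm1).trans (Real.exp_le_exp.mpr (by linarith)))
  rw [← ha₁] at f2
  set D : ℝ := 4 / l * ((K * 2 ^ ℓ + 1) * (CK + 1) * ((48 ^ (m + 2)) ^ (ℓ + 2) *
    ((CK0 + 1) * ((d : ℝ) ^ 2 * (b + 1)) + CK1 + 1))) with hD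
  have hD0 : 0 < D := by positivity
  set ε := 1 / (n * D) with hε
  have hε0 : 0 < ε := by positivity
  set Bm := 4 + CK0 + CK1 + CK with hBm
  have hg := Nat.le_ceil (2 * (Bm / ε) + 1)
  have hg' := (Nat.ceil_lt_add_one (show 0 ≤ 2 * (Bm / ε) + 1 by positivity)).le
  set g := ⌈2 * (Bm / ε) + 1⌉₊ with hgdef
  have hle : ∀ B, B ≤ Bm → 2 * (B / ε) + 1 ≤ g := fun B hB => by
    refine le_trans ?_ hg; gcongr
  have hnet := hasNet_hypothesisSpace (K := K) hε0 hCK0 hCK1 hCK' hd hb0 hl0 (g := g)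
    (hle 4 (by linarith)) (hle CK0 (by linarith)) (hle CK1 (by linarith)) (hle CK (by linarith))
    hm1 ℓ
  rw [← hD, show D * ε = 1 / n by rw [hε]; field_simp] at hnet
  refine ⟨_, hnet, ?_⟩
  have hg1 : (1 : ℝ) ≤ g := le_trans (by linarith [show 0 ≤ Bm / ε by positivity]) hg
  have hgX : Real.log g ≤ a₂ * X := by
    rw [← Real.log_exp (a₂ * X)]
    refine Real.log_le_log (by linarith) ?_
    have h1 : 1 ≤ Real.exp ((1 + a₁) * X) := Real.one_le_exp (by positivity)
    have h2 : n * D ≤ Real.exp ((1 + a₁) * X) := by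
      rw [add_mul, Real.exp_add]
      refine mul_le_mul ?_ f2 hD0.le (Real.exp_pos _).le
      rw [← Real.exp_log hn0, Real.exp_le_exp]; linarith
    have h3 : 2 * (Bm + 1) ≤ Real.exp ((2 * (5 + CK0 + CK1)) * X) *
        Real.exp ((1 + c₂ + c₃ * c) * X) := by
      calc 2 * (Bm + 1) ≤ (2 * (5 + CK0 + CK1)) * (CK + 1) := by
            rw [hBm]
            have := mul_nonneg (show 0 ≤ 4 + CK0 + CK1 by positivity) hCK'
            linarith
        _ ≤ _ := mul_le_mul (le_exp_mul (by positivity) hX1) f1 (by positivity) (Real.exp_pos _).le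
    have h4 : Bm / ε = Bm * (n * D) := by rw [hε]; field_simp
    rw [ha₂, add_mul, add_mul, Real.exp_add, Real.exp_add]
    calc (g : ℝ) ≤ 2 * (Bm * (n * D)) + 1 + 1 := by rw [← h4]; exact hg'
      _ ≤ 2 * (Bm * Real.exp ((1 + a₁) * X)) + 1 + 1 := by gcongr
      _ ≤ 2 * (Bm + 1) * Real.exp ((1 + a₁) * X) := by linarith
      _ ≤ _ := mul_le_mul_of_nonneg_right h3 (Real.exp_pos _).le
  have hE := numParams_le d K hm1 h2m
  set E := d * K * d + d * K + 2 * (d * K * (30 * m + 10)) + (2 ^ ℓ + 1) * K * (30 * m + 10) +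
      (2 ^ ℓ + 1) * K + 1
  have hE' : (E : ℝ) ≤ a₃ * m ^ 2 := by
    rw [ha₃]; exact_mod_cast hE
  have hgE : (1 : ℝ) ≤ (g : ℝ) ^ E := one_le_pow₀ hg1
  have hlg : 0 ≤ Real.log g := Real.log_nonneg hg1
  calc Real.log ((g ^ E : ℕ) + 1) ≤ Real.log (2 * (g : ℝ) ^ E) := by
        push_cast
        exact Real.log_le_log (by positivity) (by linarith)
    _ = Real.log 2 + E * Real.log g := by
        rw [Real.log_mul (by norm_num) (by positivity), Real.log_pow]
    _ ≤ 1 + (a₃ * m ^ 2) * (a₂ * X) := by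
        have := Real.log_two_lt_d9
        gcongr
        linarith
    _ ≤ m ^ 2 * X + (a₃ * m ^ 2) * (a₂ * X) := by
        gcongr
        exact one_le_mul_of_one_le_of_one_le (hm1'.trans hmm) hX1
    _ = (1 + a₃ * a₂) * (m ^ 2 * X) := by ring

/-! ### Excess risk in the mixture model -/

namespace GaussianMixture

variable {d K : ℕ} (G : GaussianMixture d K)

theorem law_ae : ∀ᵐ z ∂G.law, z.2 = 1 ∨ z.2 = -1 := by
  rw [law_eq_twoDensityLaw]; exact twoDensityLaw_ae _ _ _

theorem abs_bayes_le_one {X : Type*} [MeasurableSpace X] (ρ : Measure (X × ℝ)) (x : X) :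
    |bayes ρ x| ≤ 1 := by
  rcases bayes_eq_or ρ x with h | h <;> simp [h]

theorem hingeRisk_sub_bayes_le_two {f : EuclideanSpace ℝ (Fin d) → ℝ} (hf : Measurable f)
    (hf1 : ∀ x, |f x| ≤ 1) : hingeRisk G.law f - hingeRisk G.law (bayes G.law) ≤ 2 := by
  have := hingeRisk_le_add G.law_ae hf hf1 (measurable_bayes G.law) (abs_bayes_le_one G.law)
    (τ := 2) fun x => (abs_sub _ _).trans (by linarith [hf1 x, abs_bayes_le_one G.law x])
  linarith

theorem misclassError_sub_bayes_le {f : EuclideanSpace ℝ (Fin d) → ℝ} (hf : Measurable f)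
    (hf1 : ∀ x, |f x| ≤ 1) :
    misclassError G.law (fun x => sgn (f x)) - misclassError G.law (bayes G.law) ≤
      hingeRisk G.law f - hingeRisk G.law (bayes G.law) := by
  rw [law_eq_twoDensityLaw]
  exact misclassError_sub_le_hingeRisk_sub G.continuous_discrPos.measurable
    G.continuous_discrNeg.measurable G.discrPos_nonneg G.discrNeg_nonneg G.integrable_discrPos
    G.integrable_discrNeg G.discrPos_add_discrNeg_pos hf hf1

/-- Under the noise condition the second moment of the excess loss is controlled by the excess
risk. -/
theorem mul_integral_sq_excess_le {c₀ q : ℝ} (hc₀ : 0 < c₀) (hnoise : G.NoiseCondition c₀ q)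
    {r : ℝ} (hr : 0 < r) {f : EuclideanSpace ℝ (Fin d) → ℝ} (hf : Measurable f)
    (hf1 : ∀ x, |f x| ≤ 1) :
    r * ∫ z, (hinge (z.2 * f z.1) - hinge (z.2 * bayes G.law z.1)) ^ 2 ∂G.law ≤
      (hingeRisk G.law f - hingeRisk G.law (bayes G.law)) / 2 +
        4 * c₀ * (r * (4 * (∑ j, |G.coeff j|) * r) ^ q) := by
  have hS := G.sum_abs_coeff_pos
  set S := ∑ j, |G.coeff j|
  -- The threshold `t = 4 * S * r` makes the coefficient of the excess risk equal to `1 / 2`.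
  have ht : 0 < 4 * S * r := by positivity
  have h1 := hnoise.setIntegral_le hc₀ ht
  have h2 := integral_sq_excess_le (ν := volume) G.continuous_discrPos.measurable
    G.continuous_discrNeg.measurable G.discrPos_nonneg G.discrNeg_nonneg G.integrable_discrPos
    G.integrable_discrNeg G.discrPos_add_discrNeg_pos hf hf1 ht G.discrPos_add_discrNeg_le
  rw [← law_eq_twoDensityLaw] at h2
  have e : S / (4 * S * r) = 1 / (4 * r) := by field_simp
  rw [e] at h2
  have h3 := mul_le_mul_of_nonneg_left h2 hr.le
  have e2 : ∀ x y : ℝ, r * (4 * x + 2 * (1 / (4 * r)) * y) = 4 * (r * x) + y / 2 := fun x y => by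
    field_simp; ring
  rw [e2] at h3
  have h4 := mul_le_mul_of_nonneg_left h1 hr.le
  linarith

/-- The excess risk of a scaled approximation of the discriminant function. -/
theorem hingeRisk_scaling_sub_le {c₀ q : ℝ} (hc₀ : 0 < c₀) (hnoise : G.NoiseCondition c₀ q)
    {g : EuclideanSpace ℝ (Fin d) → ℝ} {l η b : ℝ} (hl : 0 < l) (hη : 0 ≤ η)
    (hg : ∀ x : EuclideanSpace ℝ (Fin d), (∀ i, |x i| ≤ b) → |g x - G.discr x| ≤ η)
    (hgm : Measurable fun x => scaling l (g x)) :
    hingeRisk G.law (fun x => scaling l (g x)) - hingeRisk G.law (bayes G.law) ≤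
      2 * (c₀ * (l + η) ^ q) + 2 *
        ∫ x in {x : EuclideanSpace ℝ (Fin d) | ∀ i, |x i| ≤ b}ᶜ, (G.discrPos x + G.discrNeg x) := by
  have hm : MeasurableSet {x : EuclideanSpace ℝ (Fin d) | ∀ i, |x i| ≤ b} := by
    rw [Set.ofPred_forall]
    exact MeasurableSet.iInter fun i =>
      (isClosed_le (by fun_prop) continuous_const).measurableSet
  -- Where `|D| > l + η` on the cube, the scaling unit returns exactly the sign of `D`.
  have h1 := hnoise.setIntegral_le hc₀ (add_pos_of_pos_of_nonneg hl hη)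
  have h2 := hingeRisk_sub_le_of_eq_sign (ν := volume) G.continuous_discrPos.measurable
    G.continuous_discrNeg.measurable G.discrPos_nonneg G.discrNeg_nonneg G.integrable_discrPos
    G.integrable_discrNeg G.discrPos_add_discrNeg_pos hgm (fun x => abs_scaling_le_one hl _) hm
    (t := l + η) fun x hx ht => by
      have h := abs_le.mp (hg x hx)
      rw [discr] at h
      rw [scaling_eq hl]
      rcases le_total 0 (G.discrPos x - G.discrNeg x) with h0 | h0
      · rw [abs_of_nonneg h0] at ht ⊢
        rw [if_pos (by linarith), one_mul]
      · rw [abs_of_nonpos h0] at ht ⊢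
        rw [if_neg (by linarith), if_neg (by linarith)]; ring
  rw [← law_eq_twoDensityLaw] at h2
  linarith

/-! ### The choice of the parameters -/

theorem cPrime_eigMax_pos (hd : 1 ≤ d) {q c₃ : ℝ} (hq : 0 < q) (hc₃ : 0 ≤ c₃) :
    0 < cPrime q c₃ G.eigMax := by
  have := G.eigMax_pos hd
  have := Real.log_pos one_lt_two
  unfold cPrime; positivity

theorem four_le_mul_eigMax (hd : 1 ≤ d) {CK0 CK1 c₃ : ℝ}
    (hCK0 : Real.sqrt d / Real.sqrt G.eigMin ≤ CK0) (hCK1 : 0 ≤ CK1)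
    (hc₃ : 4 * (d : ℝ) ^ 2 * (CK0 + CK1) ^ 2 ≤ c₃) : 4 ≤ G.eigMax * c₃ := by
  have hσ := G.eigMin_pos hd
  have hσ' := G.eigMin_le_eigMax hd
  have hd1 : (1 : ℝ) ≤ d := by exact_mod_cast hd
  have h1 : (d : ℝ) / G.eigMin ≤ (CK0 + CK1) ^ 2 := by
    have e : (Real.sqrt d / Real.sqrt G.eigMin) ^ 2 = d / G.eigMin := by
      rw [div_pow, Real.sq_sqrt (by positivity), Real.sq_sqrt hσ.le]
    rw [← e]
    exact pow_le_pow_left₀ (by positivity) (by linarith) 2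
  have h2 : (1 : ℝ) / G.eigMin ≤ d / G.eigMin := by gcongr
  have h3 : 1 / G.eigMin ≤ (d : ℝ) ^ 2 * (CK0 + CK1) ^ 2 :=
    (h2.trans h1).trans (le_mul_of_one_le_left (sq_nonneg _) (one_le_pow₀ hd1))
  have h4 : 4 / G.eigMin ≤ c₃ := by
    have : 4 / G.eigMin = 4 * (1 / G.eigMin) := by ring
    linarith
  rw [div_le_iff₀ hσ] at h4
  nlinarith [show 0 ≤ c₃ from le_trans (by positivity) hc₃]

/-- The consequences of the choice of the depth `ℓ` and of the number `m = ℓ * 2 ^ (ℓ - 1)` of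
hidden layers of the gates. -/
theorem depth_bounds (hd : 1 ≤ d) {q c₃ : ℝ} (hq : 0 < q) (hc₃0 : 0 ≤ c₃)
    (hc₃ : 4 ≤ G.eigMax * c₃) {n ℓ m : ℕ} (hn : 1 ≤ Real.log n)
    (hℓ : IsLeast {k : ℕ | 16 * G.eigMax / cPrime q c₃ G.eigMax * Real.log n ≤
      (k : ℝ) * 2 ^ (k - 1)} ℓ) (hm : m = ℓ * 2 ^ (ℓ - 1)) :
    1 ≤ ℓ ∧ (1 / q + 64) * Real.log n ≤ m * Real.log 2 ∧
      16 * G.eigMax * Real.log n ≤ cPrime q c₃ G.eigMax * m ∧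
      (m : ℝ) ≤ (64 * G.eigMax / cPrime q c₃ G.eigMax + 1) * Real.log n := by
  have hσ := G.eigMax_pos hd
  have hc := G.cPrime_eigMax_pos hd hq hc₃0
  have hl2 := Real.log_pos one_lt_two
  have hm' : (m : ℝ) = ℓ * 2 ^ (ℓ - 1) := by rw [hm]; push_cast; ring
  have h1 : 16 * G.eigMax / cPrime q c₃ G.eigMax * Real.log n ≤ m := by rw [hm']; exact hℓ.1
  have h0 : 0 < 16 * G.eigMax / cPrime q c₃ G.eigMax * Real.log n := by positivity
  have hℓ1 : 1 ≤ ℓ := by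
    rcases Nat.eq_zero_or_pos ℓ with rfl | h
    · rw [hm'] at h1; simp at h1; linarith
    · exact h
  refine ⟨hℓ1, ?_, ?_, ?_⟩
  · have e : 16 * G.eigMax / cPrime q c₃ G.eigMax = (1 / q + 16 * (G.eigMax * c₃)) / Real.log 2 := by
      unfold cPrime; field_simp
    rw [e, div_mul_eq_mul_div, div_le_iff₀ hl2] at h1
    refine le_trans ?_ h1
    gcongr; linarith
  · rw [div_mul_eq_mul_div, div_le_iff₀ hc] at h1
    linarith
  · obtain ⟨k, rfl⟩ := Nat.exists_eq_add_of_le' hℓ1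
    set A := G.eigMax / cPrime q c₃ G.eigMax with hA
    have hA0 : 0 < A := by positivity
    have e1 : 64 * G.eigMax / cPrime q c₃ G.eigMax = 64 * A := by rw [hA]; ring
    rw [e1]
    rcases Nat.eq_zero_or_pos k with rfl | hk
    · rw [hm']; norm_num; nlinarith
    -- By minimality, `k * 2 ^ (k - 1)` is too small, and `m` is at most four times as large.
    · have h2 : ¬ (16 * G.eigMax / cPrime q c₃ G.eigMax * Real.log n ≤ (k : ℝ) * 2 ^ (k - 1)) :=
        fun h => by have := hℓ.2 h; omega
      obtain ⟨i, rfl⟩ := Nat.exists_eq_add_of_le' hk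
      rw [show 16 * G.eigMax / cPrime q c₃ G.eigMax = 16 * A by rw [hA]; ring] at h2
      rw [hm']
      simp only [Nat.add_sub_cancel] at h2 ⊢
      push_cast at h2 ⊢
      rw [pow_succ]
      have h3 : (0 : ℝ) < 2 ^ i := by positivity
      have h4 : (0 : ℝ) ≤ i * 2 ^ i := by positivity
      nlinarith

end GaussianMixture

/-! ### The learning rate -/

namespace GaussianMixture

variable {d K : ℕ} (G : GaussianMixture d K)

/-- For deep networks the hypothesis space contains a function of small excess risk. -/
theorem exists_mem_hypothesisSpace_risk_le (hd : 1 ≤ d) {q c₀ CK0 CK1 c₂ c₃ : ℝ} (hq : 0 < q)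
    (hc₀ : 0 < c₀) (hCK0 : Real.sqrt d / Real.sqrt G.eigMin ≤ CK0)
    (hCK1 : G.meanBound / Real.sqrt G.eigMin ≤ CK1) (hc₂ : ∑ j, |G.coeff j| ≤ c₂) (hc₃ : 0 < c₃)
    (hnoise : G.NoiseCondition c₀ q) :
    ∃ C : ℝ, 0 ≤ C ∧ ∃ ℓ₀ : ℕ, ∀ (n ℓ m : ℕ) (l b CK : ℝ), ℓ₀ ≤ ℓ → 1 ≤ Real.log n →
      (1 / q + 64) * Real.log n ≤ m * Real.log 2 →
      16 * G.eigMax * Real.log n ≤ cPrime q c₃ G.eigMax * m → m = ℓ * 2 ^ (ℓ - 1) →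
      l = (n : ℝ) ^ (-(1 / q)) → b = Real.sqrt (cPrime q c₃ G.eigMax * m) →
      CK = c₂ * Real.exp (c₃ * b ^ 2) → ∃ f ∈ hypothesisSpace d K CK0 CK1 CK l b m ℓ,
        hingeRisk G.law f - hingeRisk G.law (bayes G.law) ≤
          C * (1 / (n : ℝ)) ^ ((q + 1) / (q + 2)) := by
  have hc := G.cPrime_eigMax_pos hd hq hc₃.le
  have hσ := G.eigMax_pos hd
  have hl2 := Real.log_pos one_lt_two
  set c := cPrime q c₃ G.eigMax with hcdef
  -- The loss `θ` in the exponent `m / 2` is such that `m * log 2 ≥ (1 / q + 64) * log n` still gives an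
  -- approximation error of at most `n ^ (-1 / (2 * q) - 1)`.
  set θ : ℝ := 31 / (1 / (2 * q) + 32) with hθ
  have hq' : 0 < 1 / (2 * q) := by positivity
  have hθ0 : 0 < θ := by positivity
  have hθ1 : θ < 1 := by rw [hθ, div_lt_one (by positivity)]; linarith
  have hev := G.eventually_exists_net hd hCK0 hCK1 hc₂ hc₃ hc
    (ξ := Real.log 2 / 2 * θ) (by positivity)
  obtain ⟨p₀, hp₀⟩ := Filter.eventually_atTop.mp
    (hev.and (eventually_mul_succ_le_two_pow (16 * G.meanBound ^ 2) hc))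
  obtain ⟨Ct, hCt, htail⟩ := G.exists_setIntegral_compl_cube_le hd
  refine ⟨2 * (c₀ * 2 ^ q) + 2 * Ct, by positivity, p₀ + 1, ?_⟩
  intro n ℓ m l b CK hℓ hn h1 h2 hm hl hb hCK
  obtain ⟨p, rfl⟩ := Nat.exists_eq_add_of_le' (show 1 ≤ ℓ by omega)
  rw [Nat.add_sub_cancel] at hm
  obtain ⟨hnet, hmean⟩ := hp₀ p (by omega)
  obtain ⟨P, hP, happ⟩ := hnet m b CK hm hb hCK
  have hn0 : (0 : ℝ) < n := by
    rcases Nat.eq_zero_or_pos n with rfl | h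
    · norm_num at hn
    · exact_mod_cast h
  have hl0 : 0 < l := by rw [hl]; positivity
  have hb2 : b ^ 2 = c * m := by rw [hb, Real.sq_sqrt (by positivity)]
  have hb0 : 0 ≤ b := by rw [hb]; positivity
  have hμ := G.meanBound_nonneg
  have hm' : (m : ℝ) = (p + 1) * 2 ^ p := by rw [hm]; push_cast; ring
  have hbμ : 4 * G.meanBound ≤ b := by
    refine (sq_le_sq₀ (by positivity) hb0).mp ?_
    rw [hb2, hm']
    have : (0 : ℝ) < 2 ^ p := by positivity
    have hp0 : (0 : ℝ) ≤ p := p.cast_nonneg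
    have h3 : 0 ≤ c * p * 2 ^ p := by positivity
    have h4 : 0 ≤ G.meanBound ^ 2 * p := by positivity
    nlinarith
  set x := Real.log n with hx
  set α := (q + 1) / (q + 2) with hα
  have hα0 : 0 < α := by positivity
  have hα1 : α ≤ 1 := by rw [hα, div_le_one (by positivity)]; linarith
  have hαq : α / q ≤ 1 / (2 * q) + 1 / 4 := by
    rw [hα, div_div, div_add_div _ _ (by positivity) (by positivity),
      div_le_div_iff₀ (by positivity) (by positivity)]
    nlinarith [pow_pos hq 2, pow_pos hq 3]
  have hpow : ∀ y : ℝ, (1 / (n : ℝ)) ^ y = Real.exp (-(y * x)) := fun y => by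
    rw [Real.rpow_def_of_pos (by positivity), one_div, Real.log_inv]; congr 1; ring
  set η := Real.exp (-((Real.log 2 / 2 - Real.log 2 / 2 * θ) * m)) with hη
  -- The approximation error and the width of the scaling unit are both of order `n ^ (-α / q)`.
  have hηle : η ≤ Real.exp (-(α / q * x)) := by
    rw [hη, Real.exp_le_exp, neg_le_neg_iff]
    have h3 : (1 - θ) * (1 / (2 * q) + 32) = 1 / (2 * q) + 1 := by rw [hθ]; field_simp; ring
    have h4 : (1 - θ) * ((1 / q + 64) * x) ≤ (1 - θ) * (m * Real.log 2) :=
      mul_le_mul_of_nonneg_left h1 (by linarith)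
    have h5 : (1 - θ) * ((1 / q + 64) * x) = 2 * ((1 - θ) * (1 / (2 * q) + 32)) * x := by
      field_simp; ring
    rw [h5, h3] at h4
    have h6 : α / q * x ≤ (1 / (2 * q) + 1 / 4) * x := by gcongr
    linarith
  have hlle : l ≤ Real.exp (-(α / q * x)) := by
    rw [hl, Real.rpow_def_of_pos hn0, ← hx, Real.exp_le_exp]
    have : α / q * x ≤ 1 / q * x := by gcongr
    linarith
  have hmem : P.toFun l b m (p + 1) ∈ hypothesisSpace d K CK0 CK1 CK l b m (p + 1) := ⟨P, hP, rfl⟩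
  refine ⟨_, hmem, ?_⟩
  have hrisk := G.hingeRisk_scaling_sub_le hc₀ hnoise (b := b) hl0 (Real.exp_pos _).le happ
    (measurable_of_mem_hypothesisSpace hl0 hmem).1
  refine hrisk.trans ?_
  rw [add_mul, hpow]
  have e1 : (l + η) ^ q ≤ 2 ^ q * Real.exp (-(α * x)) := by
    calc (l + η) ^ q ≤ (2 * Real.exp (-(α / q * x))) ^ q :=
          Real.rpow_le_rpow (by positivity) (by linarith) hq.le
      _ = _ := by
          rw [Real.mul_rpow (by norm_num) (Real.exp_pos _).le, ← Real.exp_mul]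
          congr 2; field_simp
  have e2 : Real.exp (-(b ^ 2 / (8 * G.eigMax))) ≤ Real.exp (-(α * x)) := by
    rw [Real.exp_le_exp, neg_le_neg_iff, le_div_iff₀ (by positivity), hb2]
    calc α * x * (8 * G.eigMax) ≤ 1 * x * (16 * G.eigMax) := by gcongr; norm_num
      _ = 16 * G.eigMax * x := by ring
      _ ≤ c * m := h2
  have e3 := (htail b hbμ).trans (mul_le_mul_of_nonneg_left e2 hCt)
  have e4 := mul_le_mul_of_nonneg_left e1 hc₀.le
  linarith

/-- The parameter `r` of the oracle inequality that balances the variance term and the deviation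
term. -/
theorem exists_step {q n : ℝ} (hq : 0 < q) (hn1' : 1 ≤ n) :
    ∃ r : ℝ, 0 < r ∧ r ≤ 1 / 2 ∧ r * r ^ q ≤ (1 / n) ^ ((q + 1) / (q + 2)) ∧
      1 / (r * n) = 2 * (1 / n) ^ ((q + 1) / (q + 2)) := by
  have hn0 : 0 < n := by linarith
  set α := (q + 1) / (q + 2) with hα
  set ρ := (1 / n) ^ α with hρ
  set r := 1 / 2 * (1 / n) ^ (1 / (q + 2)) with hr
  have hr0 : 0 < r := by positivity
  have hr1 : r ≤ 1 / 2 := by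
    rw [hr]
    have : (1 / n) ^ (1 / (q + 2)) ≤ 1 :=
      Real.rpow_le_one (by positivity) (div_le_one_of_le₀ hn1' hn0.le) (by positivity)
    linarith
  have hrq : r * r ^ q ≤ ρ := by
    rw [← Real.rpow_one_add' hr0.le (by positivity)]
    calc r ^ (1 + q) ≤ ((1 / n) ^ (1 / (q + 2))) ^ (1 + q) := by
          refine Real.rpow_le_rpow hr0.le ?_ (by positivity)
          rw [hr]
          linarith [show (0 : ℝ) ≤ (1 / n) ^ (1 / (q + 2)) by positivity]
      _ = ρ := by
          rw [← Real.rpow_mul (by positivity), hρ, hα]; congr 1; field_simp; ring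
  have hrn : 1 / (r * n) = 2 * ρ := by
    have h1 : (1 / n) ^ (1 / (q + 2)) * ρ = 1 / n := by
      rw [hρ, ← Real.rpow_add (by positivity)]
      have : 1 / (q + 2) + α = 1 := by rw [hα]; field_simp; ring
      rw [this, Real.rpow_one]
    have h2 : r * ρ = 1 / (2 * n) := by
      rw [hr, mul_assoc, h1]; field_simp
    rw [div_eq_iff (by positivity)]
    calc (1 : ℝ) = 2 * n * (1 / (2 * n)) := by field_simp
      _ = 2 * ρ * (r * n) := by rw [← h2]; ring
  exact ⟨r, hr0, hr1, hrq, hrn⟩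

/-- The learning rate for deep networks: the oracle inequality with a net at distance `1 / n`. -/
theorem exists_rate (hd : 1 ≤ d) {q c₀ CK0 CK1 c₂ c₃ : ℝ} (hq : 0 < q)
    (hc₀ : 0 < c₀) (hCK0 : Real.sqrt d / Real.sqrt G.eigMin ≤ CK0)
    (hCK1 : G.meanBound / Real.sqrt G.eigMin ≤ CK1) (hc₂ : ∑ j, |G.coeff j| ≤ c₂)
    (hc₃ : 4 ≤ G.eigMax * c₃) (hc₃0 : 0 < c₃) (hnoise : G.NoiseCondition c₀ q) :
    ∃ C : ℝ, 0 ≤ C ∧ ∃ ℓ₀ : ℕ, ∀ (n ℓ m : ℕ) (l b CK δ : ℝ), ℓ₀ ≤ ℓ → 3 ≤ n → 1 ≤ Real.log n →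
      IsLeast {k : ℕ | 16 * G.eigMax / cPrime q c₃ G.eigMax * Real.log n ≤
        (k : ℝ) * 2 ^ (k - 1)} ℓ → m = ℓ * 2 ^ (ℓ - 1) → l = (n : ℝ) ^ (-(1 / q)) →
      b = Real.sqrt (cPrime q c₃ G.eigMax * m) → CK = c₂ * Real.exp (c₃ * b ^ 2) →
      0 < δ → δ < 1 → Measure.pi (fun _ : Fin n => G.law)
        {z | ¬ ∀ f, IsERM (hypothesisSpace d K CK0 CK1 CK l b m ℓ) z f →
          hingeRisk G.law f - hingeRisk G.law (bayes G.law) ≤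
            C * Real.log (2 / δ) * Real.log n ^ 4 * (1 / (n : ℝ)) ^ ((q + 1) / (q + 2))} ≤
        ENNReal.ofReal δ := by
  have hc := G.cPrime_eigMax_pos hd hq hc₃0.le
  have hσ := G.eigMax_pos hd
  have hl2 := Real.log_pos one_lt_two
  have hCK0' : 0 ≤ CK0 := le_trans (by positivity) hCK0
  have hCK1' : 0 ≤ CK1 := le_trans (div_nonneg G.meanBound_nonneg (Real.sqrt_nonneg _)) hCK1
  have hS := G.sum_abs_coeff_pos
  have hc₂' : 0 ≤ c₂ := hS.le.trans hc₂
  obtain ⟨A₁, hA₁, ℓ₀, happ⟩ := G.exists_mem_hypothesisSpace_risk_le hd hq hc₀ hCK0 hCK1 hc₂ hc₃0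
    hnoise
  obtain ⟨A₃, hA₃, hnet⟩ := exists_hasNet_log_le d K hd hCK0' hCK1' hc₂' hc₃0.le hc.le hq
  set c := cPrime q c₃ G.eigMax with hcdef
  set S := ∑ j, |G.coeff j| with hSdef
  set A₂ := 4 * c₀ * (4 * S) ^ q with hA₂def
  have hA₂ : 0 ≤ A₂ := by positivity
  set A₄ := 64 * G.eigMax / c + 1 with hA₄def
  have hA₄ : 0 ≤ A₄ := by positivity
  set A₅ := A₃ * (A₄ ^ 2 * (A₄ ^ 2 + 1)) with hA₅def
  have hA₅ : 0 ≤ A₅ := by positivity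
  refine ⟨2 * (3 * A₁ + 4 * A₂ + 3) + 16 * A₅ + 8, by positivity, ℓ₀, ?_⟩
  intro n ℓ m l b CK δ hℓ hn hn1 hleast hm hl hb hCK hδ hδ1
  obtain ⟨hℓ1, d1, d2, d3⟩ := G.depth_bounds hd hq hc₃0.le hc₃ hn1 hleast hm
  obtain ⟨f₀, hf₀, hrisk⟩ := happ n ℓ m l b CK hℓ hn1 d1 d2 hm hl hb hCK
  obtain ⟨N, ⟨T, hTN, hTH, hT⟩, hN⟩ := hnet n ℓ m l b CK hn hℓ1 hm hl hb hCK
  have hn0 : (0 : ℝ) < n := by exact_mod_cast (by omega : 0 < n)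
  have hn1' : (1 : ℝ) ≤ n := by exact_mod_cast (by omega : 1 ≤ n)
  have hl0 : 0 < l := by rw [hl]; positivity
  set x := Real.log n with hx
  set α := (q + 1) / (q + 2) with hα
  have hα0 : 0 < α := by positivity
  have hα1 : α ≤ 1 := by rw [hα, div_le_one (by positivity)]; linarith
  set ρ := (1 / (n : ℝ)) ^ α with hρ
  have hρ0 : 0 < ρ := by positivity
  have hnρ : 1 / (n : ℝ) ≤ ρ := by
    rw [hρ]
    calc 1 / (n : ℝ) = (1 / (n : ℝ)) ^ (1 : ℝ) := (Real.rpow_one _).symm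
      _ ≤ _ := Real.rpow_le_rpow_of_exponent_ge (by positivity)
        (div_le_one_of_le₀ hn1' hn0.le) hα1
  obtain ⟨r, hr0, hr1, hrq, hrn⟩ := exists_step hq hn1'
  -- The union bound over the net and the competitor `f₀` costs `log (N + 1)`.
  set s := Real.log (N + 1) + Real.log (1 / δ) with hs
  have hprob : ((T.card : ℝ) + 1) * Real.exp (-s) ≤ δ := by
    have hN1 : (0 : ℝ) < N + 1 := by positivity
    have e : Real.exp (-s) = δ / (N + 1) := by
      rw [hs, one_div, Real.log_inv, neg_add, neg_neg, Real.exp_add, Real.exp_neg, Real.exp_log hN1,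
        Real.exp_log hδ]
      field_simp
    have : (T.card : ℝ) ≤ N := by exact_mod_cast hTN
    rw [e, mul_div_assoc', div_le_iff₀ hN1, mul_comm δ]
    gcongr
  have hmain := pi_isERM_le (ρ := G.law) G.law_ae (n := n) (by omega)
    (H := hypothesisSpace d K CK0 CK1 CK l b m ℓ) (T := T) (τ := 1 / n)
    (fun f hf => measurable_of_mem_hypothesisSpace hl0 hf) hTH hT (measurable_bayes G.law)
    (abs_bayes_le_one G.law) hf₀ hr0 hr1 (v := A₂ * ρ)
    (fun f hf => by
      obtain ⟨hf, hf1⟩ := measurable_of_mem_hypothesisSpace hl0 hf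
      refine (G.mul_integral_sq_excess_le hc₀ hnoise hr0 hf hf1).trans ?_
      rw [Real.mul_rpow (by positivity) hr0.le, hA₂def]
      have := mul_le_mul_of_nonneg_left hrq hA₂
      rw [hA₂def] at this
      linarith) s
  refine le_trans (measure_mono ?_) (hmain.trans (ENNReal.ofReal_le_ofReal hprob))
  intro z hz hz'
  refine hz fun f hf => (hz' f hf).trans ?_
  have hL : Real.log (2 / δ) = Real.log 2 + Real.log (1 / δ) := by
    rw [← Real.log_mul (by norm_num) (by positivity)]; congr 1; ring
  have hLδ : 0 ≤ Real.log (1 / δ) := Real.log_nonneg (by rw [le_div_iff₀ hδ]; linarith)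
  set Λ := Real.log (2 / δ)
  have hΛ : 1 / 2 ≤ Λ := by rw [hL]; linarith [Real.log_two_gt_d9]
  have hx4 : 1 ≤ x ^ 4 := one_le_pow₀ hn1
  have hN' : Real.log (N + 1) ≤ A₅ * x ^ 4 := by
    refine hN.trans ?_
    have h1 : (m : ℝ) ^ 2 ≤ A₄ ^ 2 * x ^ 2 := by
      rw [← mul_pow]; exact pow_le_pow_left₀ m.cast_nonneg d3 2
    have h2 : (m : ℝ) ^ 2 + x ≤ (A₄ ^ 2 + 1) * x ^ 2 := by
      linarith [le_self_pow₀ hn1 two_ne_zero]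
    calc A₃ * ((m : ℝ) ^ 2 * ((m : ℝ) ^ 2 + x)) ≤
          A₃ * (A₄ ^ 2 * x ^ 2 * ((A₄ ^ 2 + 1) * x ^ 2)) := by gcongr
      _ = _ := by rw [hA₅def]; ring
  have hsn : s / (r * n) = 2 * (s * ρ) := by
    rw [div_eq_mul_one_div, hrn]; ring
  rw [hsn]
  have hs' : s ≤ A₅ * x ^ 4 + Λ := by rw [hs, hL]; linarith
  have h2 : Λ ≤ Λ * x ^ 4 := le_mul_of_one_le_right (by linarith) hx4
  have h3 : x ^ 4 ≤ 2 * (Λ * x ^ 4) := by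
    linarith [mul_le_mul_of_nonneg_right hΛ (zero_le_one.trans hx4)]
  have h1 : 1 ≤ 2 * (Λ * x ^ 4) := hx4.trans h3
  have h4 : 3 * (A₁ * ρ) + 4 * (A₂ * ρ) + 8 * (s * ρ) + 3 * ρ ≤
      (2 * (3 * A₁ + 4 * A₂ + 3) + 16 * A₅ + 8) * (Λ * x ^ 4) * ρ := by
    have h5 : 3 * A₁ + 4 * A₂ + 8 * s + 3 ≤
        (2 * (3 * A₁ + 4 * A₂ + 3) + 16 * A₅ + 8) * (Λ * x ^ 4) := by
      have h6 := mul_le_mul_of_nonneg_left h1 (show 0 ≤ 3 * A₁ + 4 * A₂ + 3 by positivity)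
      have h7 := mul_le_mul_of_nonneg_left h3 hA₅
      linarith
    have := mul_le_mul_of_nonneg_right h5 hρ0.le
    linarith
  linarith

end GaussianMixture

end GMMClassification

end

theorem theorem3 {d K : ℕ} (hd : 1 ≤ d) (G : GMMClassification.GaussianMixture d K)
    (q c₀ CK0 CK1 c₂ c₃ : ℝ) (hq : 0 < q) (hc₀ : 0 < c₀)
    (hCK0 : Real.sqrt d / Real.sqrt G.eigMin ≤ CK0)
    (hCK1 : G.meanBound / Real.sqrt G.eigMin ≤ CK1)
    (hc₂ : ∑ j, |G.coeff j| ≤ c₂)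
    (hc₃ : 4 * (d : ℝ) ^ 2 * (CK0 + CK1) ^ 2 ≤ c₃)
    (hnoise : G.NoiseCondition c₀ q) :
    ∃ C : ℝ, 0 < C ∧ ∀ (n ℓ m : ℕ) (l b CK δ : ℝ), 3 ≤ n →
      IsLeast {k : ℕ | 16 * G.eigMax / GMMClassification.cPrime q c₃ G.eigMax * Real.log n ≤
        (k : ℝ) * 2 ^ (k - 1)} ℓ →
      m = ℓ * 2 ^ (ℓ - 1) →
      l = (n : ℝ) ^ (-(1 / q)) →
      b = Real.sqrt (GMMClassification.cPrime q c₃ G.eigMax * ((ℓ : ℝ) * 2 ^ (ℓ - 1))) →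
      CK = c₂ * Real.exp (c₃ * b ^ 2) →
      0 < δ → δ < 1 →
      MeasureTheory.Measure.pi (fun _ : Fin n => G.law)
        {z | ¬ ∀ f : EuclideanSpace ℝ (Fin d) → ℝ,
          GMMClassification.IsERM
            (GMMClassification.hypothesisSpace d K CK0 CK1 CK l b m ℓ) z f →
          GMMClassification.misclassError G.law (fun x => GMMClassification.sgn (f x)) -
              GMMClassification.misclassError G.law (GMMClassification.bayes G.law) ≤
            GMMClassification.hingeRisk G.law f -
              GMMClassification.hingeRisk G.law (GMMClassification.bayes G.law) ∧
          GMMClassification.hingeRisk G.law f -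
              GMMClassification.hingeRisk G.law (GMMClassification.bayes G.law) ≤
            C * Real.log (2 / δ) * Real.log n ^ 4 * (1 / (n : ℝ)) ^ ((q + 1) / (q + 2))} ≤
        ENNReal.ofReal δ := by
  have hCK1' : 0 ≤ CK1 := le_trans (div_nonneg G.meanBound_nonneg (Real.sqrt_nonneg _)) hCK1
  have h4 := G.four_le_mul_eigMax hd hCK0 hCK1' hc₃
  have hσ := G.eigMax_pos hd
  have hc₃0 : 0 < c₃ := by
    by_contra! h
    nlinarith
  have hcp := G.cPrime_eigMax_pos hd hq hc₃0.le
  obtain ⟨C₁, hC₁, ℓ₀, hrate⟩ := G.exists_rate hd hq hc₀ hCK0 hCK1 hc₂ h4 hc₃0 hnoise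
  -- For a depth of at most `ℓ₀`, the sample size is bounded by `exp B`, and the bound holds trivially
  -- as the excess risk is at most `2`.
  set B := GMMClassification.cPrime q c₃ G.eigMax / (16 * G.eigMax) * (ℓ₀ * 2 ^ ℓ₀) with hB
  set C₂ := 4 * Real.exp B with hC₂
  have hC₂0 : 0 < C₂ := by positivity
  refine ⟨C₁ + C₂, by positivity, fun n ℓ m l b CK δ hn hℓ hm hl hb hCK hδ hδ1 => ?_⟩
  have hn0 : (0 : ℝ) < n := by exact_mod_cast (by omega : 0 < n)
  have hn1 : (1 : ℝ) ≤ n := by exact_mod_cast (by omega : 1 ≤ n)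
  have hlog : 1 ≤ Real.log n := by
    rw [Real.le_log_iff_exp_le hn0]
    have : (3 : ℝ) ≤ n := by exact_mod_cast hn
    linarith [Real.exp_one_lt_d9]
  have hm' : (m : ℝ) = ℓ * 2 ^ (ℓ - 1) := by rw [hm]; push_cast; ring
  rw [← hm'] at hb
  have hl0 : 0 < l := by rw [hl]; positivity
  set ρ := (1 / (n : ℝ)) ^ ((q + 1) / (q + 2)) with hρ
  have hρ0 : 0 < ρ := by positivity
  have hΛ : 1 / 2 ≤ Real.log (2 / δ) := by
    have h1 : Real.log 2 ≤ Real.log (2 / δ) := Real.log_le_log (by norm_num) (by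
      rw [le_div_iff₀ hδ]; linarith)
    linarith [Real.log_two_gt_d9]
  have hx4 : 1 ≤ Real.log n ^ 4 := one_le_pow₀ hlog
  set Λ := Real.log (2 / δ)
  have hΛx : 1 / 2 ≤ Λ * Real.log n ^ 4 := by nlinarith
  have hfirst : ∀ f ∈ GMMClassification.hypothesisSpace d K CK0 CK1 CK l b m ℓ, _ := fun f hf =>
    G.misclassError_sub_bayes_le (GMMClassification.measurable_of_mem_hypothesisSpace hl0 hf).1
      (GMMClassification.measurable_of_mem_hypothesisSpace hl0 hf).2
  rcases le_total ℓ₀ ℓ with h | h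
  · refine le_trans (measure_mono ?_) (hrate n ℓ m l b CK δ h hn hlog hℓ hm hl hb hCK hδ hδ1)
    intro z hz hz'
    refine hz fun f hf => ⟨hfirst f hf.1, (hz' f hf).trans ?_⟩
    have : 0 ≤ C₂ * (Λ * Real.log n ^ 4 * ρ) := by positivity
    linarith
  · refine le_trans (le_of_eq ?_) zero_le
    rw [show {z : Fin n → EuclideanSpace ℝ (Fin d) × ℝ | _} = ∅ from ?_, measure_empty]
    rw [Set.eq_empty_iff_forall_notMem]
    intro z hz
    refine hz fun f hf => ⟨hfirst f hf.1, ?_⟩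
    obtain ⟨h1, h2⟩ := GMMClassification.measurable_of_mem_hypothesisSpace hl0 hf.1
    refine (G.hingeRisk_sub_bayes_le_two h1 h2).trans ?_
    have hnB : (n : ℝ) ≤ Real.exp B := by
      rw [← Real.log_le_iff_le_exp hn0]
      have h3 := hℓ.1
      simp only [Set.mem_ofPred_eq] at h3
      have h5 : (ℓ : ℝ) * 2 ^ (ℓ - 1) ≤ ℓ₀ * 2 ^ ℓ₀ := by
        have h6 : (2 : ℝ) ^ (ℓ - 1) ≤ 2 ^ ℓ₀ := pow_le_pow_right₀ (by norm_num) (by omega)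
        have h7 : (ℓ : ℝ) ≤ ℓ₀ := by exact_mod_cast h
        gcongr
      rw [div_mul_eq_mul_div, div_le_iff₀ hcp] at h3
      rw [hB, div_mul_eq_mul_div, le_div_iff₀ (by positivity)]
      nlinarith
    have hρn : 1 / (n : ℝ) ≤ ρ := by
      calc 1 / (n : ℝ) = (1 / (n : ℝ)) ^ (1 : ℝ) := (Real.rpow_one _).symm
        _ ≤ _ := Real.rpow_le_rpow_of_exponent_ge (by positivity)
          (div_le_one_of_le₀ hn1 hn0.le) (by rw [div_le_one (by positivity)]; linarith)
    have h8 : 1 ≤ Real.exp B * ρ := by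
      rw [div_le_iff₀ hn0] at hρn
      nlinarith
    have h9 : 0 ≤ C₁ * (Λ * Real.log n ^ 4 * ρ) := by positivity
    have h10 : 2 ≤ C₂ * (Λ * Real.log n ^ 4 * ρ) := by
      calc (2 : ℝ) = 4 * (1 / 2) * 1 := by norm_num
        _ ≤ 4 * (Λ * Real.log n ^ 4) * (Real.exp B * ρ) := by gcongr
        _ = _ := by rw [hC₂]; ring
    linarith
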